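/- Let $\ell\in\mathbb R$, $\ell\neq1$, $m\in\mathbb C$, $\varepsilon>0$, $a(t)=t^{\ell}$, $\phi(t)=\frac{t^{1-\ell}}{1-\ell}$ for $t>0$. With the Pauli matrices $\sigma^k$ put $$\gamma^0=\begin{pmatrix}\mathbb I_2&0\\0&-\mathbb I_2\end{pmatrix},\quad \gamma^k=\begin{pmatrix}0&\sigma^k\\-\sigma^k&0\end{pmatrix}\ (k=1,2,3),\quad \gamma^U=\begin{pmatrix}\mathbb I_2&0\\0&0\end{pmatrix},\quad \gamma^L=\begin{pmatrix}0&0\\0&\mathbb I_2\end{pmatrix},$$ $$\mathscr D=i\gamma^0\partial_t+\frac{i}{a(t)}\sum_{k=1}^3\gamma^k\partial_{x_k}+i\,\frac{3\dot a(t)}{2a(t)}\gamma^0-mt^{-1}\mathbb I_4,$$ $$\mathscr D^{co}=it^{-\ell/2}\gamma^0\bigl(t^{im}\gamma^U+t^{-im}\gamma^L\bigr)\partial_t+it^{-3\ell/2}\sum_{k=1}^3\gamma^k\bigl(t^{im}\gamma^U+t^{-im}\gamma^L\bigr)\partial_{x_k}.$$ For $r\in\mathbb R$ let $\mathcal E^w(\cdot,r)$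 be the distribution on $\mathbb R^3$ given by $\langle\mathcal E^w(\cdot,r),\psi\rangle=\partial_r\Bigl(\frac{r}{4\pi}\int_{|\omega|=1}\psi(r\omega)\,d\omega\Bigr)$. For $t,b>0$ with $(\phi(t)+\phi(b))^2>r^2$ put $$E(r,t;b;m)=2^{\frac{2im}{1-\ell}-1}|1-\ell|^{\frac{\ell}{1-\ell}}|\phi(b)|^{\frac{\ell+2im}{1-\ell}}\bigl((\phi(t)+\phi(b))^2-r^2\bigr)^{-\frac{im}{1-\ell}}F\Bigl(\tfrac{im}{1-\ell},\tfrac{im}{1-\ell};1;\tfrac{(\phi(t)-\phi(b))^2-r^2}{(\phi(t)+\phi(b))^2-r^2}\Bigr),$$ $$K_1(r,t;m;\varepsilon)=2^{\frac{2im}{1-\ell}}|\phi(\varepsilon)|^{\frac{2im}{1-\ell}}\phi(\varepsilon)^{-1}\bigl((\phi(t)+\phi(\varepsilon))^2-r^2\bigr)^{-\frac{im}{1-\ell}}F\Bigl(\tfrac{im}{1-\ell},\tfrac{im}{1-\ell};1;\tfrac{(\phi(t)-\phi(\varepsilon))^2-r^2}{(\phi(t)+\phi(\varepsilon))^2-r^2}\Bigr),$$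 where $F$ is the Gauss hypergeometric function, and for smooth functions $f$ on $\mathbb R^3\times\mathbb R$ and $\varphi$ on $\mathbb R^3$ $$\mathcal G(m)[f](x,t)=-2\int_\varepsilon^t b^{\frac\ell2-im}\int_0^{\phi(t)-\phi(b)}E(r,t;b;m)\int_{\mathbb R^3}\mathcal E^w(x-y,r)f(y,b)\,dy\,dr\,db,$$ $$\mathcal K_1(m;\varepsilon)[\varphi](x,t)=-i\,\varepsilon^{1+\frac\ell2-im}(1-\ell)^{-1}\int_0^{\phi(t)-\phi(\varepsilon)}K_1(r,t;m;\varepsilon)\int_{\mathbb R^3}\mathcal E^w(x-y,r)\varphi(y)\,dy\,dr.$$ **Theorem.** The distribution $\mathcal E^w$ is a fundamental solution of the Cauchy problem for the wave equation in Minkowski spacetime: $\mathcal E^w_{rr}-\Delta\mathcal E^w=0$, $\mathcal E^w(\cdot,0)=\delta$, $\mathcal E^w_r(\cdot,0)=0$. Let $F\in C^\infty(\mathbb R^3\times\mathbb R;\mathbb C^4)$ and $\Psi_\varepsilon\in C^\infty(\mathbb R^3;\mathbb C^4)$ (not necessarily of compact support), and let $$\Phi=\begin{pmatrix}\mathcal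 G(m)\mathbb I_2&0\\0&\mathcal G(-m)\mathbb I_2\end{pmatrix}[F]+\gamma^0\begin{pmatrix}\mathcal K_1(m;\varepsilon)\mathbb I_2&0\\0&\mathcal K_1(-m;\varepsilon)\mathbb I_2\end{pmatrix}[\Psi_\varepsilon].$$ Then $\Phi$ is of class $C^2$ on $\mathbb R^3\times(\varepsilon,\infty)$, and the Cauchy problem $$\mathscr D\Psi(x,t)=F(x,t)\quad(t>\varepsilon),\qquad \Psi(x,\varepsilon)=\Psi_\varepsilon(x),$$ has exactly one solution $\Psi$ that is continuous on $\mathbb R^3\times[\varepsilon,\infty)$ and of class $C^1$ on $\mathbb R^3\times(\varepsilon,\infty)$. It is given by $\Psi(x,t)=\mathscr D^{co}\Phi(x,t)$ for $t>\varepsilon$. -/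

import Mathlib

open MeasureTheory Complex
open scoped ContDiff Distributions BoundedContinuousFunction LineDeriv Matrix

noncomputable section

/-- Euclidean space `ℝ³`. -/
abbrev E3 : Type := EuclideanSpace ℝ (Fin 3)

/-- Four-component spinors `(Ψ_U, Ψ_L)`, split into the upper and the lower 2-spinor. -/
abbrev Spinor : Type := Fin 2 ⊕ Fin 2 → ℂ

/-- Complex `4 × 4` matrices, written in `2 × 2` blocks. -/
abbrev Mat4 : Type := Matrix (Fin 2 ⊕ Fin 2) (Fin 2 ⊕ Fin 2) ℂ

/-- The `k`-th standard basis vector of `ℝ³`. -/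
def basisVec (k : Fin 3) : E3 := EuclideanSpace.single k 1

/-! ### Gamma matrices -/

/-- The Pauli matrices `σ¹, σ², σ³`. -/
def pauli : Fin 3 → Matrix (Fin 2) (Fin 2) ℂ :=
  ![!![0, 1; 1, 0], !![0, -I; I, 0], !![1, 0; 0, -1]]

/-- `γ⁰`. -/
def gamma0 : Mat4 := Matrix.fromBlocks 1 0 0 (-1)

/-- `γᵏ`, `k = 1, 2, 3`. -/
def gammaS (k : Fin 3) : Mat4 := Matrix.fromBlocks 0 (pauli k) (-pauli k) 0

/-- `γ^U`, the upper-left corner matrix. -/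
def gammaU : Mat4 := Matrix.fromBlocks 1 0 0 0

/-- `γ^L`, the lower-right corner matrix. -/
def gammaL : Mat4 := Matrix.fromBlocks 0 0 0 1

/-! ### The Dirac operator and its right co-factor -/

/-- The scale factor `a(t) = t ^ ℓ`. -/
def scaleFactor (ℓ t : ℝ) : ℝ := t ^ ℓ

/-- `∂Ψ/∂t`. -/
def dT (Ψ : E3 → ℝ → Spinor) (x : E3) (t : ℝ) : Spinor := deriv (fun s => Ψ x s) t

/-- `∂Ψ/∂x_k`. -/
def dX (k : Fin 3) (Ψ : E3 → ℝ → Spinor) (x : E3) (t : ℝ) : Spinor :=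
  lineDeriv ℝ (fun y => Ψ y t) x (basisVec k)

/-- The Dirac operator
`𝒟 = i γ⁰ ∂_t + i a(t)⁻¹ ∑ γᵏ ∂_k + i (3 a'(t) / (2 a(t))) γ⁰ - m t⁻¹ 𝕀₄`. -/
def diracOp (ℓ : ℝ) (m : ℂ) (Ψ : E3 → ℝ → Spinor) (x : E3) (t : ℝ) : Spinor :=
  I • (gamma0 *ᵥ dT Ψ x t)
    + (I * ((1 / scaleFactor ℓ t : ℝ) : ℂ)) • ∑ k, gammaS k *ᵥ dX k Ψ x t
    + (I * ((3 * deriv (scaleFactor ℓ) t / (2 * scaleFactor ℓ t) : ℝ) : ℂ)) • (gamma0 *ᵥ Ψ x t)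
    - (m * (t : ℂ)⁻¹) • Ψ x t

/-- The matrix `t^{im} γ^U + t^{-im} γ^L`. -/
def phaseMat (m : ℂ) (t : ℝ) : Mat4 :=
  (t : ℂ) ^ (I * m) • gammaU + (t : ℂ) ^ (-(I * m)) • gammaL

/-- The right co-factor
`𝒟^{co} = i t^{-ℓ/2} γ⁰ (t^{im} γ^U + t^{-im} γ^L) ∂_t
  + i t^{-3ℓ/2} ∑ γᵏ (t^{im} γ^U + t^{-im} γ^L) ∂_k`. -/
def diracCo (ℓ : ℝ) (m : ℂ) (Φ : E3 → ℝ → Spinor) (x : E3) (t : ℝ) : Spinor :=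
  (I * ((t ^ (-ℓ / 2) : ℝ) : ℂ)) • ((gamma0 * phaseMat m t) *ᵥ dT Φ x t)
    + (I * ((t ^ (-3 * ℓ / 2) : ℝ) : ℂ)) • ∑ k, (gammaS k * phaseMat m t) *ᵥ dX k Φ x t

/-! ### The fundamental solution of the wave equation in Minkowski spacetime -/

/-- The value on `ψ` of `∂_r (r · (uniform probability measure on the sphere of radius r))`:
since `volume.toSphere` is the surface measure of the unit sphere (of total mass `4π`), this is
`∂_r (r / (4π) ∫_{|ω| = 1} ψ(r ω) dω)`, with the derivative carried out. -/
def wavePairing {G : Type*} [NormedAddCommGroup G] [NormedSpace ℝ G] (r : ℝ) (ψ : E3 → G) : G :=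
  (4 * Real.pi)⁻¹ • ∫ w : Metric.sphere (0 : E3) 1,
    (ψ (r • (w : E3)) + r • fderiv ℝ ψ (r • (w : E3)) (w : E3)) ∂(volume : Measure E3).toSphere

/-- Integration over the unit sphere of `f(r ω) + r g(r ω) ω`, for bounded continuous `f`, `g`. -/
def spherePairCLM (r : ℝ) : (E3 →ᵇ ℝ) × (E3 →ᵇ (E3 →L[ℝ] ℝ)) →L[ℝ] ℝ :=
  LinearMap.mkContinuous
    { toFun := fun p : (E3 →ᵇ ℝ) × (E3 →ᵇ (E3 →L[ℝ] ℝ)) => ∫ w : Metric.sphere (0 : E3) 1,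
        (p.1 (r • (w : E3)) + r • p.2 (r • (w : E3)) (w : E3)) ∂(volume : Measure E3).toSphere
      map_add' := by
        intro p q
        rw [← integral_add]
        · refine integral_congr_ae (Filter.Eventually.of_forall fun w => ?_)
          simp only [Prod.fst_add, Prod.snd_add, BoundedContinuousFunction.coe_add,
            Pi.add_apply, _root_.add_apply, smul_eq_mul]
          ring
        all_goals
          refine Continuous.integrable_of_hasCompactSupport ?_ (HasCompactSupport.of_compactSpace _)
          fun_prop
      map_smul' := by
        intro c p
        rw [RingHom.id_apply, smul_eq_mul, ← integral_const_mul]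
        refine integral_congr_ae (Filter.Eventually.of_forall fun w => ?_)
        simp only [Prod.smul_fst, Prod.smul_snd, BoundedContinuousFunction.coe_smul,
          _root_.smul_apply, smul_eq_mul]
        ring }
    ((1 + |r|) * (volume : Measure E3).toSphere.real Set.univ)
    (by
      intro p
      have h := norm_integral_le_of_norm_le_const (μ := (volume : Measure E3).toSphere)
        (f := fun w : Metric.sphere (0 : E3) 1 =>
          p.1 (r • (w : E3)) + r • p.2 (r • (w : E3)) (w : E3)) (C := (1 + |r|) * ‖p‖)
        (Filter.Eventually.of_forall fun w => by
          have hw : ‖(w : E3)‖ = 1 := by simp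
          have h1 : ‖p.1 (r • (w : E3))‖ ≤ ‖p‖ :=
            (p.1.norm_coe_le_norm _).trans (norm_fst_le p)
          have h2 : ‖p.2 (r • (w : E3)) (w : E3)‖ ≤ ‖p‖ := by
            refine ((p.2 (r • (w : E3))).le_opNorm _).trans ?_
            rw [hw, mul_one]
            exact (p.2.norm_coe_le_norm _).trans (norm_snd_le p)
          calc _ ≤ ‖p.1 (r • (w : E3))‖ + ‖r • p.2 (r • (w : E3)) (w : E3)‖ := norm_add_le _ _
            _ ≤ ‖p‖ + |r| * ‖p‖ := by
              rw [norm_smul, Real.norm_eq_abs r]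
              gcongr
            _ = (1 + |r|) * ‖p‖ := by ring)
      refine h.trans (le_of_eq ?_)
      ring)

/-- The distribution `ℰ^w(·, r)` on `ℝ³`: the derivative in `r` of `r` times the uniform
probability measure on the sphere of radius `r`. -/
def waveFundamental (r : ℝ) : 𝓓'((⊤ : TopologicalSpace.Opens E3), ℝ) :=
  ((4 * Real.pi)⁻¹ • (spherePairCLM r ∘L
    ((TestFunction.toBoundedContinuousFunctionCLM ℝ).prod
      (TestFunction.toBoundedContinuousFunctionCLM ℝ ∘L
        (TestFunction.fderivCLM ℝ ⊤ ⊤ :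
          𝓓((⊤ : TopologicalSpace.Opens E3), ℝ) →L[ℝ] _))) :
    𝓓((⊤ : TopologicalSpace.Opens E3), ℝ) →L[ℝ] ℝ) :)

theorem waveFundamental_apply (r : ℝ) (ψ : 𝓓((⊤ : TopologicalSpace.Opens E3), ℝ)) :
    waveFundamental r ψ = wavePairing r ψ := by
  change (4 * Real.pi)⁻¹ • (∫ w : Metric.sphere (0 : E3) 1,
    (ψ (r • (w : E3)) + r • (TestFunction.fderivCLM ℝ ⊤ ⊤ ψ :
      𝓓((⊤ : TopologicalSpace.Opens E3), E3 →L[ℝ] ℝ)) (r • (w : E3)) (w : E3))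
      ∂(volume : Measure E3).toSphere) = _
  rw [TestFunction.fderivCLM_apply_of_le ψ (by simp)]
  rfl

/-- A family `𝓔 r` of distributions on `ℝ³` is the fundamental solution of the Cauchy problem
`𝓔_rr - Δ 𝓔 = 0`, `𝓔(·, 0) = δ`, `𝓔_r(·, 0) = 0` (derivatives in `r` are those of distribution
valued functions, derivatives in `x` are distributional). -/
def IsWaveFundamentalSolution
    (𝓔 : ℝ → 𝓓'((⊤ : TopologicalSpace.Opens E3), ℝ)) : Prop :=
  ∀ ψ : 𝓓((⊤ : TopologicalSpace.Opens E3), ℝ),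
    ContDiff ℝ 2 (fun r => 𝓔 r ψ) ∧
    (∀ r, deriv (deriv fun s => 𝓔 s ψ) r
      = (∑ k, ∂_{basisVec k} (∂_{basisVec k} (𝓔 r))) ψ) ∧
    𝓔 0 ψ = Distribution.delta (0 : E3) ψ ∧
    deriv (fun s => 𝓔 s ψ) 0 = 0

/-- `∫ ℰ^w(x - y, r) φ(y) dy`, the convolution of `ℰ^w(·, r)` with `φ`, that is the pairing of the
compactly supported distribution `ℰ^w(·, r)` with `z ↦ φ(x - z)`. -/
def waveConv (r : ℝ) (φ : E3 → ℂ) (x : E3) : ℂ := wavePairing r fun z => φ (x - z)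

/-! ### The kernels and the integral operators -/

/-- The distance function `φ(t) = t^{1-ℓ} / (1-ℓ)`, `ℓ ≠ 1`. -/
def phi (ℓ t : ℝ) : ℝ := t ^ (1 - ℓ) / (1 - ℓ)

/-- The factor
`((φ(t)+φ(b))² - r²)^{-iμ} F(iμ, iμ; 1; ((φ(t)-φ(b))² - r²) / ((φ(t)+φ(b))² - r²))`,
`μ = m / (1-ℓ)`, which is common to the two kernels. -/
def kernelCore (ℓ : ℝ) (m : ℂ) (r t b : ℝ) : ℂ :=
  ((((phi ℓ t + phi ℓ b) ^ 2 - r ^ 2 : ℝ) : ℂ) ^ (-(I * m / ((1 - ℓ : ℝ) : ℂ)))) *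
    ordinaryHypergeometric (I * m / ((1 - ℓ : ℝ) : ℂ)) (I * m / ((1 - ℓ : ℝ) : ℂ)) 1
      ((((phi ℓ t - phi ℓ b) ^ 2 - r ^ 2) / ((phi ℓ t + phi ℓ b) ^ 2 - r ^ 2) : ℝ) : ℂ)

/-- The kernel `E(r, t; b; m)`. For `ℓ < 1` one has `φ > 0` and `1 - ℓ > 0` and the absolute values
can be dropped; for `ℓ > 1`, where `φ < 0` and `1 - ℓ < 0`, they fix the meaning of the powers. -/
def kernelE (ℓ : ℝ) (r t b : ℝ) (m : ℂ) : ℂ :=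
  (2 : ℂ) ^ (2 * I * m / ((1 - ℓ : ℝ) : ℂ) - 1) * ((|1 - ℓ| ^ (ℓ / (1 - ℓ)) : ℝ) : ℂ) *
    ((|phi ℓ b| : ℝ) : ℂ) ^ (((ℓ : ℂ) + 2 * I * m) / ((1 - ℓ : ℝ) : ℂ)) * kernelCore ℓ m r t b

/-- The kernel `K₁(r, t; m; ε)`. The power `φ(ε)^{2im/(1-ℓ) - 1}` is
`|φ(ε)|^{2im/(1-ℓ)} φ(ε)^{-1}`, where the absolute value can be dropped for `ℓ < 1`. -/
def kernelK1 (ℓ : ℝ) (r t : ℝ) (m : ℂ) (ε : ℝ) : ℂ :=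
  (2 : ℂ) ^ (2 * I * m / ((1 - ℓ : ℝ) : ℂ)) *
    (((|phi ℓ ε| : ℝ) : ℂ) ^ (2 * I * m / ((1 - ℓ : ℝ) : ℂ)) * ((phi ℓ ε : ℝ) : ℂ)⁻¹) *
    kernelCore ℓ m r t ε

/-- The operator `𝒢(x, t, D_x; m)`. -/
def opG (ℓ ε : ℝ) (m : ℂ) (f : E3 → ℝ → ℂ) (x : E3) (t : ℝ) : ℂ :=
  -2 * ∫ b in ε..t, (b : ℂ) ^ ((ℓ : ℂ) / 2 - I * m) *
    ∫ r in (0 : ℝ)..(phi ℓ t - phi ℓ b), kernelE ℓ r t b m * waveConv r (fun y => f y b) x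

/-- The operator `𝒦₁(x, t, D_x; m; ε)`. -/
def opK1 (ℓ ε : ℝ) (m : ℂ) (φ : E3 → ℂ) (x : E3) (t : ℝ) : ℂ :=
  -I * (ε : ℂ) ^ (1 + (ℓ : ℂ) / 2 - I * m) * ((1 - ℓ : ℝ) : ℂ)⁻¹ *
    ∫ r in (0 : ℝ)..(phi ℓ t - phi ℓ ε), kernelK1 ℓ r t m ε * waveConv r φ x

/-- `diag(𝒢(m) 𝕀₂, 𝒢(-m) 𝕀₂)[F]`. -/
def diagG (ℓ ε : ℝ) (m : ℂ) (F : E3 → ℝ → Spinor) (x : E3) (t : ℝ) : Spinor :=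
  Sum.elim (fun i => opG ℓ ε m (fun y b => F y b (Sum.inl i)) x t)
    (fun i => opG ℓ ε (-m) (fun y b => F y b (Sum.inr i)) x t)

/-- `diag(𝒦₁(m; ε) 𝕀₂, 𝒦₁(-m; ε) 𝕀₂)[Ψ_ε]`. -/
def diagK1 (ℓ ε : ℝ) (m : ℂ) (Ψε : E3 → Spinor) (x : E3) (t : ℝ) : Spinor :=
  Sum.elim (fun i => opK1 ℓ ε m (fun y => Ψε y (Sum.inl i)) x t)
    (fun i => opK1 ℓ ε (-m) (fun y => Ψε y (Sum.inr i)) x t)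

/-- The function in the braces of the solution formula,
`diag(𝒢(m), 𝒢(-m))[F] + γ⁰ diag(𝒦₁(m; ε), 𝒦₁(-m; ε))[Ψ_ε]`. -/
def potential (ℓ ε : ℝ) (m : ℂ) (F : E3 → ℝ → Spinor) (Ψε : E3 → Spinor)
    (x : E3) (t : ℝ) : Spinor :=
  diagG ℓ ε m F x t + gamma0 *ᵥ diagK1 ℓ ε m Ψε x t

/-- `Ψ` is a classical solution of the Cauchy problem `𝒟 Ψ = F` for `t > ε`,
`Ψ(x, ε) = Ψ_ε(x)`: it is continuous on `t ≥ ε` and continuously differentiable on `t > ε`. -/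
structure IsCauchySolution (ℓ : ℝ) (m : ℂ) (ε : ℝ) (F : E3 → ℝ → Spinor) (Ψε : E3 → Spinor)
    (Ψ : E3 → ℝ → Spinor) : Prop where
  continuousOn : ContinuousOn (fun p : E3 × ℝ => Ψ p.1 p.2) {p | ε ≤ p.2}
  contDiffOn : ContDiffOn ℝ 1 (fun p : E3 × ℝ => Ψ p.1 p.2) {p | ε < p.2}
  equation : ∀ x t, ε < t → diracOp ℓ m Ψ x t = F x t
  initial : ∀ x, Ψ x ε = Ψε x

end

/-! ### Parametric integrals over compact spaces -/

section ParametricIntegral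

universe u

variable {P G : Type u} [NormedAddCommGroup P] [NormedSpace ℝ P]
  [NormedAddCommGroup G] [NormedSpace ℝ G]
  {Y : Type*} [NormedAddCommGroup Y] [NormedSpace ℝ Y]
  {K : Type*} [TopologicalSpace K] [CompactSpace K] [SecondCountableTopology K]
  [MeasurableSpace K] [OpensMeasurableSpace K] {μ : Measure K} [IsFiniteMeasure μ]

/-! Existence. The co-factor is chosen so that `𝒟 𝒟^{co}` is diagonal. On a component `u` of the
potential it is, up to a nonvanishing factor, the scalar operator `u_tt + (ℓ + 2im) t⁻¹ u_t -
t^{-2ℓ} Δu`, with `-m` for `m` in the lower block: `(σ·∂)² = Δ`, and the powers of `t` in the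
co-factor make the mixed derivatives and the first-order terms in `σ·∂` cancel
(`diracUpper_coUpper`). So each component has to solve this scalar equation with right side `-t^{ℓ/2
- im} f`, vanish at `t = ε`, and have there the velocity that the co-factor turns into the initial
spinor.

In the variable `τ = φ(t)` the homogeneous equation is the Euler–Poisson–Darboux equation `u_ττ + 2μ
τ⁻¹ u_τ = Δu`, `μ = im/(1-ℓ)`. The function `ζ^{-μ} F(μ, μ; 1; ξ/ζ)`, `ζ = (τ+τ₀)² - r²`, `ξ =
(τ-τ₀)² - r²`, satisfies it with `∂_r²` in place of `Δ`, by the hypergeometric equation (`hypF_ode`,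
`coreFun_epd`). Integrate it over `0 ≤ r ≤ τ - τ₀` against `v(r) = ℰ^w(·, r) * f`, which satisfies
`v_rr = Δv`, `v_r(0) = 0`, and move `∂_r²` by parts: the result solves the equation, vanishes at the
pole `τ₀` and, once normalized, has velocity `f` there (`hasDerivAt_epdInt1`, `hasDerivAt_evolT`,
`evolT_self`). The kernels `E` and `K₁` are constants times this Riemann function; `𝒢` is minus the
Duhamel superposition, `𝒦₁` a multiple of the single solution with pole at `ε` (`opG_eq_duhamel`,
`opK1_eq_evol`).

That `ℰ^w` solves the wave equation is Darboux's equation for spherical means. The Laplacian differs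
from its radial part by squares of rotation fields, and the derivative of a function along a
rotation field has integral zero over the sphere, because the surface measure is rotation invariant
(`integral_sphere_rotGen`, `integral_laplace3`).

All integrals run over compact sets and all integrands are smooth near them, on both sides of the
pole. So differentiation under the integral sign needs no support hypothesis
(`contDiffOn_integral_of_compact`), and the potential is smooth across `t = ε`, where the initial
value can be read off directly (`coUpper_initial`).

Uniqueness. For a difference `Ψ` of two solutions, `|Ψ|²` and the currents `Re (Ψ† γ⁰ γᵏ Ψ)` obey a
conservation law with a production of order zero. Tested against a weight supported in a backward
cone that shrinks fast enough to absorb the flux, it gives an energy to which Gronwall's argument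
applies (`eq_zero_of_local_conservation`, `dirac_eq_zero`). Only `C¹` regularity is used, and no
condition at spatial infinity. -/

theorem ContDiffOn.differentiableAt_of_isOpen {E' F' : Type*} [NormedAddCommGroup E']
    [NormedSpace ℝ E'] [NormedAddCommGroup F'] [NormedSpace ℝ F'] {f : E' → F'} {s : Set E'}
    {n : WithTop ℕ∞} (h : ContDiffOn ℝ n f s) (hn : n ≠ 0) (hs : IsOpen s) {x : E'} (hx : x ∈ s) :
    DifferentiableAt ℝ f x :=
  (h.contDiffAt (hs.mem_nhds hx)).differentiableAt hn

theorem continuousOn_fderiv_comp_inl {Ω : Set (P × Y)} (hΩ : IsOpen Ω) {g : P × Y → G}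
    (hg : ContDiffOn ℝ 1 g Ω) :
    ContinuousOn (fun q => (fderiv ℝ g q).comp (ContinuousLinearMap.inl ℝ P Y)) Ω :=
  (hg.continuousOn_fderiv_of_isOpen hΩ le_rfl).clm_comp continuousOn_const

theorem integrable_of_continuous_compactSpace {E' : Type*} [NormedAddCommGroup E']
    {f : K → E'} (hf : Continuous f) : Integrable f μ := by
  obtain ⟨C, hC⟩ := (isCompact_range hf).isBounded.exists_norm_le
  exact Integrable.of_bound hf.aestronglyMeasurable C
    (Filter.Eventually.of_forall fun k => hC _ ⟨k, rfl⟩)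

/-- Compactness of `K` and the tube lemma bound the partial derivative uniformly in `k` on a whole
neighbourhood of `p`, so dominated convergence applies with a constant majorant. -/
theorem hasFDerivAt_integral_of_compact {κ : K → Y} (hκ : Continuous κ) {Ω : Set (P × Y)}
    (hΩ : IsOpen Ω) {g : P × Y → G} (hg : ContDiffOn ℝ 1 g Ω) {p : P}
    (hp : ∀ k, (p, κ k) ∈ Ω) :
    HasFDerivAt (fun p => ∫ k, g (p, κ k) ∂μ)
      (∫ k, (fderiv ℝ g (p, κ k)).comp (ContinuousLinearMap.inl ℝ P Y) ∂μ) p := by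
  have hd := continuousOn_fderiv_comp_inl hΩ hg
  have hpath : ∀ q : P, Continuous fun k => (q, κ k) := fun q => by fun_prop
  have hcont : ∀ q : P, (∀ k, (q, κ k) ∈ Ω) → Continuous fun k => g (q, κ k) := fun q hq =>
    hg.continuousOn.comp_continuous (hpath q) hq
  have hdc : Continuous fun k => (fderiv ℝ g (p, κ k)).comp (ContinuousLinearMap.inl ℝ P Y) :=
    hd.comp_continuous (hpath p) hp
  obtain ⟨C, hC⟩ := (isCompact_range hdc).isBounded.exists_norm_le
  -- `C` is a bound on the slice over `p` only; the open condition with `C + 1` survives for nearby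
  -- parameters.
  have hO : IsOpen (Ω ∩ (fun q => (fderiv ℝ g q).comp (ContinuousLinearMap.inl ℝ P Y)) ⁻¹'
      Metric.ball 0 (C + 1)) := hd.isOpen_inter_preimage hΩ Metric.isOpen_ball
  obtain ⟨u, v, hu, -, hpu, hv, huv⟩ := generalized_tube_lemma (isCompact_singleton (x := p))
    (isCompact_range hκ) hO (by
      rintro ⟨q, y⟩ ⟨hq, k, rfl⟩
      obtain rfl : q = p := hq
      refine ⟨hp k, ?_⟩
      have := hC _ ⟨k, rfl⟩
      simp only [Set.mem_preimage, mem_ball_zero_iff]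
      exact this.trans_lt (lt_add_one C))
  have hmem : ∀ q ∈ u, ∀ k, (q, κ k) ∈ Ω ∩ _ := fun q hq k => huv ⟨hq, hv ⟨k, rfl⟩⟩
  have hun : u ∈ nhds p := hu.mem_nhds (hpu rfl)
  refine hasFDerivAt_integral_of_dominated_of_fderiv_le (bound := fun _ => C + 1)
    (F' := fun q k => (fderiv ℝ g (q, κ k)).comp (ContinuousLinearMap.inl ℝ P Y)) hun ?_ ?_ ?_ ?_
    (integrable_const _) ?_
  · filter_upwards [hun] with q hq
    exact (hcont q fun k => (hmem q hq k).1).aestronglyMeasurable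
  · exact integrable_of_continuous_compactSpace (hcont p hp)
  · exact hdc.aestronglyMeasurable
  · refine Filter.Eventually.of_forall fun k q hq => ?_
    have := (hmem q hq k).2
    simp only [Set.mem_preimage, mem_ball_zero_iff] at this
    exact this.le
  · refine Filter.Eventually.of_forall fun k q hq => ?_
    have h1 := (hg.differentiableAt_of_isOpen one_ne_zero hΩ (hmem q hq k).1).hasFDerivAt
    exact h1.comp q (hasFDerivAt_prodMk_left q (κ k))

/-- Induction on the order: the derivative is again an integral of this kind, with values in `P
→L[ℝ] G`. This is why `P` and `G` share a universe. -/
theorem contDiffOn_integral_of_compact {κ : K → Y} (hκ : Continuous κ) {Ω : Set (P × Y)}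
    (hΩ : IsOpen Ω) {g : P × Y → G} (hg : ContDiffOn ℝ ∞ g Ω) {U : Set P} (hU : IsOpen U)
    (hUΩ : ∀ p ∈ U, ∀ k, (p, κ k) ∈ Ω) :
    ContDiffOn ℝ ∞ (fun p => ∫ k, g (p, κ k) ∂μ) U := by
  rw [contDiffOn_infty]
  intro n
  induction n generalizing G with
  | zero =>
    rw [Nat.cast_zero, contDiffOn_zero]
    intro p hp
    exact (hasFDerivAt_integral_of_compact hκ hΩ (hg.of_le (by norm_num))
      (hUΩ p hp)).continuousAt.continuousWithinAt
  | succ n ih =>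
    have hD : ∀ p ∈ U, HasFDerivAt (fun p => ∫ k, g (p, κ k) ∂μ)
        (∫ k, (fderiv ℝ g (p, κ k)).comp (ContinuousLinearMap.inl ℝ P Y) ∂μ) p := fun p hp =>
      hasFDerivAt_integral_of_compact hκ hΩ (hg.of_le (by norm_num)) (hUΩ p hp)
    rw [Nat.cast_succ, contDiffOn_succ_iff_fderiv_of_isOpen hU]
    refine ⟨fun p hp => (hD p hp).differentiableAt.differentiableWithinAt, by simp, ?_⟩
    have h1 : ContDiffOn ℝ ∞
        (fun q => (fderiv ℝ g q).comp (ContinuousLinearMap.inl ℝ P Y)) Ω :=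
      (hg.fderiv_of_isOpen hΩ (by simp)).clm_comp contDiffOn_const
    exact (ih h1).congr fun p hp => (hD p hp).fderiv

theorem fderiv_integral_of_compact_apply [CompleteSpace G] {κ : K → Y} (hκ : Continuous κ)
    {Ω : Set (P × Y)} (hΩ : IsOpen Ω) {g : P × Y → G} (hg : ContDiffOn ℝ 1 g Ω) {p : P}
    (hp : ∀ k, (p, κ k) ∈ Ω) (v : P) :
    fderiv ℝ (fun p => ∫ k, g (p, κ k) ∂μ) p v = ∫ k, fderiv ℝ g (p, κ k) (v, 0) ∂μ := by
  rw [(hasFDerivAt_integral_of_compact hκ hΩ hg hp).fderiv, ContinuousLinearMap.integral_apply]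
  · simp
  · exact integrable_of_continuous_compactSpace
      ((continuousOn_fderiv_comp_inl hΩ hg).comp_continuous (by fun_prop) hp)

end ParametricIntegral

/-! ### Parametric interval integrals -/

section IntervalIntegral

universe u

variable {P G : Type u} [NormedAddCommGroup P] [NormedSpace ℝ P]
  [NormedAddCommGroup G] [NormedSpace ℝ G]

theorem intervalIntegral_eq_integral_subtype (f : ℝ → G) {a b : ℝ} (hab : a ≤ b) :
    ∫ s in a..b, f s = ∫ k : Set.Icc a b, f k ∂(volume.comap Subtype.val) := by
  rw [intervalIntegral.integral_of_le hab, ← integral_Icc_eq_integral_Ioc,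
    integral_subtype_comap measurableSet_Icc]

theorem isFiniteMeasure_comap_Icc (a b : ℝ) :
    IsFiniteMeasure ((volume : Measure ℝ).comap (Subtype.val : Set.Icc a b → ℝ)) := by
  refine ⟨?_⟩
  rw [(MeasurableEmbedding.subtype_coe measurableSet_Icc).comap_apply, Set.image_univ,
    Subtype.range_coe]
  exact isCompact_Icc.measure_lt_top

theorem intervalIntegral_eq_smul_unit [CompleteSpace G] (f : ℝ → G) (a c : ℝ) :
    ∫ r in a..c, f r = (c - a) • ∫ s in (0 : ℝ)..1, f (a + s * (c - a)) := by
  have h := intervalIntegral.smul_integral_comp_add_mul (a := 0) (b := 1) f (c - a) a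
  simp only [mul_zero, add_zero, mul_one] at h
  rw [add_sub_cancel] at h
  rw [← h]
  simp_rw [mul_comm (c - a)]

/-- The order of `a` and `c` is left free: below, the time `t` may precede the pole `b`. -/
theorem add_mul_sub_mem_uIcc {a c s : ℝ} (hs : s ∈ Set.Icc (0 : ℝ) 1) :
    a + s * (c - a) ∈ Set.uIcc a c := by
  rw [← segment_eq_uIcc]
  exact ⟨1 - s, s, by linarith [hs.2], hs.1, by ring, by simp only [smul_eq_mul]; ring⟩

/-- The integral over a variable interval, as a function of parameters and upper end point,
pulled back to the unit interval. -/
theorem contDiffOn_intervalIntegral [CompleteSpace G] {Ω : Set (P × ℝ)} (hΩ : IsOpen Ω)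
    {g : P × ℝ → G} (hg : ContDiffOn ℝ ∞ g Ω) (a : ℝ) {U : Set P} (hU : IsOpen U) {c : P → ℝ}
    (hc : ContDiffOn ℝ ∞ c U) (hUΩ : ∀ p ∈ U, ∀ r ∈ Set.uIcc a (c p), (p, r) ∈ Ω) :
    ContDiffOn ℝ ∞ (fun p => ∫ r in a..c p, g (p, r)) U := by
  have := isFiniteMeasure_comap_Icc 0 1
  have hmap : ContDiffOn ℝ ∞ (fun q : P × ℝ => (q.1, a + q.2 * (c q.1 - a))) (U ×ˢ Set.univ) := by
    have h1 : ContDiffOn ℝ ∞ (fun q : P × ℝ => c q.1) (U ×ˢ Set.univ) :=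
      hc.comp contDiffOn_fst fun q hq => hq.1
    exact contDiffOn_fst.prodMk (contDiffOn_const.add (contDiffOn_snd.mul (h1.sub contDiffOn_const)))
  have hO := hmap.continuousOn.isOpen_inter_preimage (hU.prod isOpen_univ) hΩ
  have hsm := contDiffOn_integral_of_compact
    (μ := (volume : Measure ℝ).comap (Subtype.val : Set.Icc (0 : ℝ) 1 → ℝ)) (κ := Subtype.val)
    continuous_subtype_val hO (hg.comp (hmap.mono Set.inter_subset_left) fun q hq => hq.2) hU
    fun p hp k => ⟨⟨hp, trivial⟩, hUΩ p hp _ (add_mul_sub_mem_uIcc k.2)⟩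
  refine ((hc.sub (contDiffOn_const (c := a))).smul hsm).congr fun p hp => ?_
  rw [intervalIntegral_eq_smul_unit, intervalIntegral_eq_integral_subtype _ zero_le_one]
  rfl

theorem differentiableAt_intervalIntegral [CompleteSpace G] {Ω : Set (P × ℝ)} (hΩ : IsOpen Ω)
    {g : P × ℝ → G} (hg : ContDiffOn ℝ 1 g Ω) (a : ℝ) {p : P} {c : ℝ}
    (hp : ∀ r ∈ Set.uIcc a c, (p, r) ∈ Ω) :
    DifferentiableAt ℝ (fun q : P × ℝ => ∫ r in a..q.2, g (q.1, r)) (p, c) := by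
  have := isFiniteMeasure_comap_Icc 0 1
  have hmap : ContDiff ℝ 1 (fun q : (P × ℝ) × ℝ => (q.1.1, a + q.2 * (q.1.2 - a))) := by fun_prop
  have hO := hΩ.preimage hmap.continuous
  have hsm := hasFDerivAt_integral_of_compact
    (μ := (volume : Measure ℝ).comap (Subtype.val : Set.Icc (0 : ℝ) 1 → ℝ)) (κ := Subtype.val)
    continuous_subtype_val hO (hg.comp hmap.contDiffOn fun q hq => hq) (p := (p, c))
    fun k => hp _ (add_mul_sub_mem_uIcc k.2)
  have h2 : DifferentiableAt ℝ (fun q : P × ℝ => q.2 - a) (p, c) := by fun_prop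
  refine (h2.smul hsm.differentiableAt).congr_of_eventuallyEq
    (Filter.Eventually.of_forall fun q => ?_)
  change ∫ r in a..q.2, g (q.1, r) = _
  rw [intervalIntegral_eq_smul_unit, intervalIntegral_eq_integral_subtype _ zero_le_one]
  rfl

theorem hasFDerivAt_intervalIntegral_const [CompleteSpace G] {Ω : Set (P × ℝ)} (hΩ : IsOpen Ω)
    {g : P × ℝ → G} (hg : ContDiffOn ℝ 1 g Ω) (a c : ℝ) {p : P}
    (hp : ∀ r ∈ Set.uIcc a c, (p, r) ∈ Ω) :
    HasFDerivAt (fun q : P => ∫ r in a..c, g (q, r))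
      (∫ r in a..c, (fderiv ℝ g (p, r)).comp (ContinuousLinearMap.inl ℝ P ℝ)) p := by
  have key : ∀ a c : ℝ, a ≤ c → (∀ r ∈ Set.uIcc a c, (p, r) ∈ Ω) →
      HasFDerivAt (fun q : P => ∫ r in a..c, g (q, r))
      (∫ r in a..c, (fderiv ℝ g (p, r)).comp (ContinuousLinearMap.inl ℝ P ℝ)) p := by
    intro a c hac hp
    have := isFiniteMeasure_comap_Icc a c
    have hsm := hasFDerivAt_integral_of_compact
      (μ := (volume : Measure ℝ).comap (Subtype.val : Set.Icc a c → ℝ)) (κ := Subtype.val)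
      continuous_subtype_val hΩ hg (p := p) fun k => hp _ (by rw [Set.uIcc_of_le hac]; exact k.2)
    simp_rw [intervalIntegral_eq_integral_subtype _ hac]
    exact hsm
  rcases le_total a c with h | h
  · exact key a c h hp
  · simp_rw [intervalIntegral.integral_symm c a]
    exact (key c a h (by rwa [Set.uIcc_comm])).neg

theorem continuousOn_slice {E' F' : Type*} [TopologicalSpace E'] [TopologicalSpace F']
    {Ω : Set (E' × ℝ)} {g : E' × ℝ → F'} (hg : ContinuousOn g Ω) {p : E'} {s : Set ℝ}
    (hp : ∀ r ∈ s, (p, r) ∈ Ω) : ContinuousOn (fun r => g (p, r)) s :=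
  hg.comp (by fun_prop) hp

theorem fderiv_intervalIntegral_const_apply [CompleteSpace G] {Ω : Set (P × ℝ)} (hΩ : IsOpen Ω)
    {g : P × ℝ → G} (hg : ContDiffOn ℝ 1 g Ω) (a c : ℝ) {p : P}
    (hp : ∀ r ∈ Set.uIcc a c, (p, r) ∈ Ω) (v : P) :
    fderiv ℝ (fun q : P => ∫ r in a..c, g (q, r)) p v =
      ∫ r in a..c, fderiv ℝ g (p, r) (v, 0) := by
  rw [(hasFDerivAt_intervalIntegral_const hΩ hg a c hp).fderiv,
    ContinuousLinearMap.intervalIntegral_apply]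
  · simp
  · exact (continuousOn_slice (continuousOn_fderiv_comp_inl hΩ hg) hp).intervalIntegrable

/-- The Leibniz rule. -/
theorem hasDerivAt_intervalIntegral_leibniz {G : Type} [NormedAddCommGroup G] [NormedSpace ℝ G]
    [CompleteSpace G] {Ω : Set (ℝ × ℝ)} (hΩ : IsOpen Ω)
    {h : ℝ × ℝ → G} (hh : ContDiffOn ℝ 1 h Ω) (a : ℝ) {β : ℝ → ℝ} {β' t : ℝ}
    (hβ : HasDerivAt β β' t) (ht : ∀ r ∈ Set.uIcc a (β t), (t, r) ∈ Ω) :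
    HasDerivAt (fun t => ∫ r in a..β t, h (t, r))
      (β' • h (t, β t) + ∫ r in a..β t, fderiv ℝ h (t, r) (1, 0)) t := by
  -- The integral is differentiable jointly in parameter and end point. Its derivative `L` is
  -- computed on the two axes and then applied to the velocity `(1, β')`.
  have hD := (differentiableAt_intervalIntegral hΩ hh a ht).hasFDerivAt
  set L := fderiv ℝ (fun q : ℝ × ℝ => ∫ r in a..q.2, h (q.1, r)) (t, β t) with hL
  have h1 : L (1, 0) = ∫ r in a..β t, fderiv ℝ h (t, r) (1, 0) := by
    rw [← fderiv_intervalIntegral_const_apply hΩ hh a (β t) ht 1]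
    have := hD.comp t (hasFDerivAt_prodMk_left (𝕜 := ℝ) t (β t))
    have h' := this.fderiv
    simp only [Function.comp_def] at h'
    rw [h']
    simp
  have h2 : L (0, 1) = h (t, β t) := by
    have := (hD.comp (β t) (hasFDerivAt_prodMk_right (𝕜 := ℝ) t (β t))).hasDerivAt
    simp only [Function.comp_def] at this
    have hcont := continuousOn_slice hh.continuousOn ht
    -- The fundamental theorem of calculus asks for measurability near the end point; the integrand
    -- is continuous there because `Ω` is open.
    have hnear : ∀ᶠ r in nhds (β t), (t, r) ∈ Ω :=
      (Continuous.prodMk_right t).continuousAt.eventually (hΩ.mem_nhds (ht _ Set.right_mem_uIcc))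
    have hca : ∀ᶠ r in nhds (β t), ContinuousAt (fun r => h (t, r)) r := by
      filter_upwards [hnear] with r hr
      have := hh.continuousOn.continuousAt (hΩ.mem_nhds hr)
      exact ContinuousAt.comp (f := fun r => (t, r)) this (by fun_prop)
    have hftc := intervalIntegral.integral_hasDerivAt_right (f := fun r => h (t, r))
      hcont.intervalIntegrable
      (ContinuousAt.stronglyMeasurableAtFilter (isOpen_interior (s := {r | ContinuousAt (fun r => h (t, r)) r}))
        (fun x hx => interior_subset hx) _ (mem_interior_iff_mem_nhds.2 hca)) hca.self_of_nhds
    rw [← this.unique hftc]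
    simp
  have hcomp := hD.comp_hasDerivAt t ((hasDerivAt_id t).prodMk hβ)
  convert! hcomp using 1
  have : ((1 : ℝ), β') = (1, 0) + β' • ((0 : ℝ), (1 : ℝ)) := by simp
  rw [this, map_add, map_smul, h1, h2, add_comm]

end IntervalIntegral

noncomputable section

/-! ### The surface measure of the unit sphere -/

section Sphere

/-- The action of a linear isometry on the unit sphere. -/
def sphereMap (A : E3 ≃ₗᵢ[ℝ] E3) : Metric.sphere (0 : E3) 1 ≃ₜ Metric.sphere (0 : E3) 1 where
  toFun w := ⟨A w, by simp⟩
  invFun w := ⟨A.symm w, by simp⟩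
  left_inv w := by simp
  right_inv w := by simp
  continuous_toFun := by fun_prop
  continuous_invFun := by fun_prop

-- The surface measure of `s` is a multiple of the volume of the cone `(0, 1) • s`; a linear
-- isometry maps such cones to such cones and preserves volume.
open scoped Pointwise in
theorem measurePreserving_sphereMap (A : E3 ≃ₗᵢ[ℝ] E3) :
    MeasurePreserving (sphereMap A) (volume : Measure E3).toSphere
      (volume : Measure E3).toSphere := by
  refine ⟨(sphereMap A).continuous.measurable, ?_⟩
  ext s hs
  rw [Measure.map_apply (sphereMap A).continuous.measurable hs,
    Measure.toSphere_apply' _ hs,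
    Measure.toSphere_apply' _ ((sphereMap A).continuous.measurable hs)]
  congr 1
  rw [← (show MeasurePreserving A.toMeasurableEquiv volume volume from
    A.measurePreserving).measure_preimage_equiv (Set.Ioo (0 : ℝ) 1 • Subtype.val '' s)]
  change _ = volume (A ⁻¹' _)
  congr 1
  ext x
  simp only [Set.mem_smul, Set.mem_image, Set.mem_preimage]
  constructor
  · rintro ⟨c, hc, _, ⟨w, hw, rfl⟩, rfl⟩
    exact ⟨c, hc, _, ⟨sphereMap A w, hw, rfl⟩, by simp [sphereMap]⟩
  · rintro ⟨c, hc, _, ⟨w, hw, rfl⟩, h⟩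
    refine ⟨c, hc, _, ⟨(sphereMap A).symm w, by simpa using hw, rfl⟩, ?_⟩
    apply A.injective
    rw [← h]
    simp [sphereMap]

theorem integral_sphere_comp_isometry {G : Type*} [NormedAddCommGroup G] [NormedSpace ℝ G]
    (A : E3 ≃ₗᵢ[ℝ] E3) (g : E3 → G) :
    ∫ w : Metric.sphere (0 : E3) 1, g (A w) ∂(volume : Measure E3).toSphere =
      ∫ w : Metric.sphere (0 : E3) 1, g w ∂(volume : Measure E3).toSphere :=
  (measurePreserving_sphereMap A).integral_comp (sphereMap A).measurableEmbedding fun w => g w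

theorem toSphere_real_univ : (volume : Measure E3).toSphere.real Set.univ = 4 * Real.pi := by
  rw [Measure.toSphere_real_apply_univ, Measure.real, EuclideanSpace.volume_ball_fin_three]
  rw [ENNReal.toReal_mul, ENNReal.toReal_ofReal (by positivity)]
  simp
  ring

/-! ### Infinitesimal rotations -/

/-- The generator `x_i ∂_j - x_j ∂_i` of rotations, as a linear vector field. -/
def rotGen (i j : Fin 3) : E3 →L[ℝ] E3 :=
  (EuclideanSpace.proj (𝕜 := ℝ) i).smulRight (basisVec j) -
    (EuclideanSpace.proj (𝕜 := ℝ) j).smulRight (basisVec i)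

theorem rotGen_apply (i j : Fin 3) (x : E3) :
    rotGen i j x = x i • basisVec j - x j • basisVec i := rfl

/-- The rotation by the angle `θ` in the plane of the coordinates `i`, `j`. -/
def rotLin (i j : Fin 3) (θ : ℝ) : E3 →L[ℝ] E3 :=
  ContinuousLinearMap.id ℝ E3 + (Real.cos θ - 1) •
    ((EuclideanSpace.proj (𝕜 := ℝ) i).smulRight (basisVec i) +
      (EuclideanSpace.proj (𝕜 := ℝ) j).smulRight (basisVec j)) + Real.sin θ • rotGen i j

theorem norm_rotLin {i j : Fin 3} (hij : i ≠ j) (θ : ℝ) (x : E3) : ‖rotLin i j θ x‖ = ‖x‖ := by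
  have h := Real.sin_sq_add_cos_sq θ
  rw [← sq_eq_sq₀ (norm_nonneg _) (norm_nonneg _), EuclideanSpace.real_norm_sq_eq,
    EuclideanSpace.real_norm_sq_eq, Fin.sum_univ_three, Fin.sum_univ_three]
  fin_cases i <;> fin_cases j <;> first | exact absurd rfl hij | skip
  all_goals
    simp [rotLin, rotGen, basisVec]
    first
    | linear_combination ((x 0) ^ 2 + (x 1) ^ 2) * h
    | linear_combination ((x 0) ^ 2 + (x 2) ^ 2) * h
    | linear_combination ((x 1) ^ 2 + (x 2) ^ 2) * h

/-- `rotLin` as a linear isometry equivalence. -/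
def rotIso {i j : Fin 3} (hij : i ≠ j) (θ : ℝ) : E3 ≃ₗᵢ[ℝ] E3 :=
  LinearIsometry.toLinearIsometryEquiv
    ⟨(rotLin i j θ).toLinearMap, norm_rotLin hij θ⟩ rfl

/-- The integral of `g` after a rotation by `θ` is independent of `θ`; differentiate at `θ = 0`.
This replaces integration by parts on the sphere. -/
theorem integral_sphere_rotGen {G : Type} [NormedAddCommGroup G] [NormedSpace ℝ G]
    [CompleteSpace G] {i j : Fin 3} (hij : i ≠ j) {g : E3 → G} (hg : ContDiff ℝ 1 g) :
    ∫ w : Metric.sphere (0 : E3) 1, fderiv ℝ g w (rotGen i j w)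
      ∂(volume : Measure E3).toSphere = 0 := by
  have hsm : ContDiff ℝ 1 (fun q : ℝ × E3 => g (rotLin i j q.1 q.2)) := by
    refine hg.comp ?_
    simp only [rotLin, _root_.add_apply, _root_.smul_apply]
    have h1 := Real.contDiff_cos (n := 1)
    have h2 := Real.contDiff_sin (n := 1)
    fun_prop
  have hconst : (fun θ : ℝ => ∫ w : Metric.sphere (0 : E3) 1, g (rotLin i j θ w)
      ∂(volume : Measure E3).toSphere) = fun _ => ∫ w : Metric.sphere (0 : E3) 1, g w
      ∂(volume : Measure E3).toSphere := by
    funext θ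
    exact integral_sphere_comp_isometry (rotIso hij θ) g
  have h := fderiv_integral_of_compact_apply (P := ℝ) (Y := E3)
    (μ := (volume : Measure E3).toSphere)
    (κ := ((↑) : Metric.sphere (0 : E3) 1 → E3)) continuous_subtype_val isOpen_univ
    hsm.contDiffOn (p := 0) (fun _ => trivial) 1
  rw [hconst] at h
  simp only [fderiv_fun_const, Pi.zero_apply, _root_.zero_apply] at h
  rw [h]
  refine integral_congr_ae (Filter.Eventually.of_forall fun w => ?_)
  have hd : HasDerivAt (fun θ : ℝ => rotLin i j θ (w : E3)) (rotGen i j w) 0 := by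
    simp only [rotLin, _root_.add_apply, _root_.smul_apply]
    have := (((Real.hasDerivAt_cos 0).sub_const 1).smul_const
      ((w : E3) i • basisVec i + (w : E3) j • basisVec j)).add
      ((Real.hasDerivAt_sin 0).smul_const (rotGen i j w))
    have := this.const_add (w : E3)
    simp only [Real.sin_zero, Real.cos_zero, neg_zero, zero_smul, one_smul, zero_add] at this
    refine this.congr_of_eventuallyEq (Filter.Eventually.of_forall fun θ => ?_)
    simp [add_assoc]
  have h0 : rotLin i j 0 (w : E3) = w := by simp [rotLin]
  have h1 := (hg.differentiable one_ne_zero (rotLin i j 0 (w : E3))).hasFDerivAt.comp_hasDerivAt 0 hd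
  have h2 := ((hsm.differentiable one_ne_zero ((0 : ℝ), (w : E3))).hasFDerivAt.comp (0 : ℝ)
    (hasFDerivAt_prodMk_left (𝕜 := ℝ) (0 : ℝ) (w : E3))).hasDerivAt
  have h3 := h1.unique h2
  rw [h0] at h3
  simpa using h3

end Sphere

/-! ### Spherical means and the wave equation -/

section Wave

variable {G : Type} [NormedAddCommGroup G] [NormedSpace ℝ G]

/-- The partial derivative in direction `k`. -/
def partialX (k : Fin 3) (φ : E3 → G) (y : E3) : G := fderiv ℝ φ y (basisVec k)

/-- The Laplacian on `ℝ³`. -/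
def laplace3 (φ : E3 → G) (y : E3) : G := ∑ k, partialX k (partialX k φ) y

theorem ContDiff.partialX {φ : E3 → G} (hφ : ContDiff ℝ ∞ φ) (k : Fin 3) :
    ContDiff ℝ ∞ (partialX k φ) :=
  (hφ.fderiv_right (by simp)).clm_apply contDiff_const

theorem ContDiff.laplace3 {φ : E3 → G} (hφ : ContDiff ℝ ∞ φ) : ContDiff ℝ ∞ (laplace3 φ) :=
  ContDiff.sum fun k _ => (hφ.partialX k).partialX k

theorem partialX_partialX {φ : E3 → G} (hφ : ContDiff ℝ ∞ φ) (j k : Fin 3) (y : E3) :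
    partialX j (partialX k φ) y = fderiv ℝ (fderiv ℝ φ) y (basisVec j) (basisVec k) := by
  have h : DifferentiableAt ℝ (fderiv ℝ φ) y :=
    ((hφ.fderiv_right (m := ∞) (by simp)).differentiable (by simp)) y
  unfold partialX
  rw [fderiv_clm_apply h (by fun_prop)]
  simp

theorem sum_smul_basisVec (x : E3) :
    x = x 0 • basisVec 0 + x 1 • basisVec 1 + x 2 • basisVec 2 := by
  ext i
  fin_cases i <;> simp [basisVec]

/-- Spherical integrals depend smoothly on parameters. -/
theorem contDiff_integral_sphere {P : Type} [NormedAddCommGroup P] [NormedSpace ℝ P]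
    {g : P × E3 → G} (hg : ContDiff ℝ ∞ g) :
    ContDiff ℝ ∞ fun p => ∫ w : Metric.sphere (0 : E3) 1, g (p, w)
      ∂(volume : Measure E3).toSphere := by
  rw [← contDiffOn_univ]
  exact contDiffOn_integral_of_compact (κ := ((↑) : Metric.sphere (0 : E3) 1 → E3))
    continuous_subtype_val isOpen_univ hg.contDiffOn isOpen_univ fun _ _ _ => trivial

theorem hasDerivAt_integral_sphere [CompleteSpace G] {g g' : ℝ → E3 → G}
    (hg : ContDiff ℝ 1 fun q : ℝ × E3 => g q.1 q.2) {r : ℝ}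
    (hg' : ∀ y, HasDerivAt (fun s => g s y) (g' r y) r) :
    HasDerivAt (fun s => ∫ w : Metric.sphere (0 : E3) 1, g s w ∂(volume : Measure E3).toSphere)
      (∫ w : Metric.sphere (0 : E3) 1, g' r w ∂(volume : Measure E3).toSphere) r := by
  have hD := hasFDerivAt_integral_of_compact (μ := (volume : Measure E3).toSphere)
    (κ := ((↑) : Metric.sphere (0 : E3) 1 → E3)) continuous_subtype_val isOpen_univ
    hg.contDiffOn (p := r) fun _ => trivial
  have h2 := fderiv_integral_of_compact_apply (μ := (volume : Measure E3).toSphere)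
    (κ := ((↑) : Metric.sphere (0 : E3) 1 → E3)) continuous_subtype_val isOpen_univ
    hg.contDiffOn (p := r) (fun _ => trivial) 1
  have h3 := hD.differentiableAt.hasFDerivAt.hasDerivAt
  rw [h2] at h3
  convert! h3 using 1
  refine integral_congr_ae (Filter.Eventually.of_forall fun w => ?_)
  have h4 := ((hg.differentiable one_ne_zero (r, (w : E3))).hasFDerivAt.comp r
    (hasFDerivAt_prodMk_left (𝕜 := ℝ) r (w : E3))).hasDerivAt
  simpa using (hg' w).unique h4

/-- The mean of `ψ` over the sphere of radius `r` about the origin. -/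
def sphMean (r : ℝ) (ψ : E3 → G) : G :=
  (4 * Real.pi)⁻¹ • ∫ w : Metric.sphere (0 : E3) 1, ψ (r • (w : E3))
    ∂(volume : Measure E3).toSphere

/-- With `M_r` the spherical mean and `W_r` the pairing, this is one half of the system `(r M_r ψ)'
= W_r ψ`, `(W_r ψ)' = r M_r (Δψ)`; the other half is Darboux's equation. -/
theorem hasDerivAt_smul_sphMean [CompleteSpace G] {ψ : E3 → G} (hψ : ContDiff ℝ ∞ ψ) (r : ℝ) :
    HasDerivAt (fun s => s • sphMean s ψ) (wavePairing r ψ) r := by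
  have h1 := hasDerivAt_integral_sphere (g := fun s y => s • ψ (s • y))
    (g' := fun s y => ψ (s • y) + s • fderiv ℝ ψ (s • y) y) (r := r)
    (by
      have := hψ.of_le (m := 1) (by simp)
      fun_prop)
    (fun y => by
      have h := (hψ.differentiable (by simp) (r • y)).hasFDerivAt.comp_hasDerivAt r
        ((hasDerivAt_id r).smul_const y)
      have := (hasDerivAt_id r).smul h
      simp only [one_smul, id] at this
      rw [add_comm]
      exact this)
  have h2 := h1.const_smul (4 * Real.pi)⁻¹
  refine h2.congr_of_eventuallyEq (Filter.Eventually.of_forall fun s => ?_)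
  simp only [sphMean, integral_smul, Pi.smul_apply]
  rw [smul_comm]

/-- The sum of the squares of the rotation fields is the angular part of the Laplacian. -/
theorem sum_rotGen_sq (B : E3 →L[ℝ] E3 →L[ℝ] G) (L : E3 →L[ℝ] G) (r : ℝ) {x : E3}
    (hx : ‖x‖ = 1) :
    (r • B (rotGen 0 1 x) (rotGen 0 1 x) + L (rotGen 0 1 (rotGen 0 1 x))) +
    (r • B (rotGen 0 2 x) (rotGen 0 2 x) + L (rotGen 0 2 (rotGen 0 2 x))) +
    (r • B (rotGen 1 2 x) (rotGen 1 2 x) + L (rotGen 1 2 (rotGen 1 2 x))) =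
    r • ∑ k, B (basisVec k) (basisVec k) - (L x + (L x + r • B x x)) := by
  have h1 : x 0 * x 0 + x 1 * x 1 + x 2 * x 2 = 1 := by
    have := EuclideanSpace.real_norm_sq_eq x
    rw [hx, Fin.sum_univ_three] at this
    linarith
  have h2 : x 2 * x 2 = 1 - x 0 * x 0 - x 1 * x 1 := by linarith
  have hr01 := rotGen_apply 0 1
  have e01 : ∀ i j k : Fin 3, (basisVec i : E3) j = if j = i then 1 else 0 := by
    intro i j k; simp [basisVec]
  have hBx : B x x = B (x 0 • basisVec 0 + x 1 • basisVec 1 + x 2 • basisVec 2)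
      (x 0 • basisVec 0 + x 1 • basisVec 1 + x 2 • basisVec 2) := by rw [← sum_smul_basisVec]
  have hLx : L x = L (x 0 • basisVec 0 + x 1 • basisVec 1 + x 2 • basisVec 2) := by
    rw [← sum_smul_basisVec]
  rw [hBx, hLx, Fin.sum_univ_three]
  -- The diagonal second derivatives are multiplied by `|x|² = 1`; then the coefficients of `B` on
  -- the two sides are quadratic forms in `x` that agree identically.
  have key : ∀ c : G, c = (x 0 * x 0 + x 1 * x 1 + x 2 * x 2) • c := fun c => by
    rw [h1, one_smul]
  rw [key (B (basisVec 0) (basisVec 0)), key (B (basisVec 1) (basisVec 1)),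
    key (B (basisVec 2) (basisVec 2))]
  simp only [rotGen_apply, map_add, map_sub, map_smul, _root_.add_apply, _root_.sub_apply,
    _root_.smul_apply, e01 _ _ 0]
  simp
  module

/-- For a rotation field `X`, differentiate `y ↦ Dψ(r y)(X y)` along `X`: the integral is zero.
Summing over the three coordinate planes leaves `r Δψ` minus the radial terms. Starting from `Dψ`
and not from `ψ(r ·)` avoids a division by `r`, so `r = 0` is included. -/
theorem integral_laplace3 [CompleteSpace G] {ψ : E3 → G} (hψ : ContDiff ℝ ∞ ψ) (r : ℝ) :
    ∫ w : Metric.sphere (0 : E3) 1, (fderiv ℝ ψ (r • (w : E3)) w + (fderiv ℝ ψ (r • (w : E3)) w +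
        r • fderiv ℝ (fderiv ℝ ψ) (r • (w : E3)) w w)) ∂(volume : Measure E3).toSphere =
      ∫ w : Metric.sphere (0 : E3) 1, r • laplace3 ψ (r • (w : E3))
        ∂(volume : Measure E3).toSphere := by
  have hD : ContDiff ℝ ∞ (fderiv ℝ ψ) := hψ.fderiv_right (by simp)
  have hDD : ContDiff ℝ ∞ (fderiv ℝ (fderiv ℝ ψ)) := hD.fderiv_right (by simp)
  have hg : ∀ i j, ContDiff ℝ ∞ fun y : E3 => fderiv ℝ ψ (r • y) (rotGen i j y) := fun i j =>
    (hD.comp (by fun_prop)).clm_apply (by fun_prop)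
  have hval : ∀ (i j : Fin 3) (y : E3), fderiv ℝ (fun y : E3 => fderiv ℝ ψ (r • y) (rotGen i j y)) y
      (rotGen i j y) = r • fderiv ℝ (fderiv ℝ ψ) (r • y) (rotGen i j y) (rotGen i j y) +
      fderiv ℝ ψ (r • y) (rotGen i j (rotGen i j y)) := by
    intro i j y
    have h1 : HasFDerivAt (fun y : E3 => fderiv ℝ ψ (r • y))
        ((fderiv ℝ (fderiv ℝ ψ) (r • y)).comp (r • ContinuousLinearMap.id ℝ E3)) y :=
      ((hD.differentiable (by simp) (r • y)).hasFDerivAt).comp y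
        ((hasFDerivAt_id y).const_smul r)
    rw [(h1.clm_apply (rotGen i j).hasFDerivAt).fderiv]
    simp [add_comm]
  have hz : ∀ i j : Fin 3, i ≠ j → ∫ w : Metric.sphere (0 : E3) 1,
      (r • fderiv ℝ (fderiv ℝ ψ) (r • (w : E3)) (rotGen i j w) (rotGen i j w) +
      fderiv ℝ ψ (r • (w : E3)) (rotGen i j (rotGen i j w)))
        ∂(volume : Measure E3).toSphere = 0 := by
    intro i j hij
    rw [← integral_sphere_rotGen hij ((hg i j).of_le (by simp))]
    simp_rw [hval]
  have hcD : Continuous (fderiv ℝ ψ) := hD.continuous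
  have hcDD : Continuous (fderiv ℝ (fderiv ℝ ψ)) := hDD.continuous
  have hcL : Continuous (laplace3 ψ) := hψ.laplace3.continuous
  have hint : ∀ f : Metric.sphere (0 : E3) 1 → G, Continuous f →
    Integrable f (volume : Measure E3).toSphere := fun f hf =>
      integrable_of_continuous_compactSpace hf
  have hi : ∀ i j : Fin 3, Integrable (fun w : Metric.sphere (0 : E3) 1 =>
      r • fderiv ℝ (fderiv ℝ ψ) (r • (w : E3)) (rotGen i j w) (rotGen i j w) +
      fderiv ℝ ψ (r • (w : E3)) (rotGen i j (rotGen i j w))) (volume : Measure E3).toSphere :=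
    fun i j => hint _ (by fun_prop)
  rw [eq_comm, ← sub_eq_zero, ← integral_sub (hint _ (by fun_prop)) (hint _ (by fun_prop))]
  have h := congrArg₂ (· + ·) (congrArg₂ (· + ·) (hz 0 1 (by decide)) (hz 0 2 (by decide)))
    (hz 1 2 (by decide))
  simp only [add_zero] at h
  rw [← integral_add (hi _ _) (hi _ _), ← integral_add (by exact (hi _ _).add (hi _ _)) (hi _ _)] at h
  rw [← h]
  refine integral_congr_ae (Filter.Eventually.of_forall fun w => ?_)
  have hw : ‖(w : E3)‖ = 1 := by simp
  beta_reduce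
  rw [sum_rotGen_sq (fderiv ℝ (fderiv ℝ ψ) (r • (w : E3))) (fderiv ℝ ψ (r • (w : E3))) r hw]
  simp only [laplace3, partialX_partialX hψ]

/-- Darboux's equation for spherical means. -/
theorem hasDerivAt_wavePairing [CompleteSpace G] {ψ : E3 → G} (hψ : ContDiff ℝ ∞ ψ) (r : ℝ) :
    HasDerivAt (fun s => wavePairing s ψ) (r • sphMean r (laplace3 ψ)) r := by
  have hD : ContDiff ℝ ∞ (fderiv ℝ ψ) := hψ.fderiv_right (by simp)
  have h1 := hasDerivAt_integral_sphere (g := fun s y => ψ (s • y) + s • fderiv ℝ ψ (s • y) y)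
    (g' := fun s y => fderiv ℝ ψ (s • y) y +
      (fderiv ℝ ψ (s • y) y + s • fderiv ℝ (fderiv ℝ ψ) (s • y) y y)) (r := r)
    (by
      have h0 := hψ.of_le (m := 1) (by simp)
      have h2 := hD.of_le (m := 1) (by simp)
      fun_prop)
    (fun y => by
      have hs : HasDerivAt (fun s : ℝ => s • y) y r := by
        simpa using (hasDerivAt_id r).smul_const y
      have h := (hψ.differentiable (by simp) (r • y)).hasFDerivAt.comp_hasDerivAt r hs
      have h' := (hD.differentiable (by simp) (r • y)).hasFDerivAt.comp_hasDerivAt r hs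
      have h'' := (hasDerivAt_id r).smul (h'.clm_apply (hasDerivAt_const r y))
      have := h.add h''
      simp only [one_smul, id, map_zero, add_zero] at this
      convert! this using 1
      simp only [Function.comp_apply]
      abel)
  have h2 := h1.const_smul (4 * Real.pi)⁻¹
  rw [integral_laplace3 hψ] at h2
  simp only [sphMean]
  rw [smul_comm, ← integral_smul]
  exact h2

theorem wavePairing_zero [CompleteSpace G] (ψ : E3 → G) : wavePairing 0 ψ = ψ 0 := by
  unfold wavePairing
  simp only [zero_smul, add_zero, integral_const, toSphere_real_univ]
  rw [smul_smul, inv_mul_cancel₀ (by positivity), one_smul]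

theorem contDiff_wavePairing {ψ : E3 → G} (hψ : ContDiff ℝ ∞ ψ) :
    ContDiff ℝ ∞ fun r => wavePairing r ψ := by
  have hD : ContDiff ℝ ∞ (fderiv ℝ ψ) := hψ.fderiv_right (by simp)
  exact (contDiff_integral_sphere (P := ℝ)
    (g := fun q : ℝ × E3 => ψ (q.1 • q.2) + q.1 • fderiv ℝ ψ (q.1 • q.2) q.2)
    (by fun_prop)).const_smul _

/-- `ℰ^w` is the fundamental solution of the Cauchy problem for the wave equation. -/
theorem isWaveFundamentalSolution_waveFundamental :
    IsWaveFundamentalSolution waveFundamental := by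
  intro ψ
  have hψ : ContDiff ℝ ∞ (ψ : E3 → ℝ) := ψ.contDiff
  have hfun : (fun r => waveFundamental r ψ) = fun r => wavePairing r ψ :=
    funext fun r => waveFundamental_apply r ψ
  have hd : ∀ r, HasDerivAt (fun s => waveFundamental s ψ) (r • sphMean r (laplace3 ψ)) r := by
    intro r
    rw [hfun]
    exact hasDerivAt_wavePairing hψ r
  have hline : ∀ (k : Fin 3) (f : 𝓓((⊤ : TopologicalSpace.Opens E3), ℝ)),
      ((∂_{basisVec k} f : 𝓓((⊤ : TopologicalSpace.Opens E3), ℝ)) : E3 → ℝ) = partialX k f := by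
    intro k f
    funext y
    rw [TestFunction.lineDerivOp_eq_lineDerivCLM ℝ,
      TestFunction.lineDerivCLM_apply_of_le (by simp)]
    have hf : ContDiff ℝ ∞ (f : E3 → ℝ) := f.contDiff
    exact (hf.differentiable (by simp) y).lineDeriv_eq_fderiv
  refine ⟨?_, ?_, ?_, ?_⟩
  · rw [hfun]
    exact contDiff_infty.1 (contDiff_wavePairing hψ) 2
  · intro r
    have h1 : (deriv fun s => waveFundamental s ψ) = fun r => r • sphMean r (laplace3 ψ) :=
      funext fun r => (hd r).deriv
    rw [h1, (hasDerivAt_smul_sphMean hψ.laplace3 r).deriv]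
    -- Transposing a distributional derivative costs a sign; two of them cancel.
    have h2 : ∀ k, (∂_{basisVec k} (∂_{basisVec k} (waveFundamental r))) ψ =
        waveFundamental r (∂_{basisVec k} (∂_{basisVec k} ψ)) := by
      intro k
      rw [Distribution.lineDerivOp_apply_apply, Distribution.lineDerivOp_apply_apply,
        LineDeriv.lineDerivOp_neg, neg_neg]
    have h3 : (∑ k, ∂_{basisVec k} (∂_{basisVec k} (waveFundamental r))) ψ =
        ∑ k, (∂_{basisVec k} (∂_{basisVec k} (waveFundamental r))) ψ := by
      simp
    rw [h3]
    simp_rw [h2]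
    rw [← map_sum, waveFundamental_apply]
    have h4 : ((∑ k, ∂_{basisVec k} (∂_{basisVec k} ψ) :
        𝓓((⊤ : TopologicalSpace.Opens E3), ℝ)) : E3 → ℝ) = laplace3 ψ := by
      funext y
      simp only [laplace3, ← hline]
      simp
    rw [h4]
  · rw [waveFundamental_apply, wavePairing_zero, Distribution.delta_apply]
  · simpa using (hd 0).deriv

end Wave

/-! ### Convolution with the fundamental solution -/

section WaveConv

theorem hasFDerivAt_comp_const_sub {φ : E3 → ℂ} (hφ : Differentiable ℝ φ) (x z : E3) :
    HasFDerivAt (fun z => φ (x - z)) (-fderiv ℝ φ (x - z)) z := by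
  have h := (hφ (x - z)).hasFDerivAt.comp z ((hasFDerivAt_id z).const_sub x)
  convert! h using 1
  ext v
  simp

theorem partialX_comp_const_sub {φ : E3 → ℂ} (hφ : Differentiable ℝ φ) (k : Fin 3) (x : E3) :
    partialX k (fun z => φ (x - z)) = fun z => -partialX k φ (x - z) := by
  funext z
  simp [partialX, (hasFDerivAt_comp_const_sub hφ x z).fderiv]

theorem laplace3_comp_const_sub {φ : E3 → ℂ} (hφ : ContDiff ℝ ∞ φ) (x : E3) :
    laplace3 (fun z => φ (x - z)) = fun z => laplace3 φ (x - z) := by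
  funext z
  unfold laplace3
  refine Finset.sum_congr rfl fun k _ => ?_
  rw [partialX_comp_const_sub (hφ.differentiable (by simp)) k x]
  have h := partialX_comp_const_sub ((hφ.partialX k).differentiable (by simp)) k x
  have h2 : partialX k (fun z => -partialX k φ (x - z)) z =
      -partialX k (fun z => partialX k φ (x - z)) z := by
    simp only [partialX]
    rw [fderiv_fun_neg]
    rfl
  rw [h2, h, neg_neg]

/-- The derivative in `r` of `waveConv r φ x`. -/
def waveConvVel (r : ℝ) (φ : E3 → ℂ) (x : E3) : ℂ :=
  r • sphMean r fun z => laplace3 φ (x - z)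

theorem hasDerivAt_waveConv {φ : E3 → ℂ} (hφ : ContDiff ℝ ∞ φ) (x : E3) (r : ℝ) :
    HasDerivAt (fun r => waveConv r φ x) (waveConvVel r φ x) r := by
  have h := hasDerivAt_wavePairing (ψ := fun z => φ (x - z)) (by fun_prop) r
  rwa [laplace3_comp_const_sub hφ] at h

theorem hasDerivAt_waveConvVel {φ : E3 → ℂ} (hφ : ContDiff ℝ ∞ φ) (x : E3) (r : ℝ) :
    HasDerivAt (fun r => waveConvVel r φ x) (waveConv r (laplace3 φ) x) r := by
  have := hφ.laplace3
  exact hasDerivAt_smul_sphMean (ψ := fun z => laplace3 φ (x - z)) (by fun_prop) r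

theorem waveConvVel_zero (φ : E3 → ℂ) (x : E3) : waveConvVel 0 φ x = 0 := by
  simp [waveConvVel]

theorem waveConv_zero (φ : E3 → ℂ) (x : E3) : waveConv 0 φ x = φ x := by
  simp [waveConv, wavePairing_zero]

theorem waveConv_eq {φ : E3 → ℂ} (hφ : Differentiable ℝ φ) (r : ℝ) (x : E3) :
    waveConv r φ x = (4 * Real.pi)⁻¹ • ∫ w : Metric.sphere (0 : E3) 1,
      (φ (x - r • (w : E3)) - r • fderiv ℝ φ (x - r • (w : E3)) w)
        ∂(volume : Measure E3).toSphere := by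
  unfold waveConv wavePairing
  congr 1
  refine integral_congr_ae (Filter.Eventually.of_forall fun w => ?_)
  beta_reduce
  rw [(hasFDerivAt_comp_const_sub hφ x _).fderiv, _root_.neg_apply, smul_neg, ← sub_eq_add_neg]

/-- Smoothness is needed jointly in position, radius and source time, because all three vary in the
Duhamel integral. -/
theorem contDiff_waveConv {f : E3 → ℝ → ℂ} (hf : ContDiff ℝ ∞ fun p : E3 × ℝ => f p.1 p.2) :
    ContDiff ℝ ∞ fun p : E3 × ℝ × ℝ => waveConv p.2.1 (fun y => f y p.2.2) p.1 := by
  have hd : ∀ y b, HasFDerivAt (fun y => f y b)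
      ((fderiv ℝ (fun p : E3 × ℝ => f p.1 p.2) (y, b)).comp
        (ContinuousLinearMap.inl ℝ E3 ℝ)) y := fun y b =>
    HasFDerivAt.comp (f := fun y => (y, b)) y (hf.differentiable (by simp) (y, b)).hasFDerivAt
      (hasFDerivAt_prodMk_left y b)
  have hD : ContDiff ℝ ∞ (fderiv ℝ fun p : E3 × ℝ => f p.1 p.2) := hf.fderiv_right (by simp)
  have h : (fun p : E3 × ℝ × ℝ => waveConv p.2.1 (fun y => f y p.2.2) p.1) = fun p =>
      (4 * Real.pi)⁻¹ • ∫ w : Metric.sphere (0 : E3) 1,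
      (fun q : (E3 × ℝ × ℝ) × E3 => f (q.1.1 - q.1.2.1 • q.2) q.1.2.2 -
        q.1.2.1 • fderiv ℝ (fun p : E3 × ℝ => f p.1 p.2)
          (q.1.1 - q.1.2.1 • q.2, q.1.2.2) (q.2, 0)) (p, (w : E3))
        ∂(volume : Measure E3).toSphere := by
    funext p
    rw [waveConv_eq fun y => (hd y _).differentiableAt]
    simp [(hd _ _).fderiv]
  rw [h]
  refine ContDiff.const_smul _ (contDiff_integral_sphere
    (g := fun q : (E3 × ℝ × ℝ) × E3 => f (q.1.1 - q.1.2.1 • q.2) q.1.2.2 -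
        q.1.2.1 • fderiv ℝ (fun p : E3 × ℝ => f p.1 p.2)
          (q.1.1 - q.1.2.1 • q.2, q.1.2.2) (q.2, 0)) ?_)
  have h1 : ContDiff ℝ ∞ fun q : (E3 × ℝ × ℝ) × E3 => f (q.1.1 - q.1.2.1 • q.2) q.1.2.2 :=
    hf.comp (f := fun q : (E3 × ℝ × ℝ) × E3 => (q.1.1 - q.1.2.1 • q.2, q.1.2.2)) (by fun_prop)
  fun_prop

theorem partialX_waveConv {φ : E3 → ℂ} (hφ : ContDiff ℝ ∞ φ) (r : ℝ) (k : Fin 3) :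
    partialX k (fun x => waveConv r φ x) = fun x => waveConv r (partialX k φ) x := by
  have hD : ContDiff ℝ ∞ (fderiv ℝ φ) := hφ.fderiv_right (by simp)
  have hdiff : Differentiable ℝ φ := hφ.differentiable (by simp)
  have hg : ContDiff ℝ 1 fun q : E3 × E3 => φ (q.1 - r • q.2) - r • fderiv ℝ φ (q.1 - r • q.2) q.2 :=
    ContDiff.of_le (n := ∞) (by fun_prop) (by simp)
  funext x
  have h1 : (fun x => waveConv r φ x) = fun x => (4 * Real.pi)⁻¹ •
      ∫ w : Metric.sphere (0 : E3) 1,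
      (fun q : E3 × E3 => φ (q.1 - r • q.2) - r • fderiv ℝ φ (q.1 - r • q.2) q.2) (x, (w : E3))
        ∂(volume : Measure E3).toSphere := funext fun x => waveConv_eq hdiff r x
  have hF := hasFDerivAt_integral_of_compact (μ := (volume : Measure E3).toSphere)
    (κ := ((↑) : Metric.sphere (0 : E3) 1 → E3)) continuous_subtype_val isOpen_univ
    hg.contDiffOn (p := x) fun _ => trivial
  rw [waveConv_eq ((hφ.partialX k).differentiable (by simp)), h1, partialX,
    fderiv_fun_const_smul hF.differentiableAt, _root_.smul_apply,
    fderiv_integral_of_compact_apply continuous_subtype_val isOpen_univ hg.contDiffOn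
      (fun _ => trivial)]
  congr 1
  refine integral_congr_ae (Filter.Eventually.of_forall fun w => ?_)
  have hxw : HasFDerivAt (fun q : E3 × E3 => q.1 - r • q.2)
      (ContinuousLinearMap.fst ℝ E3 E3 - r • ContinuousLinearMap.snd ℝ E3 E3) (x, (w : E3)) :=
    hasFDerivAt_fst.sub (hasFDerivAt_snd.const_smul r)
  have e1 := (hdiff (x - r • (w : E3))).hasFDerivAt.comp (x, (w : E3)) hxw
  have e2 := ((hD.differentiable (by simp) (x - r • (w : E3))).hasFDerivAt.comp (x, (w : E3))
    hxw).clm_apply (hasFDerivAt_snd (𝕜 := ℝ) (p := (x, (w : E3))))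
  have e3 := e1.sub (e2.const_smul r)
  -- The radial derivative sits inside the spherical integral and `∂_k` outside; they commute by
  -- symmetry of the second derivative.
  have hsym : IsSymmSndFDerivAt ℝ φ (x - r • (w : E3)) :=
    (contDiff_infty.1 hφ 2).contDiffAt.isSymmSndFDerivAt (by simp)
  have e4 : fderiv ℝ (partialX k φ) (x - r • (w : E3)) w =
      fderiv ℝ (fderiv ℝ φ) (x - r • (w : E3)) w (basisVec k) := by
    have : HasFDerivAt (partialX k φ) _ (x - r • (w : E3)) :=
      ((hD.differentiable (by simp) (x - r • (w : E3))).hasFDerivAt).clm_apply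
        (hasFDerivAt_const (basisVec k) _)
    rw [this.fderiv]
    simp
  change fderiv ℝ (fun q : E3 × E3 => φ (q.1 - r • q.2) - r • fderiv ℝ φ (q.1 - r • q.2) q.2)
    (x, (w : E3)) (basisVec k, 0) = partialX k φ (x - r • (w : E3)) -
      r • fderiv ℝ (partialX k φ) (x - r • (w : E3)) w
  rw [e4]
  have e5 := e3.fderiv
  simp only [Function.comp_def] at e5
  refine (congrArg (fun L => L (basisVec k, (0 : E3))) e5).trans ?_
  simp [partialX, hsym.eq]

theorem waveConv_sum {ι : Type} (s : Finset ι) {φ : ι → E3 → ℂ} (hφ : ∀ i, ContDiff ℝ ∞ (φ i))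
    (r : ℝ) (x : E3) : waveConv r (fun y => ∑ i ∈ s, φ i y) x = ∑ i ∈ s, waveConv r (φ i) x := by
  have hdiff : ∀ i, Differentiable ℝ (φ i) := fun i => (hφ i).differentiable (by simp)
  rw [waveConv_eq (by fun_prop)]
  simp_rw [waveConv_eq (hdiff _)]
  rw [← Finset.smul_sum, ← integral_finsetSum]
  · congr 1
    refine integral_congr_ae (Filter.Eventually.of_forall fun w => ?_)
    simp only
    rw [fderiv_fun_sum fun i _ => hdiff i _, Finset.sum_sub_distrib, ← Finset.smul_sum]
    simp
  · intro i _
    have hD : ContDiff ℝ ∞ (fderiv ℝ (φ i)) := (hφ i).fderiv_right (by simp)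
    have := hD.continuous
    have := (hφ i).continuous
    exact integrable_of_continuous_compactSpace (by fun_prop)

end WaveConv

/-! ### The hypergeometric equation -/

section Hypergeometric

theorem mem_eball_one {z : ℂ} (hz : ‖z‖ < 1) : z ∈ Metric.eball (0 : ℂ) 1 := by
  rw [← ENNReal.ofReal_one, Metric.eball_ofReal]
  simpa using hz

/-- The series of the derivative. -/
def derivCoeffSeries (p : FormalMultilinearSeries ℂ ℂ ℂ) : FormalMultilinearSeries ℂ ℂ ℂ :=
  (ContinuousLinearMap.apply ℂ ℂ (1 : ℂ)).compFormalMultilinearSeries p.derivSeries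

theorem coeff_derivCoeffSeries (p : FormalMultilinearSeries ℂ ℂ ℂ) (n : ℕ) :
    (derivCoeffSeries p).coeff n = (n + 1) * p.coeff (n + 1) := by
  have := p.derivSeries_coeff_one n
  rw [nsmul_eq_mul, Nat.cast_succ] at this
  rw [← this]
  rfl

theorem HasFPowerSeriesOnBall.derivCoeffSeries {f : ℂ → ℂ} {p : FormalMultilinearSeries ℂ ℂ ℂ}
    {r : ENNReal} (h : HasFPowerSeriesOnBall f p 0 r) :
    HasFPowerSeriesOnBall (deriv f) (derivCoeffSeries p) 0 r :=
  (ContinuousLinearMap.apply ℂ ℂ (1 : ℂ)).comp_hasFPowerSeriesOnBall h.fderiv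

theorem HasFPowerSeriesOnBall.hasSum_coeff {f : ℂ → ℂ} {p : FormalMultilinearSeries ℂ ℂ ℂ}
    (h : HasFPowerSeriesOnBall f p 0 1) {z : ℂ} (hz : ‖z‖ < 1) :
    HasSum (fun n => z ^ n * p.coeff n) (f z) := by
  have := h.hasSum (y := z) (mem_eball_one hz)
  simpa using this

/-- The coefficients of `₂F₁ μ μ 1`. -/
def hypCoeff (μ : ℂ) (n : ℕ) : ℂ := ordinaryHypergeometricCoefficient μ μ 1 n

/-- The hypergeometric equation with parameters `μ, μ, 1`, read off on coefficients. -/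
theorem hypCoeff_succ (μ : ℂ) (n : ℕ) :
    ((n : ℂ) + 1) ^ 2 * hypCoeff μ (n + 1) = (μ + n) ^ 2 * hypCoeff μ n := by
  have h1 : (ascPochhammer ℂ n).eval 1 ≠ 0 := by
    rw [ascPochhammer_eval_one]; exact_mod_cast n.factorial_ne_zero
  have h2 : (n : ℂ) + 1 ≠ 0 := by exact_mod_cast n.succ_ne_zero
  have h3 : (n.factorial : ℂ) ≠ 0 := by exact_mod_cast n.factorial_ne_zero
  have h4 : (1 : ℂ) + n ≠ 0 := by rwa [add_comm]
  simp only [hypCoeff, ordinaryHypergeometricCoefficient, ascPochhammer_succ_eval,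
    Nat.factorial_succ, Nat.cast_mul, Nat.cast_succ]
  field_simp
  ring

theorem hasFPowerSeriesOnBall_hyp (μ : ℂ) :
    HasFPowerSeriesOnBall (ordinaryHypergeometric μ μ 1 : ℂ → ℂ)
      (FormalMultilinearSeries.ofScalars ℂ (hypCoeff μ)) 0 1 := by
  have hr : 1 ≤ (ordinaryHypergeometricSeries ℂ μ μ (1 : ℂ)).radius := by
    -- If `-μ` is a natural number the series terminates and its radius is infinite; otherwise the
    -- radius is exactly `1`.
    by_cases h : ∃ k : ℕ, (k : ℂ) = -μ
    · obtain ⟨k, hk⟩ := h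
      have : μ = -(k : ℂ) := by rw [hk, neg_neg]
      rw [this, ordinaryHypergeometric_radius_top_of_neg_nat₁]
      exact le_top
    · push Not at h
      rw [ordinaryHypergeometricSeries_radius_eq_one]
      refine fun k => ⟨h k, h k, fun hk => ?_⟩
      have : ((k : ℂ) + 1) = 0 := by rw [hk]; ring
      exact absurd this (by exact_mod_cast k.succ_ne_zero)
  exact ((ordinaryHypergeometricSeries ℂ μ μ (1 : ℂ)).hasFPowerSeriesOnBall
    (zero_lt_one.trans_le hr)).mono one_pos hr

/-- `₂F₁ μ μ 1`. -/
def hypF (μ : ℂ) : ℂ → ℂ := ordinaryHypergeometric μ μ 1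

theorem hasDerivAt_hypF (μ : ℂ) {z : ℂ} (hz : ‖z‖ < 1) :
    HasDerivAt (hypF μ) (deriv (hypF μ) z) z :=
  ((hasFPowerSeriesOnBall_hyp μ).analyticAt_of_mem (mem_eball_one hz)).differentiableAt.hasDerivAt

theorem hasDerivAt_deriv_hypF (μ : ℂ) {z : ℂ} (hz : ‖z‖ < 1) :
    HasDerivAt (deriv (hypF μ)) (deriv (deriv (hypF μ)) z) z :=
  ((hasFPowerSeriesOnBall_hyp μ).derivCoeffSeries.analyticAt_of_mem (mem_eball_one hz)).differentiableAt.hasDerivAt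

/-- The hypergeometric differential equation. -/
theorem hypF_ode (μ : ℂ) {z : ℂ} (hz : ‖z‖ < 1) :
    z * (1 - z) * deriv (deriv (hypF μ)) z + (1 - (2 * μ + 1) * z) * deriv (hypF μ) z
      - μ ^ 2 * hypF μ z = 0 := by
  have h0 := (hasFPowerSeriesOnBall_hyp μ).hasSum_coeff hz
  have h1 := (hasFPowerSeriesOnBall_hyp μ).derivCoeffSeries.hasSum_coeff hz
  have h2 := (hasFPowerSeriesOnBall_hyp μ).derivCoeffSeries.derivCoeffSeries.hasSum_coeff hz
  simp only [coeff_derivCoeffSeries, FormalMultilinearSeries.coeff_ofScalars] at h0 h1 h2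
  change HasSum _ (hypF μ z) at h0
  change HasSum _ (deriv (hypF μ) z) at h1
  change HasSum _ (deriv (deriv (hypF μ)) z) at h2
  -- The factor `n` kills the term `n = 0`, so the index shift loses nothing; `n (n - 1)` does the
  -- same for two terms below.
  have h1z : HasSum (fun n : ℕ => (n : ℂ) * z ^ n * hypCoeff μ n) (z * deriv (hypF μ) z) := by
    rw [← hasSum_nat_add_iff' 1]
    convert! h1.mul_left z using 1
    · funext n
      push_cast
      ring
    · simp
  have h2z : HasSum (fun n : ℕ => (n : ℂ) * (n + 1) * z ^ n * hypCoeff μ (n + 1))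
      (z * deriv (deriv (hypF μ)) z) := by
    rw [← hasSum_nat_add_iff' 1]
    convert! h2.mul_left z using 1
    · funext n
      push_cast
      ring
    · simp
  have h2zz : HasSum (fun n : ℕ => (n : ℂ) * (n - 1) * z ^ n * hypCoeff μ n)
      (z ^ 2 * deriv (deriv (hypF μ)) z) := by
    rw [← hasSum_nat_add_iff' 2]
    convert! h2.mul_left (z ^ 2) using 1
    · funext n
      push_cast
      ring
    · simp [Finset.sum_range_succ]
  have hs := ((h2z.sub h2zz).add (h1.sub (h1z.mul_left (2 * μ + 1)))).sub (h0.mul_left (μ ^ 2))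
  -- The `n`-th term is `zⁿ ((n + 1)² c_{n+1} - (n + μ)² c_n)`.
  have hzero : (fun n : ℕ => (n : ℂ) * (n + 1) * z ^ n * hypCoeff μ (n + 1) -
      (n : ℂ) * (n - 1) * z ^ n * hypCoeff μ n + (z ^ n * (((n : ℂ) + 1) * hypCoeff μ (n + 1)) -
      (2 * μ + 1) * ((n : ℂ) * z ^ n * hypCoeff μ n)) - μ ^ 2 * (z ^ n * hypCoeff μ n)) =
      fun _ => 0 := by
    funext n
    linear_combination z ^ n * hypCoeff_succ μ n
  rw [hzero] at hs
  have := hs.unique hasSum_zero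
  linear_combination this

theorem contDiffOn_hypF (μ : ℂ) : ContDiffOn ℝ ∞ (hypF μ) (Metric.ball 0 1) := by
  intro z hz
  have h : AnalyticAt ℂ (hypF μ) z := (hasFPowerSeriesOnBall_hyp μ).analyticAt_of_mem
    (mem_eball_one (by simpa using hz))
  exact (h.restrictScalars (𝕜 := ℝ)).contDiffAt.contDiffWithinAt

theorem contDiffOn_deriv_hypF (μ : ℂ) : ContDiffOn ℝ ∞ (deriv (hypF μ)) (Metric.ball 0 1) := by
  intro z hz
  have h : AnalyticAt ℂ (deriv (hypF μ)) z :=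
    (hasFPowerSeriesOnBall_hyp μ).derivCoeffSeries.analyticAt_of_mem
      (mem_eball_one (by simpa using hz))
  exact (h.restrictScalars (𝕜 := ℝ)).contDiffAt.contDiffWithinAt

end Hypergeometric

/-! ### The Riemann function of the Euler–Poisson–Darboux equation -/

section Kernel

/-- With the real logarithm, powers of a positive function are exponentials and no branch cut
interferes with differentiation. -/
theorem ofReal_cpow_eq_exp {x : ℝ} (hx : 0 < x) (c : ℂ) :
    (x : ℂ) ^ c = Complex.exp ((Real.log x : ℝ) * c) := by
  rw [Complex.cpow_def_of_ne_zero (by exact_mod_cast hx.ne'), Complex.ofReal_log hx.le]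

theorem contDiffOn_ofReal_cpow {E' : Type*} [NormedAddCommGroup E'] [NormedSpace ℝ E']
    {f : E' → ℝ} {s : Set E'} {n : WithTop ℕ∞} (hf : ContDiffOn ℝ n f s) (hpos : ∀ x ∈ s, 0 < f x)
    (c : ℂ) : ContDiffOn ℝ n (fun x => (f x : ℂ) ^ c) s := by
  have h : ContDiffOn ℝ n (fun x => ((Real.log (f x) : ℝ) : ℂ)) s :=
    Complex.ofRealCLM.contDiff.comp_contDiffOn (hf.log fun x hx => (hpos x hx).ne')
  exact (h.mul contDiffOn_const).cexp.congr fun x hx => ofReal_cpow_eq_exp (hpos x hx) c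

theorem hasDerivAt_ofReal_cpow {f : ℝ → ℝ} {f' s : ℝ} (hf : HasDerivAt f f' s) (hpos : 0 < f s)
    (c : ℂ) : HasDerivAt (fun x => (f x : ℂ) ^ c) ((f s : ℂ) ^ c * (c * (f' / f s))) s := by
  have h1 := (((hf.log hpos.ne').ofReal_comp).mul_const c).cexp
  have h2 : ∀ᶠ x in nhds s, 0 < f x := hf.continuousAt.eventually (lt_mem_nhds hpos)
  refine (h1.congr_of_eventuallyEq ?_).congr_deriv ?_
  · filter_upwards [h2] with x hx
    exact ofReal_cpow_eq_exp hx c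
  · rw [ofReal_cpow_eq_exp hpos]
    push_cast
    ring

/-- `ζ^{-μ} F(μ, μ; 1; ξ / ζ)`. -/
def coreFun (μ : ℂ) (ζ ξ : ℝ) : ℂ := (ζ : ℂ) ^ (-μ) * hypF μ ((ξ / ζ : ℝ) : ℂ)

/-- The first derivative of `coreFun` along a curve. -/
def coreFun1 (μ : ℂ) (ζ ξ ζ' ξ' : ℝ) : ℂ :=
  (ζ : ℂ) ^ (-μ) * (-μ * (ζ' / ζ) * hypF μ ((ξ / ζ : ℝ) : ℂ) +
    ((ξ' - ξ / ζ * ζ') / ζ) * deriv (hypF μ) ((ξ / ζ : ℝ) : ℂ))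

/-- The second derivative of `coreFun` along a curve with second derivatives `(c, c)`. -/
def coreFun2 (μ : ℂ) (ζ ξ ζ' ξ' c : ℝ) : ℂ :=
  (ζ : ℂ) ^ (-μ) * (
    (μ ^ 2 * (ζ' / ζ) ^ 2 - μ * (c / ζ - (ζ' / ζ) ^ 2)) * hypF μ ((ξ / ζ : ℝ) : ℂ) +
    (-2 * μ * (ζ' / ζ) * ((ξ' - ξ / ζ * ζ') / ζ) + ((c - ξ / ζ * c) / ζ -
      2 * ((ξ' - ξ / ζ * ζ') / ζ) * (ζ' / ζ))) * deriv (hypF μ) ((ξ / ζ : ℝ) : ℂ) +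
    ((ξ' - ξ / ζ * ζ') / ζ) ^ 2 * deriv (deriv (hypF μ)) ((ξ / ζ : ℝ) : ℂ))

theorem norm_ofReal_div_lt_one {ζ ξ : ℝ} (h : |ξ| < ζ) : ‖((ξ / ζ : ℝ) : ℂ)‖ < 1 := by
  have hζ : 0 < ζ := (abs_nonneg ξ).trans_lt h
  rw [Complex.norm_real, Real.norm_eq_abs, abs_div, abs_of_pos hζ, div_lt_one hζ]
  exact h

theorem hasDerivAt_div_curve {ζ ξ : ℝ → ℝ} {ζ' ξ' s : ℝ} (hζ : HasDerivAt ζ ζ' s)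
    (hξ : HasDerivAt ξ ξ' s) (h0 : ζ s ≠ 0) :
    HasDerivAt (fun s => ξ s / ζ s) ((ξ' - ξ s / ζ s * ζ') / ζ s) s := by
  refine (hξ.div hζ h0).congr_deriv ?_
  field_simp

theorem hasDerivAt_coreFun (μ : ℂ) {ζ ξ : ℝ → ℝ} {ζ' ξ' s : ℝ} (hζ : HasDerivAt ζ ζ' s)
    (hξ : HasDerivAt ξ ξ' s) (h : |ξ s| < ζ s) :
    HasDerivAt (fun s => coreFun μ (ζ s) (ξ s)) (coreFun1 μ (ζ s) (ξ s) ζ' ξ') s := by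
  have hpos : 0 < ζ s := (abs_nonneg _).trans_lt h
  have hz := hasDerivAt_div_curve hζ hξ hpos.ne'
  have h1 := hasDerivAt_ofReal_cpow hζ hpos (-μ)
  have h2 := (hasDerivAt_hypF μ (norm_ofReal_div_lt_one h)).comp_ofReal.scomp s hz
  refine (h1.mul h2).congr_deriv ?_
  simp only [coreFun1, Function.comp_apply, real_smul]
  push_cast
  ring

theorem hasDerivAt_coreFun1 (μ : ℂ) {ζ ξ ζ' ξ' : ℝ → ℝ} {c s : ℝ} (hζ : HasDerivAt ζ (ζ' s) s)
    (hξ : HasDerivAt ξ (ξ' s) s) (hζ' : HasDerivAt ζ' c s) (hξ' : HasDerivAt ξ' c s)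
    (h : |ξ s| < ζ s) :
    HasDerivAt (fun s => coreFun1 μ (ζ s) (ξ s) (ζ' s) (ξ' s))
      (coreFun2 μ (ζ s) (ξ s) (ζ' s) (ξ' s) c) s := by
  have hpos : 0 < ζ s := (abs_nonneg _).trans_lt h
  have hposC : (ζ s : ℂ) ≠ 0 := by exact_mod_cast hpos.ne'
  have hz := hasDerivAt_div_curve hζ hξ hpos.ne'
  have h1 := hasDerivAt_ofReal_cpow hζ hpos (-μ)
  have h2 := (hasDerivAt_hypF μ (norm_ofReal_div_lt_one h)).comp_ofReal.scomp s hz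
  have h3 := (hasDerivAt_deriv_hypF μ (norm_ofReal_div_lt_one h)).comp_ofReal.scomp s hz
  have hp := (hasDerivAt_div_curve hζ hζ' hpos.ne').ofReal_comp
  have hq := (hasDerivAt_div_curve hζ (hξ'.sub (hz.mul hζ')) hpos.ne').ofReal_comp
  have hall := h1.mul (((hp.const_mul (-μ)).mul h2).add (hq.mul h3))
  refine (hall.congr_of_eventuallyEq (Filter.Eventually.of_forall fun x => ?_)).congr_deriv ?_
  · simp [coreFun1]
  · simp only [coreFun2, Function.comp_apply, real_smul, Pi.mul_apply, Pi.sub_apply, Pi.add_apply]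
    push_cast
    field_simp
    ring

/-- The Euler–Poisson–Darboux equation for the Riemann function. -/
theorem coreFun_epd (μ : ℂ) {r τ τ₀ : ℝ} (hτ : τ ≠ 0)
    (h : |(τ - τ₀) ^ 2 - r ^ 2| < (τ + τ₀) ^ 2 - r ^ 2) :
    coreFun2 μ ((τ + τ₀) ^ 2 - r ^ 2) ((τ - τ₀) ^ 2 - r ^ 2) (2 * (τ + τ₀)) (2 * (τ - τ₀)) 2 +
      2 * μ / τ * coreFun1 μ ((τ + τ₀) ^ 2 - r ^ 2) ((τ - τ₀) ^ 2 - r ^ 2)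
        (2 * (τ + τ₀)) (2 * (τ - τ₀)) =
    coreFun2 μ ((τ + τ₀) ^ 2 - r ^ 2) ((τ - τ₀) ^ 2 - r ^ 2) (-2 * r) (-2 * r) (-2) := by
  have hpos : 0 < (τ + τ₀) ^ 2 - r ^ 2 := (abs_nonneg _).trans_lt h
  have hode := hypF_ode μ (norm_ofReal_div_lt_one h)
  have hτC : (τ : ℂ) ≠ 0 := by exact_mod_cast hτ
  obtain ⟨ζ, hζ⟩ : ∃ ζ, ζ = (τ + τ₀) ^ 2 - r ^ 2 := ⟨_, rfl⟩
  obtain ⟨ξ, hξ⟩ : ∃ ξ, ξ = (τ - τ₀) ^ 2 - r ^ 2 := ⟨_, rfl⟩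
  rw [← hζ, ← hξ] at hode ⊢
  rw [← hζ] at hpos
  have hζC : (ζ : ℂ) ≠ 0 := by exact_mod_cast hpos.ne'
  simp only [coreFun1, coreFun2]
  obtain ⟨F0, hF0⟩ : ∃ F0, F0 = hypF μ ((ξ / ζ : ℝ) : ℂ) := ⟨_, rfl⟩
  obtain ⟨F1, hF1⟩ : ∃ F1, F1 = deriv (hypF μ) ((ξ / ζ : ℝ) : ℂ) := ⟨_, rfl⟩
  obtain ⟨F2, hF2⟩ : ∃ F2, F2 = deriv (deriv (hypF μ)) ((ξ / ζ : ℝ) : ℂ) := ⟨_, rfl⟩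
  rw [← hF0, ← hF1, ← hF2] at hode ⊢
  have hζ' : (ζ : ℂ) = (τ + τ₀) ^ 2 - r ^ 2 := by rw [hζ]; push_cast; ring
  have hξ' : (ξ : ℂ) = (τ - τ₀) ^ 2 - r ^ 2 := by rw [hξ]; push_cast; ring
  push_cast at hode ⊢
  have key : ∀ A : ℂ, A * 0 = 0 := mul_zero
  -- The two sides differ by the hypergeometric equation times `ζ^{-μ} · 4τ₀/(τζ)`. Since `ζ - ξ =
  -- 4ττ₀`, eliminating `ξ` and `r²` leaves a rational identity in `τ`, `τ₀`, `ζ`.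
  rw [← sub_eq_zero, ← key ((ζ : ℂ) ^ (-μ) * (4 * τ₀ / (τ * ζ))), ← hode]
  have hr : (r : ℂ) ^ 2 = (τ + τ₀) ^ 2 - ζ := by rw [hζ']; ring
  have hξζ : (ξ : ℂ) = ζ - 4 * τ * τ₀ := by rw [hξ', hζ']; ring
  rw [hξζ]
  field_simp
  ring_nf
  simp only [hr]
  ring

theorem hasDerivAt_coreFun_tau (μ : ℂ) {r τ τ₀ : ℝ}
    (h : |(τ - τ₀) ^ 2 - r ^ 2| < (τ + τ₀) ^ 2 - r ^ 2) :
    HasDerivAt (fun τ => coreFun μ ((τ + τ₀) ^ 2 - r ^ 2) ((τ - τ₀) ^ 2 - r ^ 2))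
      (coreFun1 μ ((τ + τ₀) ^ 2 - r ^ 2) ((τ - τ₀) ^ 2 - r ^ 2) (2 * (τ + τ₀)) (2 * (τ - τ₀))) τ := by
  have h1 : HasDerivAt (fun τ => (τ + τ₀) ^ 2 - r ^ 2) (2 * (τ + τ₀)) τ := by
    simpa using (((hasDerivAt_id τ).add_const τ₀).pow 2).sub_const (r ^ 2)
  have h2 : HasDerivAt (fun τ => (τ - τ₀) ^ 2 - r ^ 2) (2 * (τ - τ₀)) τ := by
    simpa using (((hasDerivAt_id τ).sub_const τ₀).pow 2).sub_const (r ^ 2)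
  exact hasDerivAt_coreFun μ h1 h2 h

theorem hasDerivAt_coreFun1_tau (μ : ℂ) {r τ τ₀ : ℝ}
    (h : |(τ - τ₀) ^ 2 - r ^ 2| < (τ + τ₀) ^ 2 - r ^ 2) :
    HasDerivAt (fun τ => coreFun1 μ ((τ + τ₀) ^ 2 - r ^ 2) ((τ - τ₀) ^ 2 - r ^ 2)
        (2 * (τ + τ₀)) (2 * (τ - τ₀)))
      (coreFun2 μ ((τ + τ₀) ^ 2 - r ^ 2) ((τ - τ₀) ^ 2 - r ^ 2)
        (2 * (τ + τ₀)) (2 * (τ - τ₀)) 2) τ := by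
  have h1 : HasDerivAt (fun τ => (τ + τ₀) ^ 2 - r ^ 2) (2 * (τ + τ₀)) τ := by
    simpa using (((hasDerivAt_id τ).add_const τ₀).pow 2).sub_const (r ^ 2)
  have h2 : HasDerivAt (fun τ => (τ - τ₀) ^ 2 - r ^ 2) (2 * (τ - τ₀)) τ := by
    simpa using (((hasDerivAt_id τ).sub_const τ₀).pow 2).sub_const (r ^ 2)
  have h3 : HasDerivAt (fun τ => 2 * (τ + τ₀)) 2 τ := by
    simpa using ((hasDerivAt_id τ).add_const τ₀).const_mul 2
  have h4 : HasDerivAt (fun τ => 2 * (τ - τ₀)) 2 τ := by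
    simpa using ((hasDerivAt_id τ).sub_const τ₀).const_mul 2
  exact hasDerivAt_coreFun1 μ (ζ' := fun τ => 2 * (τ + τ₀)) (ξ' := fun τ => 2 * (τ - τ₀))
    h1 h2 h3 h4 h

theorem hasDerivAt_sub_sq (a r : ℝ) : HasDerivAt (fun r => a - r ^ 2) (-2 * r) r := by
  simpa using ((hasDerivAt_id r).pow 2).const_sub a

theorem hasDerivAt_coreFun_r (μ : ℂ) {r a b : ℝ} (h : |b - r ^ 2| < a - r ^ 2) :
    HasDerivAt (fun r => coreFun μ (a - r ^ 2) (b - r ^ 2))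
      (coreFun1 μ (a - r ^ 2) (b - r ^ 2) (-2 * r) (-2 * r)) r :=
  hasDerivAt_coreFun μ (hasDerivAt_sub_sq a r) (hasDerivAt_sub_sq b r) h

theorem hasDerivAt_coreFun1_r (μ : ℂ) {r a b : ℝ} (h : |b - r ^ 2| < a - r ^ 2) :
    HasDerivAt (fun r => coreFun1 μ (a - r ^ 2) (b - r ^ 2) (-2 * r) (-2 * r))
      (coreFun2 μ (a - r ^ 2) (b - r ^ 2) (-2 * r) (-2 * r) (-2)) r := by
  have h3 : HasDerivAt (fun r : ℝ => -2 * r) (-2) r := by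
    simpa using (hasDerivAt_id r).const_mul (-2)
  exact hasDerivAt_coreFun1 μ (ζ' := fun r => -2 * r) (ξ' := fun r => -2 * r)
    (hasDerivAt_sub_sq a r) (hasDerivAt_sub_sq b r) h3 h3 h

/-- The Riemann function is even in `r`. This removes the boundary term at `r = 0` in the
integration by parts. -/
theorem coreFun1_zero (μ : ℂ) (a b : ℝ) : coreFun1 μ a b (-2 * 0) (-2 * 0) = 0 := by
  simp [coreFun1]

/-! ### Smooth dependence of the Riemann function on its arguments. -/

section Smooth

variable {E' : Type*} [NormedAddCommGroup E'] [NormedSpace ℝ E'] {s : Set E'} {ζ ξ ζ' ξ' : E' → ℝ}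

theorem contDiffOn_hyp_div {H : ℂ → ℂ} (hH : ContDiffOn ℝ ∞ H (Metric.ball 0 1))
    (hζ : ContDiffOn ℝ ∞ ζ s) (hξ : ContDiffOn ℝ ∞ ξ s) (h : ∀ p ∈ s, |ξ p| < ζ p) :
    ContDiffOn ℝ ∞ (fun p => H ((ξ p / ζ p : ℝ) : ℂ)) s := by
  have hpos : ∀ p ∈ s, ζ p ≠ 0 := fun p hp => ((abs_nonneg _).trans_lt (h p hp)).ne'
  exact hH.comp (f := fun p => ((ξ p / ζ p : ℝ) : ℂ))
    (Complex.ofRealCLM.contDiff.comp_contDiffOn (hξ.div hζ hpos)) fun p hp => by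
      simpa using norm_ofReal_div_lt_one (h p hp)

theorem contDiffOn_coreFun (μ : ℂ) (hζ : ContDiffOn ℝ ∞ ζ s) (hξ : ContDiffOn ℝ ∞ ξ s)
    (h : ∀ p ∈ s, |ξ p| < ζ p) : ContDiffOn ℝ ∞ (fun p => coreFun μ (ζ p) (ξ p)) s :=
  (contDiffOn_ofReal_cpow hζ (fun p hp => (abs_nonneg _).trans_lt (h p hp)) _).mul
    (contDiffOn_hyp_div (contDiffOn_hypF μ) hζ hξ h)

theorem contDiffOn_coreFun1 (μ : ℂ) (hζ : ContDiffOn ℝ ∞ ζ s) (hξ : ContDiffOn ℝ ∞ ξ s)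
    (hζ' : ContDiffOn ℝ ∞ ζ' s) (hξ' : ContDiffOn ℝ ∞ ξ' s)
    (h : ∀ p ∈ s, |ξ p| < ζ p) :
    ContDiffOn ℝ ∞ (fun p => coreFun1 μ (ζ p) (ξ p) (ζ' p) (ξ' p)) s := by
  have hpos : ∀ p ∈ s, ζ p ≠ 0 := fun p hp => ((abs_nonneg _).trans_lt (h p hp)).ne'
  have hp : ContDiffOn ℝ ∞ (fun p => ((ζ' p / ζ p : ℝ) : ℂ)) s :=
    Complex.ofRealCLM.contDiff.comp_contDiffOn (hζ'.div hζ hpos)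
  have hq : ContDiffOn ℝ ∞ (fun p => (((ξ' p - ξ p / ζ p * ζ' p) / ζ p : ℝ) : ℂ)) s :=
    Complex.ofRealCLM.contDiff.comp_contDiffOn ((hξ'.sub ((hξ.div hζ hpos).mul hζ')).div hζ hpos)
  have := (contDiffOn_ofReal_cpow hζ (fun p hp => (abs_nonneg _).trans_lt (h p hp)) (-μ)).mul
    (((contDiffOn_const (c := -μ).mul hp).mul
      (contDiffOn_hyp_div (contDiffOn_hypF μ) hζ hξ h)).add (hq.mul
      (contDiffOn_hyp_div (contDiffOn_deriv_hypF μ) hζ hξ h)))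
  refine this.congr fun p _ => ?_
  simp [coreFun1]

end Smooth

end Kernel

/-! ### The Cauchy problem for the Euler–Poisson–Darboux equation -/

section EPD

theorem hasDerivAt_leibniz {Ω : Set (ℝ × ℝ)} (hΩ : IsOpen Ω) {h h' : ℝ → ℝ → ℂ}
    (hh : ContDiffOn ℝ ∞ (fun q : ℝ × ℝ => h q.1 q.2) Ω) (a : ℝ) {β : ℝ → ℝ} {β' t : ℝ}
    (hβ : HasDerivAt β β' t) (ht : ∀ r ∈ Set.uIcc a (β t), (t, r) ∈ Ω)
    (hd : ∀ r ∈ Set.uIcc a (β t), HasDerivAt (fun t => h t r) (h' t r) t) :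
    HasDerivAt (fun t => ∫ r in a..β t, h t r) (β' • h t (β t) + ∫ r in a..β t, h' t r) t := by
  have h1 := hasDerivAt_intervalIntegral_leibniz hΩ (hh.of_le (by simp)) a hβ ht
  refine h1.congr_deriv ?_
  congr 1
  refine intervalIntegral.integral_congr fun r hr => ?_
  have h2 := (hh.differentiableAt_of_isOpen (by simp) hΩ (ht r hr)).hasFDerivAt.comp t
    (hasFDerivAt_prodMk_left (𝕜 := ℝ) t r)
  simpa using h2.hasDerivAt.unique (hd r hr)

/-- `ζ - ξ = 4ττ₀` and `ζ + ξ = 2(τ² + τ₀² - r²)` are both positive. Hence the base `ζ` of the power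
is positive and `ξ/ζ` lies in the unit disc. -/
theorem abs_lt_of_mem_cone {r τ τ₀ : ℝ} (h0 : 0 < τ * τ₀) (h : r ^ 2 < τ ^ 2 + τ₀ ^ 2) :
    |(τ - τ₀) ^ 2 - r ^ 2| < (τ + τ₀) ^ 2 - r ^ 2 := by
  rw [abs_lt]
  constructor <;> nlinarith

/-- `(τ - τ₀)² = τ² + τ₀² - 2ττ₀`. The path of integration stays in the domain of smoothness also
for `τ < τ₀` and for negative `τ`, `τ₀`; the latter is the case `ℓ > 1`. -/
theorem sq_lt_of_mem_uIcc {r τ τ₀ : ℝ} (h0 : 0 < τ * τ₀) (hr : r ∈ Set.uIcc 0 (τ - τ₀)) :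
    r ^ 2 < τ ^ 2 + τ₀ ^ 2 := by
  have h1 : |r| ≤ |τ - τ₀| := by
    have := Set.abs_sub_left_of_mem_uIcc hr
    simpa using this
  have h2 := sq_le_sq.2 h1
  nlinarith

/-- The set of `(τ, r)` on which the Riemann function with pole at `τ₀` is smooth. -/
def epdDomain (τ₀ : ℝ) : Set (ℝ × ℝ) := {q | 0 < q.1 * τ₀ ∧ q.2 ^ 2 < q.1 ^ 2 + τ₀ ^ 2}

theorem isOpen_epdDomain (τ₀ : ℝ) : IsOpen (epdDomain τ₀) :=
  (isOpen_lt (f := fun _ => (0 : ℝ)) (g := fun q : ℝ × ℝ => q.1 * τ₀) (by fun_prop)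
    (by fun_prop)).inter (isOpen_lt (f := fun q : ℝ × ℝ => q.2 ^ 2)
    (g := fun q : ℝ × ℝ => q.1 ^ 2 + τ₀ ^ 2) (by fun_prop) (by fun_prop))

/-- The Riemann function. -/
def epdCore (μ : ℂ) (τ₀ τ r : ℝ) : ℂ := coreFun μ ((τ + τ₀) ^ 2 - r ^ 2) ((τ - τ₀) ^ 2 - r ^ 2)

/-- The derivative in `τ` of the Riemann function. -/
def epdCoreTau (μ : ℂ) (τ₀ τ r : ℝ) : ℂ :=
  coreFun1 μ ((τ + τ₀) ^ 2 - r ^ 2) ((τ - τ₀) ^ 2 - r ^ 2) (2 * (τ + τ₀)) (2 * (τ - τ₀))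

/-- The solution with data `0`, `v`, up to a constant factor. -/
def epdInt (μ : ℂ) (τ₀ : ℝ) (v : ℝ → ℂ) (τ : ℝ) : ℂ :=
  ∫ r in (0 : ℝ)..(τ - τ₀), epdCore μ τ₀ τ r * v r

/-- The derivative of `epdInt`. -/
def epdInt1 (μ : ℂ) (τ₀ : ℝ) (v : ℝ → ℂ) (τ : ℝ) : ℂ :=
  ((4 * τ * τ₀ : ℝ) : ℂ) ^ (-μ) * v (τ - τ₀) +
    ∫ r in (0 : ℝ)..(τ - τ₀), epdCoreTau μ τ₀ τ r * v r

/-- On the characteristic `r = τ - τ₀` the hypergeometric argument vanishes and `ζ = 4ττ₀`. -/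
theorem epdCore_top (μ : ℂ) (τ₀ τ : ℝ) :
    epdCore μ τ₀ τ (τ - τ₀) = ((4 * τ * τ₀ : ℝ) : ℂ) ^ (-μ) := by
  simp only [epdCore, coreFun, sub_self, zero_div, ofReal_zero, hypF, ordinaryHypergeometric_zero,
    mul_one]
  congr 2
  ring

theorem contDiffOn_epdCore (μ : ℂ) (τ₀ : ℝ) :
    ContDiffOn ℝ ∞ (fun q : ℝ × ℝ => epdCore μ τ₀ q.1 q.2) (epdDomain τ₀) := by
  have h1 : ContDiff ℝ ∞ fun q : ℝ × ℝ => (q.1 + τ₀) ^ 2 - q.2 ^ 2 := by fun_prop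
  have h2 : ContDiff ℝ ∞ fun q : ℝ × ℝ => (q.1 - τ₀) ^ 2 - q.2 ^ 2 := by fun_prop
  exact contDiffOn_coreFun μ h1.contDiffOn h2.contDiffOn fun q hq => abs_lt_of_mem_cone hq.1 hq.2

theorem contDiffOn_epdCoreTau (μ : ℂ) (τ₀ : ℝ) :
    ContDiffOn ℝ ∞ (fun q : ℝ × ℝ => epdCoreTau μ τ₀ q.1 q.2) (epdDomain τ₀) := by
  have h1 : ContDiff ℝ ∞ fun q : ℝ × ℝ => (q.1 + τ₀) ^ 2 - q.2 ^ 2 := by fun_prop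
  have h2 : ContDiff ℝ ∞ fun q : ℝ × ℝ => (q.1 - τ₀) ^ 2 - q.2 ^ 2 := by fun_prop
  have h3 : ContDiff ℝ ∞ fun q : ℝ × ℝ => 2 * (q.1 + τ₀) := by fun_prop
  have h4 : ContDiff ℝ ∞ fun q : ℝ × ℝ => 2 * (q.1 - τ₀) := by fun_prop
  exact contDiffOn_coreFun1 μ h1.contDiffOn h2.contDiffOn h3.contDiffOn h4.contDiffOn
    fun q hq => abs_lt_of_mem_cone hq.1 hq.2

theorem epdInt_self (μ : ℂ) (τ₀ : ℝ) (v : ℝ → ℂ) : epdInt μ τ₀ v τ₀ = 0 := by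
  simp [epdInt]

theorem epdInt1_self (μ : ℂ) (τ₀ : ℝ) (v : ℝ → ℂ) :
    epdInt1 μ τ₀ v τ₀ = ((4 * τ₀ * τ₀ : ℝ) : ℂ) ^ (-μ) * v 0 := by
  simp [epdInt1]

variable {v v₁ v₂ : ℝ → ℂ} {τ₀ τ : ℝ}

theorem hasDerivAt_epdInt (μ : ℂ) (hv : ContDiff ℝ ∞ v) (h0 : 0 < τ * τ₀) :
    HasDerivAt (epdInt μ τ₀ v) (epdInt1 μ τ₀ v τ) τ := by
  have hΩ : ∀ r ∈ Set.uIcc 0 (τ - τ₀), (τ, r) ∈ epdDomain τ₀ := fun r hr =>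
    ⟨h0, sq_lt_of_mem_uIcc h0 hr⟩
  have h1 : ContDiffOn ℝ ∞ (fun q : ℝ × ℝ => v q.2) (epdDomain τ₀) :=
    (hv.comp contDiff_snd).contDiffOn
  have h := hasDerivAt_leibniz (isOpen_epdDomain τ₀) (h := fun τ r => epdCore μ τ₀ τ r * v r)
    (h' := fun τ r => epdCoreTau μ τ₀ τ r * v r) ((contDiffOn_epdCore μ τ₀).mul h1) 0
    ((hasDerivAt_id τ).sub_const τ₀) hΩ fun r hr =>
      (hasDerivAt_coreFun_tau μ (abs_lt_of_mem_cone (hΩ r hr).1 (hΩ r hr).2)).mul_const _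
  refine h.congr_deriv ?_
  simp only [id, epdCore_top, one_smul]
  rfl

/-- Green's identity in `r`: the integrand is the derivative of `core · v' - core_r · v`, and both
terms vanish at `r = 0`, since `v'(0) = 0` and `core` is even in `r`. -/
theorem epdInt_by_parts (μ : ℂ) (h1 : ∀ r, HasDerivAt v (v₁ r) r)
    (h2 : ∀ r, HasDerivAt v₁ (v₂ r) r) (hc : Continuous v₂) (hz : v₁ 0 = 0) (h0 : 0 < τ * τ₀) :
    ∫ r in (0 : ℝ)..(τ - τ₀), (epdCore μ τ₀ τ r * v₂ r -
      coreFun2 μ ((τ + τ₀) ^ 2 - r ^ 2) ((τ - τ₀) ^ 2 - r ^ 2) (-2 * r) (-2 * r) (-2) * v r) =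
    epdCore μ τ₀ τ (τ - τ₀) * v₁ (τ - τ₀) -
      coreFun1 μ ((τ + τ₀) ^ 2 - (τ - τ₀) ^ 2) ((τ - τ₀) ^ 2 - (τ - τ₀) ^ 2)
        (-2 * (τ - τ₀)) (-2 * (τ - τ₀)) * v (τ - τ₀) := by
  have hcone : ∀ r ∈ Set.uIcc 0 (τ - τ₀), |(τ - τ₀) ^ 2 - r ^ 2| < (τ + τ₀) ^ 2 - r ^ 2 :=
    fun r hr => abs_lt_of_mem_cone h0 (sq_lt_of_mem_uIcc h0 hr)
  have hcv : Continuous v := continuous_iff_continuousAt.2 fun r => (h1 r).continuousAt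
  have hslice : ∀ {k : ℝ × ℝ → ℂ}, ContDiffOn ℝ ∞ k (epdDomain τ₀) →
      ContinuousOn (fun r => k (τ, r)) (Set.uIcc 0 (τ - τ₀)) := fun hk =>
    continuousOn_slice hk.continuousOn fun r hr => ⟨h0, sq_lt_of_mem_uIcc h0 hr⟩
  have hcore2 : ContinuousOn (fun r => coreFun2 μ ((τ + τ₀) ^ 2 - r ^ 2) ((τ - τ₀) ^ 2 - r ^ 2)
      (-2 * r) (-2 * r) (-2)) (Set.uIcc 0 (τ - τ₀)) := by
    have hO : IsOpen {r : ℝ | r ^ 2 < τ ^ 2 + τ₀ ^ 2} := isOpen_lt (by fun_prop) (by fun_prop)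
    have hk : ContDiffOn ℝ ∞ (fun r => coreFun1 μ ((τ + τ₀) ^ 2 - r ^ 2) ((τ - τ₀) ^ 2 - r ^ 2)
        (-2 * r) (-2 * r)) {r : ℝ | r ^ 2 < τ ^ 2 + τ₀ ^ 2} :=
      contDiffOn_coreFun1 μ (by fun_prop) (by fun_prop) (by fun_prop) (by fun_prop)
        fun r hr => abs_lt_of_mem_cone h0 hr
    have hk' := hk.continuousOn_deriv_of_isOpen hO (by simp)
    refine (hk'.mono fun r hr => sq_lt_of_mem_uIcc h0 hr).congr fun r hr => ?_
    exact (hasDerivAt_coreFun1_r μ (hcone r hr)).deriv.symm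
  have h := intervalIntegral.integral_eq_sub_of_hasDerivAt (a := 0) (b := τ - τ₀)
    (f := fun r => epdCore μ τ₀ τ r * v₁ r -
      coreFun1 μ ((τ + τ₀) ^ 2 - r ^ 2) ((τ - τ₀) ^ 2 - r ^ 2) (-2 * r) (-2 * r) * v r)
    (f' := fun r => epdCore μ τ₀ τ r * v₂ r -
      coreFun2 μ ((τ + τ₀) ^ 2 - r ^ 2) ((τ - τ₀) ^ 2 - r ^ 2) (-2 * r) (-2 * r) (-2) * v r)
    (fun r hr => by
      have e1 := (hasDerivAt_coreFun_r μ (hcone r hr)).mul (h2 r)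
      have e2 := (hasDerivAt_coreFun1_r μ (hcone r hr)).mul (h1 r)
      refine (e1.sub e2).congr_deriv ?_
      simp only [epdCore]
      ring)
    (((hslice (contDiffOn_epdCore μ τ₀)).mul hc.continuousOn).sub
      (hcore2.mul hcv.continuousOn)).intervalIntegrable
  rw [h, hz, coreFun1_zero]
  ring

/-- Put `B = (4ττ₀)^{-μ}`. After integration by parts the terms at the end point are `B' v + B v' +
core_τ v - (B v' - core_r v)`. On the characteristic `core_τ + core_r = B'`, and `B' = -μ τ⁻¹ B`, so
they add up to `-2μ τ⁻¹ B v`, which is the end-point part of `-2μ τ⁻¹ u_τ`. -/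
theorem hasDerivAt_epdInt1 (μ : ℂ) (hv : ContDiff ℝ ∞ v) (h1 : ∀ r, HasDerivAt v (v₁ r) r)
    (h2 : ∀ r, HasDerivAt v₁ (v₂ r) r) (hc : Continuous v₂) (hz : v₁ 0 = 0) (h0 : 0 < τ * τ₀) :
    HasDerivAt (epdInt1 μ τ₀ v) (epdInt μ τ₀ v₂ τ - 2 * μ / τ * epdInt1 μ τ₀ v τ) τ := by
  have hΩ : ∀ r ∈ Set.uIcc 0 (τ - τ₀), (τ, r) ∈ epdDomain τ₀ := fun r hr =>
    ⟨h0, sq_lt_of_mem_uIcc h0 hr⟩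
  have hcone : ∀ r ∈ Set.uIcc 0 (τ - τ₀), |(τ - τ₀) ^ 2 - r ^ 2| < (τ + τ₀) ^ 2 - r ^ 2 :=
    fun r hr => abs_lt_of_mem_cone h0 (sq_lt_of_mem_uIcc h0 hr)
  have hτ : τ ≠ 0 := fun h => by simp [h] at h0
  have hτ₀ : τ₀ ≠ 0 := fun h => by simp [h] at h0
  have hτC : (τ : ℂ) ≠ 0 := by exact_mod_cast hτ
  have hτ₀C : (τ₀ : ℂ) ≠ 0 := by exact_mod_cast hτ₀
  have hv' : ContDiffOn ℝ ∞ (fun q : ℝ × ℝ => v q.2) (epdDomain τ₀) :=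
    (hv.comp contDiff_snd).contDiffOn
  have hI := hasDerivAt_leibniz (isOpen_epdDomain τ₀) (h := fun τ r => epdCoreTau μ τ₀ τ r * v r)
    (h' := fun τ r => coreFun2 μ ((τ + τ₀) ^ 2 - r ^ 2) ((τ - τ₀) ^ 2 - r ^ 2)
        (2 * (τ + τ₀)) (2 * (τ - τ₀)) 2 * v r) ((contDiffOn_epdCoreTau μ τ₀).mul hv') 0
    ((hasDerivAt_id τ).sub_const τ₀) hΩ fun r hr =>
      (hasDerivAt_coreFun1_tau μ (hcone r hr)).mul_const _
  have hbd := hasDerivAt_ofReal_cpow (f := fun τ => 4 * τ * τ₀) (f' := 4 * τ₀) (s := τ)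
    (by simpa using ((hasDerivAt_id τ).const_mul 4).mul_const τ₀) (by nlinarith) (-μ)
  have hvt : HasDerivAt (fun τ => v (τ - τ₀)) (v₁ (τ - τ₀)) τ := by
    exact (h1 (τ - τ₀)).comp_sub_const τ τ₀
  refine ((hbd.mul hvt).add hI).congr_deriv ?_
  have hparts := epdInt_by_parts μ h1 h2 hc hz h0
  have hslice : ∀ {k : ℝ × ℝ → ℂ}, ContDiffOn ℝ ∞ k (epdDomain τ₀) →
      ContinuousOn (fun r => k (τ, r)) (Set.uIcc 0 (τ - τ₀)) := fun hk =>
    continuousOn_slice hk.continuousOn hΩ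
  have hcv : Continuous v := hv.continuous
  have i1 : IntervalIntegrable (fun r => epdCore μ τ₀ τ r * v₂ r) volume 0 (τ - τ₀) :=
    ((hslice (contDiffOn_epdCore μ τ₀)).mul hc.continuousOn).intervalIntegrable
  have i2 : IntervalIntegrable (fun r => epdCoreTau μ τ₀ τ r * v r) volume 0 (τ - τ₀) :=
    ((hslice (contDiffOn_epdCoreTau μ τ₀)).mul hcv.continuousOn).intervalIntegrable
  -- The equation for the Riemann function trades `core_ττ` for `core_rr - 2μ τ⁻¹ core_τ`.
  have hsplit : ∫ r in (0 : ℝ)..(τ - τ₀), coreFun2 μ ((τ + τ₀) ^ 2 - r ^ 2) ((τ - τ₀) ^ 2 - r ^ 2)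
      (2 * (τ + τ₀)) (2 * (τ - τ₀)) 2 * v r = epdInt μ τ₀ v₂ τ -
      (∫ r in (0 : ℝ)..(τ - τ₀), (epdCore μ τ₀ τ r * v₂ r -
      coreFun2 μ ((τ + τ₀) ^ 2 - r ^ 2) ((τ - τ₀) ^ 2 - r ^ 2) (-2 * r) (-2 * r) (-2) * v r)) -
      2 * μ / τ * ∫ r in (0 : ℝ)..(τ - τ₀), epdCoreTau μ τ₀ τ r * v r := by
    have hcong : ∀ r ∈ Set.uIcc 0 (τ - τ₀), epdCore μ τ₀ τ r * v₂ r -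
        coreFun2 μ ((τ + τ₀) ^ 2 - r ^ 2) ((τ - τ₀) ^ 2 - r ^ 2) (-2 * r) (-2 * r) (-2) * v r =
        epdCore μ τ₀ τ r * v₂ r - (coreFun2 μ ((τ + τ₀) ^ 2 - r ^ 2) ((τ - τ₀) ^ 2 - r ^ 2)
          (2 * (τ + τ₀)) (2 * (τ - τ₀)) 2 * v r + 2 * μ / τ * (epdCoreTau μ τ₀ τ r * v r)) := by
      intro r hr
      rw [← coreFun_epd μ hτ (hcone r hr), epdCoreTau]
      ring
    have i3 : IntervalIntegrable (fun r => coreFun2 μ ((τ + τ₀) ^ 2 - r ^ 2)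
        ((τ - τ₀) ^ 2 - r ^ 2) (2 * (τ + τ₀)) (2 * (τ - τ₀)) 2 * v r) volume 0 (τ - τ₀) := by
      have hD := (contDiffOn_epdCoreTau μ τ₀).continuousOn_fderiv_of_isOpen
        (isOpen_epdDomain τ₀) (by simp)
      have hD' := (continuousOn_slice hD hΩ).clm_apply (continuousOn_const (c := ((1 : ℝ), (0 : ℝ))))
      refine ContinuousOn.intervalIntegrable (ContinuousOn.mul (hD'.congr fun r hr => ?_)
        hcv.continuousOn)
      have e1 := ((contDiffOn_epdCoreTau μ τ₀).differentiableAt_of_isOpen (by simp)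
        (isOpen_epdDomain τ₀) (hΩ r hr)).hasFDerivAt.comp τ
        (hasFDerivAt_prodMk_left (𝕜 := ℝ) τ r)
      simpa using (hasDerivAt_coreFun1_tau μ (hcone r hr)).unique e1.hasDerivAt
    rw [intervalIntegral.integral_congr hcong, intervalIntegral.integral_sub i1 (i3.add
      (i2.const_mul _)), intervalIntegral.integral_add i3 (i2.const_mul _),
      intervalIntegral.integral_const_mul, epdInt]
    ring
  simp only [id]
  rw [hsplit, hparts, epdCore_top, epdInt1, epdCoreTau]
  simp only [one_smul, coreFun1, sub_self, zero_div, ofReal_zero, hypF,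
    ordinaryHypergeometric_zero]
  have e4 : (τ + τ₀) ^ 2 - (τ - τ₀) ^ 2 = 4 * τ * τ₀ := by ring
  rw [e4]
  push_cast
  field_simp
  ring

end EPD

/-! ### The Cauchy problem for the generalized wave equation -/

section Evolution

theorem hasDerivAt_phi {ℓ : ℝ} (hℓ : ℓ ≠ 1) {t : ℝ} (ht : 0 < t) :
    HasDerivAt (phi ℓ) (t ^ (-ℓ)) t := by
  have h1 : 1 - ℓ ≠ 0 := sub_ne_zero.2 hℓ.symm
  have h := (Real.hasDerivAt_rpow_const (x := t) (p := 1 - ℓ) (Or.inl ht.ne')).div_const (1 - ℓ)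
  refine h.congr_deriv ?_
  rw [mul_div_cancel_left₀ _ h1]
  congr 1
  ring

theorem contDiffOn_phi (ℓ : ℝ) : ContDiffOn ℝ ∞ (phi ℓ) (Set.Ioi 0) :=
  (contDiffOn_id.rpow_const_of_ne fun _ hx => (ne_of_gt hx)).div_const _

theorem one_sub_mul_phi {ℓ : ℝ} (hℓ : ℓ ≠ 1) (t : ℝ) : (1 - ℓ) * phi ℓ t = t ^ (1 - ℓ) :=
  mul_div_cancel₀ _ (sub_ne_zero.2 hℓ.symm)

theorem phi_ne_zero {ℓ : ℝ} (hℓ : ℓ ≠ 1) {t : ℝ} (ht : 0 < t) : phi ℓ t ≠ 0 :=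
  div_ne_zero (Real.rpow_pos_of_pos ht _).ne' (sub_ne_zero.2 hℓ.symm)

theorem phi_mul_phi_pos {ℓ : ℝ} (hℓ : ℓ ≠ 1) {t b : ℝ} (ht : 0 < t) (hb : 0 < b) :
    0 < phi ℓ t * phi ℓ b := by
  unfold phi
  have h1 := Real.rpow_pos_of_pos ht (1 - ℓ)
  have h2 := Real.rpow_pos_of_pos hb (1 - ℓ)
  rw [div_mul_div_comm]
  exact div_pos (mul_pos h1 h2) (mul_self_pos.2 (sub_ne_zero.2 hℓ.symm))

theorem abs_phi (ℓ : ℝ) {t : ℝ} (ht : 0 < t) : |phi ℓ t| = t ^ (1 - ℓ) / |1 - ℓ| := by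
  rw [phi, abs_div, abs_of_pos (Real.rpow_pos_of_pos ht _)]

/-- The exponent `i m / (1 - ℓ)`. -/
def epdExp (ℓ : ℝ) (m : ℂ) : ℂ := I * m / ((1 - ℓ : ℝ) : ℂ)

/-- The constant which normalizes the Riemann function with pole at `b`. -/
def evolConst (ℓ : ℝ) (m : ℂ) (b : ℝ) : ℂ :=
  ((b ^ ℓ : ℝ) : ℂ) * ((2 * |phi ℓ b| : ℝ) : ℂ) ^ (2 * epdExp ℓ m)

/-- The solution of `u_tt + (ℓ + 2im) t⁻¹ u_t - t^{-2ℓ} Δu = 0`, `u = 0` and `u_t = f(·, b)` at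
`t = b`. -/
def evol (ℓ : ℝ) (m : ℂ) (f : E3 → ℝ → ℂ) (x : E3) (t b : ℝ) : ℂ :=
  evolConst ℓ m b * epdInt (epdExp ℓ m) (phi ℓ b) (fun r => waveConv r (fun y => f y b) x) (phi ℓ t)

/-- The derivative in `t` of `evol`. -/
def evolT (ℓ : ℝ) (m : ℂ) (f : E3 → ℝ → ℂ) (x : E3) (t b : ℝ) : ℂ :=
  evolConst ℓ m b * ((t ^ (-ℓ) : ℝ) : ℂ) *
    epdInt1 (epdExp ℓ m) (phi ℓ b) (fun r => waveConv r (fun y => f y b) x) (phi ℓ t)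

theorem evol_self (ℓ : ℝ) (m : ℂ) (f : E3 → ℝ → ℂ) (x : E3) (b : ℝ) : evol ℓ m f x b b = 0 := by
  simp [evol, epdInt_self]

/-- The unnormalized velocity at the pole is `φ'(b) = b^{-ℓ}` times `(4 φ(b)²)^{-μ}`, and
`evolConst` is its inverse. The base is `2|φ(b)|` because `φ(b) < 0` for `ℓ > 1`. -/
theorem evolConst_mul {ℓ : ℝ} (hℓ : ℓ ≠ 1) (m : ℂ) {b : ℝ} (hb : 0 < b) :
    evolConst ℓ m b * ((b ^ (-ℓ) : ℝ) : ℂ) *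
      ((4 * phi ℓ b * phi ℓ b : ℝ) : ℂ) ^ (-epdExp ℓ m) = 1 := by
  have hφ := abs_pos.2 (phi_ne_zero hℓ hb)
  have h1 : 4 * phi ℓ b * phi ℓ b = (2 * |phi ℓ b|) ^ 2 := by
    rw [mul_pow, sq_abs]; ring
  rw [evolConst, h1, ofReal_cpow_eq_exp (by positivity), ofReal_cpow_eq_exp (by positivity),
    Real.log_pow, Real.rpow_neg hb.le]
  have h2 : ((b ^ ℓ : ℝ) : ℂ) ≠ 0 := by exact_mod_cast (Real.rpow_pos_of_pos hb ℓ).ne'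
  set L : ℂ := ((Real.log (2 * |phi ℓ b|) : ℝ) : ℂ) with hL
  have h3 : ((((2 : ℕ) : ℝ) * Real.log (2 * |phi ℓ b|) : ℝ) : ℂ) * -epdExp ℓ m =
      -(L * (2 * epdExp ℓ m)) := by
    rw [hL]; push_cast; ring
  rw [h3, Complex.exp_neg]
  push_cast
  field_simp

theorem evolT_self {ℓ : ℝ} (hℓ : ℓ ≠ 1) (m : ℂ) (f : E3 → ℝ → ℂ) (x : E3) {b : ℝ} (hb : 0 < b) :
    evolT ℓ m f x b b = f x b := by
  rw [evolT, epdInt1_self, waveConv_zero, ← mul_assoc, evolConst_mul hℓ m hb, one_mul]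

variable {f : E3 → ℝ → ℂ}

theorem contDiff_slice_left (hf : ContDiff ℝ ∞ fun p : E3 × ℝ => f p.1 p.2) (b : ℝ) :
    ContDiff ℝ ∞ fun y => f y b :=
  hf.comp (f := fun y => (y, b)) (by fun_prop)

theorem contDiff_partialX_slice (hf : ContDiff ℝ ∞ fun p : E3 × ℝ => f p.1 p.2) (k : Fin 3) :
    ContDiff ℝ ∞ fun p : E3 × ℝ => partialX k (fun y => f y p.2) p.1 := by
  have hD : ContDiff ℝ ∞ (fderiv ℝ fun p : E3 × ℝ => f p.1 p.2) := hf.fderiv_right (by simp)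
  have h : (fun p : E3 × ℝ => partialX k (fun y => f y p.2) p.1) = fun p =>
      fderiv ℝ (fun p : E3 × ℝ => f p.1 p.2) p (basisVec k, 0) := by
    funext p
    have := HasFDerivAt.comp (f := fun y => (y, p.2)) p.1
      (hf.differentiable (by simp) (p.1, p.2)).hasFDerivAt (hasFDerivAt_prodMk_left p.1 p.2)
    rw [partialX]
    refine (congrArg (fun L => L (basisVec k)) this.fderiv).trans ?_
    simp
  rw [h]
  fun_prop

theorem contDiff_laplace3_slice (hf : ContDiff ℝ ∞ fun p : E3 × ℝ => f p.1 p.2) :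
    ContDiff ℝ ∞ fun p : E3 × ℝ => laplace3 (fun y => f y p.2) p.1 :=
  ContDiff.sum fun k _ => contDiff_partialX_slice
    (f := fun y b => partialX k (fun y => f y b) y) (contDiff_partialX_slice hf k) k

theorem contDiff_waveConv_r (hf : ContDiff ℝ ∞ fun p : E3 × ℝ => f p.1 p.2) (x : E3) (b : ℝ) :
    ContDiff ℝ ∞ fun r => waveConv r (fun y => f y b) x :=
  (contDiff_waveConv hf).comp (f := fun r => (x, r, b)) (by fun_prop)

theorem hasDerivAt_evol {ℓ : ℝ} (hℓ : ℓ ≠ 1) (m : ℂ)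
    (hf : ContDiff ℝ ∞ fun p : E3 × ℝ => f p.1 p.2) (x : E3) {t b : ℝ} (ht : 0 < t) (hb : 0 < b) :
    HasDerivAt (fun t => evol ℓ m f x t b) (evolT ℓ m f x t b) t := by
  have h := ((hasDerivAt_epdInt (epdExp ℓ m) (contDiff_waveConv_r hf x b)
    (phi_mul_phi_pos hℓ ht hb)).scomp t (hasDerivAt_phi hℓ ht)).const_mul (evolConst ℓ m b)
  refine h.congr_deriv ?_
  rw [evolT, real_smul]
  ring

/-- Substitution `τ = φ(t)`: the square of `φ' = t^{-ℓ}` multiplies the Laplacian, the derivative of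
`t^{-ℓ}` gives `-ℓ t⁻¹ u_t`, and `2μ φ(t)⁻¹ t^{-ℓ} = 2im t⁻¹` because `(1 - ℓ) φ(t) = t^{1-ℓ}`. -/
theorem hasDerivAt_evolT {ℓ : ℝ} (hℓ : ℓ ≠ 1) (m : ℂ)
    (hf : ContDiff ℝ ∞ fun p : E3 × ℝ => f p.1 p.2) (x : E3) {t b : ℝ} (ht : 0 < t) (hb : 0 < b) :
    HasDerivAt (fun t => evolT ℓ m f x t b)
      (((t ^ (-ℓ) : ℝ) : ℂ) ^ 2 * evol ℓ m (fun y b => laplace3 (fun y => f y b) y) x t b -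
        (ℓ + 2 * I * m) / t * evolT ℓ m f x t b) t := by
  have hs := contDiff_slice_left hf b
  have h := (hasDerivAt_epdInt1 (epdExp ℓ m) (contDiff_waveConv_r hf x b)
    (hasDerivAt_waveConv hs x) (hasDerivAt_waveConvVel hs x)
    (contDiff_waveConv_r (f := fun y b => laplace3 (fun y => f y b) y)
      (contDiff_laplace3_slice hf) x b).continuous (waveConvVel_zero _ x)
    (phi_mul_phi_pos hℓ ht hb)).scomp t (hasDerivAt_phi hℓ ht)
  have h2 := (((Real.hasDerivAt_rpow_const (x := t) (p := -ℓ) (Or.inl ht.ne')).ofReal_comp).const_mul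
    (evolConst ℓ m b)).mul h
  refine h2.congr_deriv ?_
  have hφ : (phi ℓ t : ℂ) ≠ 0 := by exact_mod_cast phi_ne_zero hℓ ht
  have h1ℓ : ((1 - ℓ : ℝ) : ℂ) ≠ 0 := by exact_mod_cast sub_ne_zero.2 hℓ.symm
  have htC : (t : ℂ) ≠ 0 := by exact_mod_cast ht.ne'
  have e1 : ((t ^ (-ℓ - 1) : ℝ) : ℂ) = ((t ^ (-ℓ) : ℝ) : ℂ) / t := by
    rw [Real.rpow_sub_one ht.ne']; push_cast; rfl
  have e2 : ((1 - ℓ : ℝ) : ℂ) * phi ℓ t = t * ((t ^ (-ℓ) : ℝ) : ℂ) := by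
    rw [← ofReal_mul, one_sub_mul_phi hℓ, ← ofReal_mul, sub_eq_add_neg, Real.rpow_add ht,
      Real.rpow_one]
  have e3 : 2 * epdExp ℓ m / (phi ℓ t : ℂ) * ((t ^ (-ℓ) : ℝ) : ℂ) = 2 * I * m / t := by
    rw [epdExp]
    rw [div_mul_eq_mul_div, div_eq_div_iff hφ htC]
    field_simp
    linear_combination -m * e2
  simp only [Function.comp_apply, real_smul]
  push_cast
  rw [e1, evolT, evol]
  linear_combination (-(evolConst ℓ m b * ((t ^ (-ℓ) : ℝ) : ℂ) * epdInt1 (epdExp ℓ m) (phi ℓ b)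
    (fun r => waveConv r (fun y => f y b) x) (phi ℓ t))) * e3

theorem contDiffOn_evolConst {ℓ : ℝ} (hℓ : ℓ ≠ 1) (m : ℂ) :
    ContDiffOn ℝ ∞ (evolConst ℓ m) (Set.Ioi 0) := by
  have h1 : ContDiffOn ℝ ∞ (fun b : ℝ => ((b ^ ℓ : ℝ) : ℂ)) (Set.Ioi 0) :=
    Complex.ofRealCLM.contDiff.comp_contDiffOn
      (contDiffOn_id.rpow_const_of_ne fun _ hx => (ne_of_gt hx))
  have h2 : ContDiffOn ℝ ∞ (fun b : ℝ => 2 * |phi ℓ b|) (Set.Ioi 0) := by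
    have : ContDiffOn ℝ ∞ (fun b : ℝ => 2 * (b ^ (1 - ℓ) / |1 - ℓ|)) (Set.Ioi 0) :=
      contDiffOn_const.mul
        ((contDiffOn_id.rpow_const_of_ne fun _ hx => (ne_of_gt hx)).div_const _)
    exact this.congr fun b hb => by rw [abs_phi ℓ hb]
  exact h1.mul (contDiffOn_ofReal_cpow h2 (fun b hb => by
    have := abs_pos.2 (phi_ne_zero hℓ hb)
    positivity) _)

/-- The set of `(x, t, b)` with positive times. -/
def posTimes : Set (E3 × ℝ × ℝ) := {p | 0 < p.2.1 ∧ 0 < p.2.2}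

theorem isOpen_posTimes : IsOpen posTimes :=
  (isOpen_lt (f := fun _ => (0 : ℝ)) (g := fun p : E3 × ℝ × ℝ => p.2.1) (by fun_prop)
    (by fun_prop)).inter (isOpen_lt (f := fun _ => (0 : ℝ)) (g := fun p : E3 × ℝ × ℝ => p.2.2)
    (by fun_prop) (by fun_prop))

/-- The set of `(x, t, b, r)` on which the integrand of `evol` is smooth. -/
def evolDomain (ℓ : ℝ) : Set ((E3 × ℝ × ℝ) × ℝ) :=
  {q | q.1 ∈ posTimes ∧ q.2 ^ 2 < phi ℓ q.1.2.1 ^ 2 + phi ℓ q.1.2.2 ^ 2}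

theorem contDiffOn_phi_fst {E' : Type*} [NormedAddCommGroup E'] [NormedSpace ℝ E'] (ℓ : ℝ)
    {c : E' → ℝ} {s : Set E'} (hc : ContDiffOn ℝ ∞ c s) (hs : ∀ p ∈ s, 0 < c p) :
    ContDiffOn ℝ ∞ (fun p => phi ℓ (c p)) s :=
  (contDiffOn_phi ℓ).comp hc hs

theorem isOpen_evolDomain (ℓ : ℝ) : IsOpen (evolDomain ℓ) := by
  have h1 : ContDiffOn ℝ ∞ (fun q : (E3 × ℝ × ℝ) × ℝ => phi ℓ q.1.2.1) (posTimes ×ˢ Set.univ) :=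
    contDiffOn_phi_fst ℓ (by fun_prop) fun q hq => hq.1.1
  have h2 : ContDiffOn ℝ ∞ (fun q : (E3 × ℝ × ℝ) × ℝ => phi ℓ q.1.2.2) (posTimes ×ˢ Set.univ) :=
    contDiffOn_phi_fst ℓ (by fun_prop) fun q hq => hq.1.2
  have h3 : ContinuousOn (fun q : (E3 × ℝ × ℝ) × ℝ => phi ℓ q.1.2.1 ^ 2 + phi ℓ q.1.2.2 ^ 2 -
      q.2 ^ 2) (posTimes ×ˢ Set.univ) :=
    ((h1.continuousOn.pow 2).add (h2.continuousOn.pow 2)).sub (by fun_prop)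
  convert! h3.isOpen_inter_preimage (isOpen_posTimes.prod isOpen_univ) (isOpen_Ioi (a := (0 : ℝ))) using 1
  ext q
  simp [evolDomain]

theorem contDiffOn_evol_integrand {ℓ : ℝ} (hℓ : ℓ ≠ 1) (m : ℂ)
    (hf : ContDiff ℝ ∞ fun p : E3 × ℝ => f p.1 p.2) :
    ContDiffOn ℝ ∞ (fun q : (E3 × ℝ × ℝ) × ℝ => epdCore (epdExp ℓ m) (phi ℓ q.1.2.2)
      (phi ℓ q.1.2.1) q.2 * waveConv q.2 (fun y => f y q.1.2.2) q.1.1) (evolDomain ℓ) := by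
  have h1 : ContDiffOn ℝ ∞ (fun q : (E3 × ℝ × ℝ) × ℝ => phi ℓ q.1.2.1) (evolDomain ℓ) :=
    contDiffOn_phi_fst ℓ (by fun_prop) fun q hq => hq.1.1
  have h2 : ContDiffOn ℝ ∞ (fun q : (E3 × ℝ × ℝ) × ℝ => phi ℓ q.1.2.2) (evolDomain ℓ) :=
    contDiffOn_phi_fst ℓ (by fun_prop) fun q hq => hq.1.2
  refine (contDiffOn_coreFun _ (((h1.add h2).pow 2).sub (by fun_prop))
    (((h1.sub h2).pow 2).sub (by fun_prop)) fun q hq =>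
      abs_lt_of_mem_cone (phi_mul_phi_pos hℓ hq.1.1 hq.1.2) hq.2).mul ?_
  exact ((contDiff_waveConv hf).comp (f := fun q : (E3 × ℝ × ℝ) × ℝ => (q.1.1, q.2, q.1.2.2))
    (by fun_prop)).contDiffOn

theorem mem_evolDomain {ℓ : ℝ} (hℓ : ℓ ≠ 1) {p : E3 × ℝ × ℝ} (hp : p ∈ posTimes) {r : ℝ}
    (hr : r ∈ Set.uIcc 0 (phi ℓ p.2.1 - phi ℓ p.2.2)) : (p, r) ∈ evolDomain ℓ :=
  ⟨hp, sq_lt_of_mem_uIcc (phi_mul_phi_pos hℓ hp.1 hp.2) hr⟩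

theorem contDiffOn_evol {ℓ : ℝ} (hℓ : ℓ ≠ 1) (m : ℂ)
    (hf : ContDiff ℝ ∞ fun p : E3 × ℝ => f p.1 p.2) :
    ContDiffOn ℝ ∞ (fun p : E3 × ℝ × ℝ => evol ℓ m f p.1 p.2.1 p.2.2) posTimes := by
  have h1 : ContDiffOn ℝ ∞ (fun q : E3 × ℝ × ℝ => phi ℓ q.2.1) posTimes :=
    contDiffOn_phi_fst ℓ (by fun_prop) fun q hq => hq.1
  have h2 : ContDiffOn ℝ ∞ (fun q : E3 × ℝ × ℝ => phi ℓ q.2.2) posTimes :=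
    contDiffOn_phi_fst ℓ (by fun_prop) fun q hq => hq.2
  have h3 : ContDiffOn ℝ ∞ (fun q : E3 × ℝ × ℝ => evolConst ℓ m q.2.2) posTimes :=
    (contDiffOn_evolConst hℓ m).comp (f := fun q : E3 × ℝ × ℝ => q.2.2) (by fun_prop)
      fun q hq => hq.2
  exact h3.mul (contDiffOn_intervalIntegral (isOpen_evolDomain ℓ)
    (contDiffOn_evol_integrand hℓ m hf) 0 isOpen_posTimes (h1.sub h2)
    fun p hp r hr => mem_evolDomain hℓ hp hr)

/-- The position enters only through the convolution, so differentiating the solution in space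
amounts to differentiating its data. -/
theorem partialX_evol {ℓ : ℝ} (hℓ : ℓ ≠ 1) (m : ℂ)
    (hf : ContDiff ℝ ∞ fun p : E3 × ℝ => f p.1 p.2) {t b : ℝ} (ht : 0 < t) (hb : 0 < b)
    (k : Fin 3) : partialX k (fun x => evol ℓ m f x t b) =
      fun x => evol ℓ m (fun y b => partialX k (fun y => f y b) y) x t b := by
  funext x
  have hmap : ContDiff ℝ ∞ (fun q : E3 × ℝ => ((q.1, t, b), q.2)) := by fun_prop
  have hO := (isOpen_evolDomain ℓ).preimage hmap.continuous
  have hg := (contDiffOn_evol_integrand hℓ m hf).comp hmap.contDiffOn fun q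
    (hq : q ∈ (fun q : E3 × ℝ => ((q.1, t, b), q.2)) ⁻¹' evolDomain ℓ) => hq
  have hmem : ∀ r ∈ Set.uIcc 0 (phi ℓ t - phi ℓ b),
      (x, r) ∈ (fun q : E3 × ℝ => ((q.1, t, b), q.2)) ⁻¹' evolDomain ℓ := fun r hr =>
    mem_evolDomain hℓ (p := (x, t, b)) ⟨ht, hb⟩ hr
  have hI := hasFDerivAt_intervalIntegral_const hO (hg.of_le (by simp)) 0 (phi ℓ t - phi ℓ b) hmem
  have hI' := fderiv_intervalIntegral_const_apply hO (hg.of_le (by simp)) 0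
    (phi ℓ t - phi ℓ b) hmem (basisVec k)
  have h0 : partialX k (fun x => evol ℓ m f x t b) x = evolConst ℓ m b *
      fderiv ℝ (fun x => epdInt (epdExp ℓ m) (phi ℓ b) (fun r => waveConv r (fun y => f y b) x)
        (phi ℓ t)) x (basisVec k) := by
    have hd : DifferentiableAt ℝ (fun x => epdInt (epdExp ℓ m) (phi ℓ b)
        (fun r => waveConv r (fun y => f y b) x) (phi ℓ t)) x := hI.differentiableAt
    simp only [partialX, evol]
    rw [fderiv_const_mul hd]
    rfl
  rw [h0, evol]
  congr 1
  refine hI'.trans (intervalIntegral.integral_congr fun r hr => ?_)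
  have hs := contDiff_slice_left hf b
  have hw : ContDiff ℝ ∞ fun x => waveConv r (fun y => f y b) x :=
    (contDiff_waveConv hf).comp (f := fun x => (x, r, b)) (by fun_prop)
  have e1 := HasFDerivAt.comp (f := fun y => (y, r)) x
    (hg.differentiableAt_of_isOpen (by simp) hO (hmem r hr)).hasFDerivAt
    (hasFDerivAt_prodMk_left x r)
  have e2 := ((hw.differentiable (by simp) x).hasFDerivAt).const_mul
    (epdCore (epdExp ℓ m) (phi ℓ b) (phi ℓ t) r)
  have e3 := congrArg (fun L => L (basisVec k)) (e1.unique e2)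
  have e4 := congrFun (partialX_waveConv hs r k) x
  simp only [partialX] at e4
  simp only [ContinuousLinearMap.comp_apply, ContinuousLinearMap.inl_apply, _root_.smul_apply,
    smul_eq_mul] at e3
  rw [e4] at e3
  exact e3

theorem laplace3_evol {ℓ : ℝ} (hℓ : ℓ ≠ 1) (m : ℂ)
    (hf : ContDiff ℝ ∞ fun p : E3 × ℝ => f p.1 p.2) {t b : ℝ} (ht : 0 < t) (hb : 0 < b) (x : E3) :
    laplace3 (fun x => evol ℓ m f x t b) x =
      evol ℓ m (fun y b => laplace3 (fun y => f y b) y) x t b := by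
  unfold laplace3
  have hk : ∀ k, partialX k (partialX k fun x => evol ℓ m f x t b) = fun x => evol ℓ m (fun y b =>
      partialX k (fun y => partialX k (fun y => f y b) y) y) x t b := fun k => by
    rw [partialX_evol hℓ m hf ht hb]
    exact partialX_evol (f := fun y b => partialX k (fun y => f y b) y) hℓ m
      (contDiff_partialX_slice hf k) ht hb k
  simp_rw [hk]
  have hkk : ∀ k, ContDiff ℝ ∞ fun p : E3 × ℝ =>
      partialX k (fun y => partialX k (fun y => f y p.2) y) p.1 := fun k =>
    contDiff_partialX_slice (f := fun y b => partialX k (fun y => f y b) y)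
      (contDiff_partialX_slice hf k) k
  simp only [evol, epdInt]
  rw [← Finset.mul_sum, ← intervalIntegral.integral_finsetSum]
  · congr 1
    refine intervalIntegral.integral_congr fun r _ => ?_
    rw [← Finset.mul_sum, ← waveConv_sum]
    exact fun k => contDiff_slice_left
      (f := fun y b => partialX k (fun y => partialX k (fun y => f y b) y) y) (hkk k) b
  · intro k _
    have := (contDiffOn_evol_integrand
      (f := fun y b => partialX k (fun y => partialX k (fun y => f y b) y) y)
      hℓ m (hkk k)).continuousOn
    exact (continuousOn_slice this fun r hr =>
      mem_evolDomain hℓ (p := (x, t, b)) ⟨ht, hb⟩ hr).intervalIntegrable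

end Evolution

/-! ### Duhamel's principle -/

section Duhamel

/-- The factor `b^{ℓ/2 - im}`. -/
def sourceFactor (ℓ : ℝ) (m : ℂ) (b : ℝ) : ℂ := (b : ℂ) ^ ((ℓ : ℂ) / 2 - I * m)

/-- The superposition of the solutions `evol` with data at the times `b ∈ [ε, t]`. -/
def duhamel (ℓ ε : ℝ) (m : ℂ) (f : E3 → ℝ → ℂ) (x : E3) (t : ℝ) : ℂ :=
  ∫ b in ε..t, sourceFactor ℓ m b * evol ℓ m f x t b

/-- The derivative in `t` of `duhamel`. -/
def duhamelT (ℓ ε : ℝ) (m : ℂ) (f : E3 → ℝ → ℂ) (x : E3) (t : ℝ) : ℂ :=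
  ∫ b in ε..t, sourceFactor ℓ m b * evolT ℓ m f x t b

variable {f : E3 → ℝ → ℂ} {ℓ ε : ℝ}

theorem pos_of_mem_uIcc {t b : ℝ} (hε : 0 < ε) (ht : 0 < t) (hb : b ∈ Set.uIcc ε t) : 0 < b :=
  (lt_min hε ht).trans_le hb.1

theorem contDiffOn_sourceFactor (ℓ : ℝ) (m : ℂ) :
    ContDiffOn ℝ ∞ (sourceFactor ℓ m) (Set.Ioi 0) :=
  contDiffOn_ofReal_cpow contDiffOn_id (fun _ hx => hx) _

theorem contDiffOn_source_mul (ℓ : ℝ) (m : ℂ) {g : E3 × ℝ × ℝ → ℂ}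
    (hg : ContDiffOn ℝ ∞ g posTimes) :
    ContDiffOn ℝ ∞ (fun p => sourceFactor ℓ m p.2.2 * g p) posTimes :=
  ((contDiffOn_sourceFactor ℓ m).comp (f := fun p : E3 × ℝ × ℝ => p.2.2) (by fun_prop)
    fun _ hp => hp.2).mul hg

/-- `evolT` is the time component of the derivative of the smooth function `evol`, so its integral
formula need not be examined. -/
theorem contDiffOn_evolT (hℓ : ℓ ≠ 1) (m : ℂ) (hf : ContDiff ℝ ∞ fun p : E3 × ℝ => f p.1 p.2) :
    ContDiffOn ℝ ∞ (fun p : E3 × ℝ × ℝ => evolT ℓ m f p.1 p.2.1 p.2.2) posTimes := by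
  have h := contDiffOn_evol hℓ m hf
  refine ((h.fderiv_of_isOpen isOpen_posTimes (m := ∞) (by simp)).clm_apply
    (contDiffOn_const (c := ((0 : E3), (1 : ℝ), (0 : ℝ))))).congr fun p hp => ?_
  have hpath : HasDerivAt (fun t => (p.1, t, p.2.2)) ((0 : E3), (1 : ℝ), (0 : ℝ)) p.2.1 :=
    (hasDerivAt_const _ _).prodMk ((hasDerivAt_id _).prodMk (hasDerivAt_const _ _))
  have h1 := HasFDerivAt.comp_hasDerivAt (f := fun t => (p.1, t, p.2.2)) p.2.1
    (h.differentiableAt_of_isOpen (by simp) isOpen_posTimes hp).hasFDerivAt hpath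
  exact (hasDerivAt_evol hℓ m hf p.1 hp.1 hp.2).unique h1

theorem isOpen_pos_pos : IsOpen {q : ℝ × ℝ | 0 < q.1 ∧ 0 < q.2} :=
  (isOpen_lt (f := fun _ => (0 : ℝ)) (g := fun p : ℝ × ℝ => p.1) (by fun_prop)
    (by fun_prop)).inter (isOpen_lt (f := fun _ => (0 : ℝ)) (g := fun p : ℝ × ℝ => p.2)
    (by fun_prop) (by fun_prop))

theorem intervalIntegrable_posTimes {g : E3 × ℝ × ℝ → ℂ} (hg : ContDiffOn ℝ ∞ g posTimes)
    (hε : 0 < ε) (x : E3) {t : ℝ} (ht : 0 < t) :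
    IntervalIntegrable (fun b => g (x, t, b)) volume ε t :=
  (hg.continuousOn.comp (f := fun b => (x, t, b)) (by fun_prop) fun _ hb =>
    ⟨ht, pos_of_mem_uIcc hε ht hb⟩).intervalIntegrable

theorem duhamel_self (m : ℂ) (f : E3 → ℝ → ℂ) (x : E3) : duhamel ℓ ε m f x ε = 0 := by
  simp [duhamel]

theorem duhamelT_self (m : ℂ) (f : E3 → ℝ → ℂ) (x : E3) : duhamelT ℓ ε m f x ε = 0 := by
  simp [duhamelT]

theorem contDiffOn_slice_posTimes {g : E3 × ℝ × ℝ → ℂ} (hg : ContDiffOn ℝ ∞ g posTimes) (x : E3) :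
    ContDiffOn ℝ ∞ (fun q : ℝ × ℝ => g (x, q.1, q.2)) {q : ℝ × ℝ | 0 < q.1 ∧ 0 < q.2} :=
  hg.comp (f := fun q : ℝ × ℝ => (x, q.1, q.2)) (by fun_prop) fun _ hq => hq

/-- The end-point term is `evol` at its own pole, which is zero. -/
theorem hasDerivAt_duhamel (hℓ : ℓ ≠ 1) (hε : 0 < ε) (m : ℂ)
    (hf : ContDiff ℝ ∞ fun p : E3 × ℝ => f p.1 p.2) (x : E3) {t : ℝ} (ht : 0 < t) :
    HasDerivAt (duhamel ℓ ε m f x) (duhamelT ℓ ε m f x t) t := by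
  have h := hasDerivAt_leibniz isOpen_pos_pos
    (h := fun t b => sourceFactor ℓ m b * evol ℓ m f x t b)
    (h' := fun t b => sourceFactor ℓ m b * evolT ℓ m f x t b)
    (contDiffOn_slice_posTimes (contDiffOn_source_mul ℓ m (contDiffOn_evol hℓ m hf)) x)
    ε (hasDerivAt_id t) (fun b hb => ⟨ht, pos_of_mem_uIcc hε ht hb⟩)
    fun b hb => (hasDerivAt_evol hℓ m hf x ht (pos_of_mem_uIcc hε ht hb)).const_mul _
  refine h.congr_deriv ?_
  simp only [id, evol_self]
  simp [duhamelT]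

/-- Now the end-point term survives: the velocity of `evol` at its pole is the datum, and this
produces the source. -/
theorem hasDerivAt_duhamelT (hℓ : ℓ ≠ 1) (hε : 0 < ε) (m : ℂ)
    (hf : ContDiff ℝ ∞ fun p : E3 × ℝ => f p.1 p.2) (x : E3) {t : ℝ} (ht : 0 < t) :
    HasDerivAt (duhamelT ℓ ε m f x) (sourceFactor ℓ m t * f x t +
      (((t ^ (-ℓ) : ℝ) : ℂ) ^ 2 * duhamel ℓ ε m (fun y b => laplace3 (fun y => f y b) y) x t -
        (ℓ + 2 * I * m) / t * duhamelT ℓ ε m f x t)) t := by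
  have h := hasDerivAt_leibniz isOpen_pos_pos
    (h := fun t b => sourceFactor ℓ m b * evolT ℓ m f x t b)
    (h' := fun t b => sourceFactor ℓ m b * (((t ^ (-ℓ) : ℝ) : ℂ) ^ 2 *
      evol ℓ m (fun y b => laplace3 (fun y => f y b) y) x t b -
        (ℓ + 2 * I * m) / t * evolT ℓ m f x t b))
    (contDiffOn_slice_posTimes (contDiffOn_source_mul ℓ m (contDiffOn_evolT hℓ m hf)) x)
    ε (hasDerivAt_id t) (fun b hb => ⟨ht, pos_of_mem_uIcc hε ht hb⟩)
    fun b hb => (hasDerivAt_evolT hℓ m hf x ht (pos_of_mem_uIcc hε ht hb)).const_mul _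
  refine h.congr_deriv ?_
  simp only [id, evolT_self hℓ m f x ht, one_smul]
  congr 1
  have i1 := intervalIntegrable_posTimes (contDiffOn_source_mul ℓ m (contDiffOn_evol
    (f := fun y b => laplace3 (fun y => f y b) y) hℓ m (contDiff_laplace3_slice hf))) hε x ht
  have i2 := intervalIntegrable_posTimes (contDiffOn_source_mul ℓ m (contDiffOn_evolT hℓ m hf))
    hε x ht
  rw [duhamel, duhamelT, ← intervalIntegral.integral_const_mul,
    ← intervalIntegral.integral_const_mul, ← intervalIntegral.integral_sub (i1.const_mul _)
      (i2.const_mul _)]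
  refine intervalIntegral.integral_congr fun b _ => ?_
  ring

/-- The set of points with positive time. -/
def posTime : Set (E3 × ℝ) := {p | 0 < p.2}

theorem isOpen_posTime : IsOpen posTime :=
  isOpen_lt (f := fun _ => (0 : ℝ)) (g := fun p : E3 × ℝ => p.2) (by fun_prop) (by fun_prop)

theorem contDiffOn_duhamel (hℓ : ℓ ≠ 1) (hε : 0 < ε) (m : ℂ)
    (hf : ContDiff ℝ ∞ fun p : E3 × ℝ => f p.1 p.2) :
    ContDiffOn ℝ ∞ (fun p : E3 × ℝ => duhamel ℓ ε m f p.1 p.2) posTime := by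
  have hmap : ContDiff ℝ ∞ (fun q : (E3 × ℝ) × ℝ => (q.1.1, q.1.2, q.2)) := by fun_prop
  exact contDiffOn_intervalIntegral (isOpen_posTimes.preimage hmap.continuous)
    ((contDiffOn_source_mul ℓ m (contDiffOn_evol hℓ m hf)).comp hmap.contDiffOn fun q
      (hq : q ∈ (fun q : (E3 × ℝ) × ℝ => (q.1.1, q.1.2, q.2)) ⁻¹' posTimes) => hq)
    ε isOpen_posTime (c := fun p => p.2) (by fun_prop)
    fun p hp r hr => ⟨hp, pos_of_mem_uIcc hε hp hr⟩

theorem partialX_duhamel (hℓ : ℓ ≠ 1) (hε : 0 < ε) (m : ℂ)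
    (hf : ContDiff ℝ ∞ fun p : E3 × ℝ => f p.1 p.2) {t : ℝ} (ht : 0 < t) (k : Fin 3) :
    partialX k (fun x => duhamel ℓ ε m f x t) =
      fun x => duhamel ℓ ε m (fun y b => partialX k (fun y => f y b) y) x t := by
  funext x
  have hmap : ContDiff ℝ ∞ (fun q : E3 × ℝ => (q.1, t, q.2)) := by fun_prop
  have hO := isOpen_posTimes.preimage hmap.continuous
  have hg := (contDiffOn_source_mul ℓ m (contDiffOn_evol hℓ m hf)).comp hmap.contDiffOn fun q
    (hq : q ∈ (fun q : E3 × ℝ => (q.1, t, q.2)) ⁻¹' posTimes) => hq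
  have hmem : ∀ b ∈ Set.uIcc ε t, (x, b) ∈ (fun q : E3 × ℝ => (q.1, t, q.2)) ⁻¹' posTimes :=
    fun b hb => ⟨ht, pos_of_mem_uIcc hε ht hb⟩
  have hI' := fderiv_intervalIntegral_const_apply hO (hg.of_le (by simp)) ε t hmem (basisVec k)
  refine hI'.trans (intervalIntegral.integral_congr fun b hb => ?_)
  have hb' : 0 < b := pos_of_mem_uIcc hε ht hb
  have e1 := HasFDerivAt.comp (f := fun y => (y, b)) x
    (hg.differentiableAt_of_isOpen (by simp) hO (hmem b hb)).hasFDerivAt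
    (hasFDerivAt_prodMk_left x b)
  have hev : DifferentiableAt ℝ (fun x => evol ℓ m f x t b) x :=
    DifferentiableAt.comp (f := fun x => (x, t, b)) x
      ((contDiffOn_evol hℓ m hf).differentiableAt_of_isOpen (by simp) isOpen_posTimes
        (⟨ht, hb'⟩ : (x, t, b) ∈ posTimes)) (by fun_prop)
  have e2 := hev.hasFDerivAt.const_mul (sourceFactor ℓ m b)
  have e3 := congrArg (fun L => L (basisVec k)) (e1.unique e2)
  have e4 := congrFun (partialX_evol hℓ m hf ht hb' k) x
  simp only [partialX] at e4
  simp only [ContinuousLinearMap.comp_apply, ContinuousLinearMap.inl_apply, _root_.smul_apply,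
    smul_eq_mul] at e3
  rw [e4] at e3
  exact e3

theorem laplace3_duhamel (hℓ : ℓ ≠ 1) (hε : 0 < ε) (m : ℂ)
    (hf : ContDiff ℝ ∞ fun p : E3 × ℝ => f p.1 p.2) {t : ℝ} (ht : 0 < t) (x : E3) :
    laplace3 (fun x => duhamel ℓ ε m f x t) x =
      duhamel ℓ ε m (fun y b => laplace3 (fun y => f y b) y) x t := by
  have hkk : ∀ k, ContDiff ℝ ∞ fun p : E3 × ℝ =>
      partialX k (fun y => partialX k (fun y => f y p.2) y) p.1 := fun k =>
    contDiff_partialX_slice (f := fun y b => partialX k (fun y => f y b) y)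
      (contDiff_partialX_slice hf k) k
  have hk : ∀ k, partialX k (partialX k fun x => duhamel ℓ ε m f x t) =
      fun x => duhamel ℓ ε m (fun y b =>
        partialX k (fun y => partialX k (fun y => f y b) y) y) x t := fun k => by
    rw [partialX_duhamel hℓ hε m hf ht]
    exact partialX_duhamel (f := fun y b => partialX k (fun y => f y b) y) hℓ hε m
      (contDiff_partialX_slice hf k) ht k
  have hev : ∀ b, 0 < b → evol ℓ m (fun y b => laplace3 (fun y => f y b) y) x t b =
      ∑ k, evol ℓ m (fun y b => partialX k (fun y => partialX k (fun y => f y b) y) y) x t b := by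
    intro b hb
    rw [← laplace3_evol hℓ m hf ht hb, laplace3]
    refine Finset.sum_congr rfl fun k _ => ?_
    rw [partialX_evol hℓ m hf ht hb]
    exact congrFun (partialX_evol (f := fun y b => partialX k (fun y => f y b) y) hℓ m
      (contDiff_partialX_slice hf k) ht hb k) x
  rw [laplace3]
  simp_rw [hk]
  simp only [duhamel]
  rw [← intervalIntegral.integral_finsetSum]
  · refine intervalIntegral.integral_congr fun b hb => ?_
    rw [hev b (pos_of_mem_uIcc hε ht hb), Finset.mul_sum]
  · intro k _
    exact intervalIntegrable_posTimes (contDiffOn_source_mul ℓ m (contDiffOn_evol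
      (f := fun y b => partialX k (fun y => partialX k (fun y => f y b) y) y)
      hℓ m (hkk k))) hε x ht

/-! ### The operators of the solution formula -/

theorem two_abs_phi_cpow (ℓ : ℝ) (m : ℂ) (b : ℝ) :
    ((2 * |phi ℓ b| : ℝ) : ℂ) ^ (2 * epdExp ℓ m) =
      (2 : ℂ) ^ (2 * I * m / ((1 - ℓ : ℝ) : ℂ)) *
        ((|phi ℓ b| : ℝ) : ℂ) ^ (2 * I * m / ((1 - ℓ : ℝ) : ℂ)) := by
  have h : 2 * epdExp ℓ m = 2 * I * m / ((1 - ℓ : ℝ) : ℂ) := by rw [epdExp]; ring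
  rw [h, ofReal_mul, Complex.mul_cpow_ofReal_nonneg (by norm_num) (abs_nonneg _)]
  norm_num

/-- The powers of `|1 - ℓ|` and `|φ(b)|` with exponent `ℓ/(1-ℓ)` combine to `b^ℓ`; the factor `2`
cancels the `-1` in the exponent of `2`. -/
theorem two_mul_kernelE (hℓ : ℓ ≠ 1) (m : ℂ) (r t : ℝ) {b : ℝ} (hb : 0 < b) :
    2 * kernelE ℓ r t b m = evolConst ℓ m b * epdCore (epdExp ℓ m) (phi ℓ b) (phi ℓ t) r := by
  have hφ := abs_pos.2 (phi_ne_zero hℓ hb)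
  have h1 : 1 - ℓ ≠ 0 := sub_ne_zero.2 hℓ.symm
  have h2 : ((ℓ : ℂ) + 2 * I * m) / ((1 - ℓ : ℝ) : ℂ) =
      ((ℓ / (1 - ℓ) : ℝ) : ℂ) + 2 * I * m / ((1 - ℓ : ℝ) : ℂ) := by
    push_cast; ring
  have h3 : |1 - ℓ| ^ (ℓ / (1 - ℓ)) * |phi ℓ b| ^ (ℓ / (1 - ℓ)) = b ^ ℓ := by
    rw [← Real.mul_rpow (abs_nonneg _) (abs_nonneg _), ← abs_mul, one_sub_mul_phi hℓ,
      abs_of_pos (Real.rpow_pos_of_pos hb _), ← Real.rpow_mul hb.le, mul_div_cancel₀ _ h1]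
  rw [evolConst, two_abs_phi_cpow ℓ m b, kernelE, h2,
    Complex.cpow_add _ _ (by exact_mod_cast hφ.ne'), ← Complex.ofReal_cpow hφ.le,
    Complex.cpow_sub _ _ two_ne_zero, Complex.cpow_one, ← h3]
  change _ = _ * kernelCore ℓ m r t b
  push_cast
  ring

theorem opG_eq_duhamel (hℓ : ℓ ≠ 1) (hε : 0 < ε) (m : ℂ) (f : E3 → ℝ → ℂ) (x : E3) {t : ℝ}
    (ht : 0 < t) : opG ℓ ε m f x t = -duhamel ℓ ε m f x t := by
  rw [opG, duhamel, ← intervalIntegral.integral_const_mul, ← intervalIntegral.integral_neg]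
  refine intervalIntegral.integral_congr fun b hb => ?_
  have hb' := pos_of_mem_uIcc hε ht hb
  have h : ∀ r, kernelE ℓ r t b m * waveConv r (fun y => f y b) x =
      (evolConst ℓ m b / 2) *
        (epdCore (epdExp ℓ m) (phi ℓ b) (phi ℓ t) r * waveConv r (fun y => f y b) x) := fun r => by
    linear_combination (waveConv r (fun y => f y b) x / 2) * two_mul_kernelE hℓ m r t hb'
  rw [evol, epdInt, sourceFactor]
  simp_rw [h]
  rw [intervalIntegral.integral_const_mul]
  ring

/-- `ε / ((1 - ℓ) φ(ε)) = ε^ℓ`, whatever the sign of `1 - ℓ`. The data are regarded as independent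
of the source time, so that `evol` can be used. -/
theorem opK1_eq_evol (hℓ : ℓ ≠ 1) (hε : 0 < ε) (m : ℂ) (φ : E3 → ℂ) (x : E3) (t : ℝ) :
    opK1 ℓ ε m φ x t = -I * sourceFactor ℓ m ε * evol ℓ m (fun y _ => φ y) x t ε := by
  have hεC : (ε : ℂ) ≠ 0 := by exact_mod_cast hε.ne'
  have h1 : ((1 - ℓ : ℝ) : ℂ) ≠ 0 := by exact_mod_cast sub_ne_zero.2 hℓ.symm
  have hφ : (phi ℓ ε : ℂ) ≠ 0 := by exact_mod_cast phi_ne_zero hℓ hε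
  have h2 : (ε : ℂ) ^ (1 + (ℓ : ℂ) / 2 - I * m) = ε * sourceFactor ℓ m ε := by
    rw [sourceFactor, add_sub_assoc, Complex.cpow_add _ _ hεC, Complex.cpow_one]
  have h3 : (ε : ℂ) * ((1 - ℓ : ℝ) : ℂ)⁻¹ * (phi ℓ ε : ℂ)⁻¹ = ((ε ^ ℓ : ℝ) : ℂ) := by
    have : ε ^ ℓ * ((1 - ℓ) * phi ℓ ε) = ε := by
      rw [one_sub_mul_phi hℓ, ← Real.rpow_add hε]
      simp
    have h4 : ((ε ^ ℓ : ℝ) : ℂ) * (((1 - ℓ : ℝ) : ℂ) * phi ℓ ε) = ε := by exact_mod_cast this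
    rw [← h4]
    field_simp
  have h5 : ∀ r, kernelK1 ℓ r t m ε * waveConv r φ x =
      ((2 : ℂ) ^ (2 * I * m / ((1 - ℓ : ℝ) : ℂ)) *
        (((|phi ℓ ε| : ℝ) : ℂ) ^ (2 * I * m / ((1 - ℓ : ℝ) : ℂ)) * ((phi ℓ ε : ℝ) : ℂ)⁻¹)) *
      (epdCore (epdExp ℓ m) (phi ℓ ε) (phi ℓ t) r * waveConv r φ x) := fun r => mul_assoc _ _ _
  rw [opK1, h2, evol, evolConst, two_abs_phi_cpow ℓ m ε, epdInt]
  simp_rw [h5]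
  rw [intervalIntegral.integral_const_mul, ← h3]
  ring

/-- One component of the function in the braces of the solution formula. -/
def scalarPotential (ℓ ε : ℝ) (m : ℂ) (s : ℂ) (f : E3 → ℝ → ℂ) (φ : E3 → ℂ) (x : E3) (t : ℝ) : ℂ :=
  -duhamel ℓ ε m f x t + s * (-I * sourceFactor ℓ m ε * evol ℓ m (fun y _ => φ y) x t ε)

variable {φ : E3 → ℂ}

theorem contDiffOn_scalarPotential (hℓ : ℓ ≠ 1) (hε : 0 < ε) (m s : ℂ)
    (hf : ContDiff ℝ ∞ fun p : E3 × ℝ => f p.1 p.2) (hφ : ContDiff ℝ ∞ φ) :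
    ContDiffOn ℝ ∞ (fun p : E3 × ℝ => scalarPotential ℓ ε m s f φ p.1 p.2) posTime := by
  have h1 := (contDiffOn_evol (f := fun y _ => φ y) hℓ m (hφ.comp contDiff_fst)).comp
    (f := fun p : E3 × ℝ => (p.1, p.2, ε)) (s := posTime) (by fun_prop) fun p hp => ⟨hp, hε⟩
  exact (contDiffOn_duhamel hℓ hε m hf).neg.add
    (contDiffOn_const.mul (contDiffOn_const.mul h1))

/-- The derivative in `t` of `scalarPotential`. -/
def scalarPotentialT (ℓ ε : ℝ) (m : ℂ) (s : ℂ) (f : E3 → ℝ → ℂ) (φ : E3 → ℂ) (x : E3) (t : ℝ) :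
    ℂ :=
  -duhamelT ℓ ε m f x t + s * (-I * sourceFactor ℓ m ε * evolT ℓ m (fun y _ => φ y) x t ε)

theorem scalarPotential_initial (m s : ℂ) (x : E3) : scalarPotential ℓ ε m s f φ x ε = 0 := by
  simp [scalarPotential, duhamel_self, evol_self]

theorem scalarPotentialT_initial (hℓ : ℓ ≠ 1) (hε : 0 < ε) (m s : ℂ) (x : E3) :
    scalarPotentialT ℓ ε m s f φ x ε = s * (-I * sourceFactor ℓ m ε * φ x) := by
  simp [scalarPotentialT, duhamelT_self, evolT_self hℓ m _ x hε]

theorem hasDerivAt_scalarPotential (hℓ : ℓ ≠ 1) (hε : 0 < ε) (m s : ℂ)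
    (hf : ContDiff ℝ ∞ fun p : E3 × ℝ => f p.1 p.2) (hφ : ContDiff ℝ ∞ φ) (x : E3) {t : ℝ}
    (ht : 0 < t) :
    HasDerivAt (scalarPotential ℓ ε m s f φ x) (scalarPotentialT ℓ ε m s f φ x t) t :=
  (hasDerivAt_duhamel hℓ hε m hf x ht).neg.add
    (((hasDerivAt_evol (f := fun y _ => φ y) hℓ m (hφ.comp contDiff_fst) x ht hε).const_mul
      _).const_mul _)

theorem hasDerivAt_scalarPotentialT (hℓ : ℓ ≠ 1) (hε : 0 < ε) (m s : ℂ)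
    (hf : ContDiff ℝ ∞ fun p : E3 × ℝ => f p.1 p.2) (hφ : ContDiff ℝ ∞ φ) (x : E3) {t : ℝ}
    (ht : 0 < t) :
    HasDerivAt (scalarPotentialT ℓ ε m s f φ x)
      (((t ^ (-ℓ) : ℝ) : ℂ) ^ 2 * laplace3 (fun y => scalarPotential ℓ ε m s f φ y t) x -
        (ℓ + 2 * I * m) / t * scalarPotentialT ℓ ε m s f φ x t - sourceFactor ℓ m t * f x t) t := by
  have hφ' : ContDiff ℝ ∞ fun p : E3 × ℝ => φ p.1 := hφ.comp contDiff_fst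
  have h := (hasDerivAt_duhamelT hℓ hε m hf x ht).neg.add
    (((hasDerivAt_evolT (f := fun y _ => φ y) hℓ m hφ' x ht hε).const_mul
      (-I * sourceFactor ℓ m ε)).const_mul s)
  refine h.congr_deriv ?_
  have hlap : laplace3 (fun y => scalarPotential ℓ ε m s f φ y t) x =
      -laplace3 (fun y => duhamel ℓ ε m f y t) x + s * (-I * sourceFactor ℓ m ε *
        laplace3 (fun y => evol ℓ m (fun y _ => φ y) y t ε) x) := by
    have hd : ContDiff ℝ ∞ fun y => duhamel ℓ ε m f y t := by
      rw [← contDiffOn_univ]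
      exact (contDiffOn_duhamel hℓ hε m hf).comp (f := fun y => (y, t)) (by fun_prop)
        fun y _ => ht
    have he : ContDiff ℝ ∞ fun y => evol ℓ m (fun y _ => φ y) y t ε := by
      rw [← contDiffOn_univ]
      exact (contDiffOn_evol (f := fun y _ => φ y) hℓ m hφ').comp (f := fun y => (y, t, ε))
        (by fun_prop) fun y _ => ⟨ht, hε⟩
    have hlin : ∀ (u w : E3 → ℂ), ContDiff ℝ ∞ u → ContDiff ℝ ∞ w → ∀ k,
        partialX k (fun y => -u y + s * (-I * sourceFactor ℓ m ε * w y)) = fun y =>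
          -partialX k u y + s * (-I * sourceFactor ℓ m ε * partialX k w y) := by
      intro u w hu hw k
      funext y
      have h1 := (hu.differentiable (by simp) y).hasFDerivAt.neg.add
        (((hw.differentiable (by simp) y).hasFDerivAt.const_mul
          (-I * sourceFactor ℓ m ε)).const_mul s)
      refine (congrArg (fun L => L (basisVec k)) h1.fderiv).trans ?_
      simp [partialX]
    simp only [laplace3, scalarPotential]
    rw [Finset.mul_sum, Finset.mul_sum, ← Finset.sum_neg_distrib, ← Finset.sum_add_distrib]
    refine Finset.sum_congr rfl fun k _ => ?_
    rw [hlin _ _ hd he, hlin _ _ (hd.partialX k) (he.partialX k)]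
  rw [hlap, laplace3_duhamel hℓ hε m hf ht, laplace3_evol (f := fun y _ => φ y) hℓ m hφ' ht hε,
    scalarPotentialT]
  ring

end Duhamel

/-! ### The Dirac operator in components -/

section DiracAlgebra

/-- `∑ k, σᵏ v_k`. -/
def pauliDot (v : Fin 3 → Fin 2 → ℂ) (i : Fin 2) : ℂ := ∑ k, ∑ j, pauli k i j * v k j

theorem pauliDot_eq (v : Fin 3 → Fin 2 → ℂ) (i : Fin 2) :
    pauliDot v i = ∑ k, (pauli k *ᵥ v k) i := rfl

theorem pauliDot_zero (v : Fin 3 → Fin 2 → ℂ) :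
    pauliDot v 0 = v 0 1 - I * v 1 1 + v 2 0 := by
  simp [pauliDot, Fin.sum_univ_three, pauli]
  ring

theorem pauliDot_one (v : Fin 3 → Fin 2 → ℂ) :
    pauliDot v 1 = v 0 0 + I * v 1 0 - v 2 1 := by
  simp [pauliDot, Fin.sum_univ_three, pauli]
  ring

/-- The Clifford relations `σʲσᵏ + σᵏσʲ = 2δ`: contracted with a symmetric array only the trace
remains. Applied to second derivatives this is `(σ·∂)² = Δ`. -/
theorem pauliDot_pauliDot {v : Fin 3 → Fin 3 → Fin 2 → ℂ} (hv : ∀ j k, v j k = v k j) (i : Fin 2) :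
    pauliDot (fun l j => pauliDot (fun k => v l k) j) i = ∑ k, v k k i := by
  have h01 := hv 0 1
  have h02 := hv 0 2
  have h12 := hv 1 2
  fin_cases i
  · simp only [Fin.zero_eta, pauliDot_zero, pauliDot_one, Fin.sum_univ_three, h01, h02, h12]
    linear_combination (-v 1 1 0) * I_sq
  · simp only [Fin.mk_one, pauliDot_zero, pauliDot_one, Fin.sum_univ_three, h01, h02, h12]
    linear_combination (-v 1 1 1) * I_sq

theorem pauliDot_add_mul (a b : ℂ) (v w : Fin 3 → Fin 2 → ℂ) (i : Fin 2) :
    pauliDot (fun k j => a * v k j + b * w k j) i = a * pauliDot v i + b * pauliDot w i := by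
  simp only [pauliDot, Finset.mul_sum, ← Finset.sum_add_distrib]
  refine Finset.sum_congr rfl fun k _ => Finset.sum_congr rfl fun j _ => ?_
  ring

theorem gamma0_mulVec_inl (v : Spinor) (i : Fin 2) : (gamma0 *ᵥ v) (Sum.inl i) = v (Sum.inl i) := by
  simp [gamma0, Matrix.fromBlocks_mulVec]

theorem gamma0_mulVec_inr (v : Spinor) (i : Fin 2) :
    (gamma0 *ᵥ v) (Sum.inr i) = -v (Sum.inr i) := by
  simp [gamma0, Matrix.fromBlocks_mulVec, Matrix.neg_mulVec]

theorem gammaS_mulVec_inl (k : Fin 3) (v : Spinor) (i : Fin 2) :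
    (gammaS k *ᵥ v) (Sum.inl i) = (pauli k *ᵥ fun j => v (Sum.inr j)) i := by
  simp [gammaS, Matrix.fromBlocks_mulVec, Function.comp_def]

theorem gammaS_mulVec_inr (k : Fin 3) (v : Spinor) (i : Fin 2) :
    (gammaS k *ᵥ v) (Sum.inr i) = -(pauli k *ᵥ fun j => v (Sum.inl j)) i := by
  rw [gammaS, Matrix.fromBlocks_mulVec, Sum.elim_inr, Pi.add_apply, Matrix.neg_mulVec,
    Matrix.zero_mulVec, Pi.zero_apply, add_zero]
  rfl

theorem phaseMat_mulVec_inl (m : ℂ) (t : ℝ) (v : Spinor) (i : Fin 2) :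
    (phaseMat m t *ᵥ v) (Sum.inl i) = (t : ℂ) ^ (I * m) * v (Sum.inl i) := by
  simp [phaseMat, gammaU, gammaL, Matrix.add_mulVec, Matrix.smul_mulVec, Matrix.fromBlocks_mulVec]

theorem phaseMat_mulVec_inr (m : ℂ) (t : ℝ) (v : Spinor) (i : Fin 2) :
    (phaseMat m t *ᵥ v) (Sum.inr i) = (t : ℂ) ^ (-(I * m)) * v (Sum.inr i) := by
  simp [phaseMat, gammaU, gammaL, Matrix.add_mulVec, Matrix.smul_mulVec, Matrix.fromBlocks_mulVec]

theorem pauli_mulVec_const_mul (k : Fin 3) (c : ℂ) (v : Fin 2 → ℂ) (i : Fin 2) :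
    (pauli k *ᵥ fun j => c * v j) i = c * (pauli k *ᵥ v) i := by
  have := congrFun (Matrix.mulVec_smul (pauli k) c v) i
  simpa using this

theorem diracOp_inl (ℓ : ℝ) (m : ℂ) (Ψ : E3 → ℝ → Spinor) (x : E3) (t : ℝ) (i : Fin 2) :
    diracOp ℓ m Ψ x t (Sum.inl i) = I * dT Ψ x t (Sum.inl i) +
      I * ((1 / scaleFactor ℓ t : ℝ) : ℂ) * pauliDot (fun k j => dX k Ψ x t (Sum.inr j)) i +
      I * ((3 * deriv (scaleFactor ℓ) t / (2 * scaleFactor ℓ t) : ℝ) : ℂ) * Ψ x t (Sum.inl i) -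
      m * (t : ℂ)⁻¹ * Ψ x t (Sum.inl i) := by
  simp only [diracOp, Pi.add_apply, Pi.sub_apply, Pi.smul_apply, smul_eq_mul, gamma0_mulVec_inl,
    Finset.sum_apply, gammaS_mulVec_inl, pauliDot_eq]

theorem diracOp_inr (ℓ : ℝ) (m : ℂ) (Ψ : E3 → ℝ → Spinor) (x : E3) (t : ℝ) (i : Fin 2) :
    diracOp ℓ m Ψ x t (Sum.inr i) = -(I * dT Ψ x t (Sum.inr i) +
      I * ((1 / scaleFactor ℓ t : ℝ) : ℂ) * pauliDot (fun k j => dX k Ψ x t (Sum.inl j)) i +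
      I * ((3 * deriv (scaleFactor ℓ) t / (2 * scaleFactor ℓ t) : ℝ) : ℂ) * Ψ x t (Sum.inr i) -
      (-m) * (t : ℂ)⁻¹ * Ψ x t (Sum.inr i)) := by
  simp only [diracOp, Pi.add_apply, Pi.sub_apply, Pi.smul_apply, smul_eq_mul, gamma0_mulVec_inr,
    Finset.sum_apply, gammaS_mulVec_inr, pauliDot_eq, Finset.sum_neg_distrib]
  ring

theorem diracCo_inl (ℓ : ℝ) (m : ℂ) (Φ : E3 → ℝ → Spinor) (x : E3) (t : ℝ) (i : Fin 2) :
    diracCo ℓ m Φ x t (Sum.inl i) =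
      I * ((t ^ (-ℓ / 2) : ℝ) : ℂ) * (t : ℂ) ^ (I * m) * dT Φ x t (Sum.inl i) +
      I * ((t ^ (-3 * ℓ / 2) : ℝ) : ℂ) * (t : ℂ) ^ (-(I * m)) *
        pauliDot (fun k j => dX k Φ x t (Sum.inr j)) i := by
  simp only [diracCo, Pi.add_apply, Pi.smul_apply, smul_eq_mul, ← Matrix.mulVec_mulVec,
    gamma0_mulVec_inl, Finset.sum_apply, gammaS_mulVec_inl, pauliDot_eq, phaseMat_mulVec_inl,
    phaseMat_mulVec_inr, pauli_mulVec_const_mul, ← Finset.mul_sum]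
  ring

theorem diracCo_inr (ℓ : ℝ) (m : ℂ) (Φ : E3 → ℝ → Spinor) (x : E3) (t : ℝ) (i : Fin 2) :
    diracCo ℓ m Φ x t (Sum.inr i) =
      -(I * ((t ^ (-ℓ / 2) : ℝ) : ℂ) * (t : ℂ) ^ (-(I * m)) * dT Φ x t (Sum.inr i) +
      I * ((t ^ (-3 * ℓ / 2) : ℝ) : ℂ) * (t : ℂ) ^ (I * m) *
        pauliDot (fun k j => dX k Φ x t (Sum.inl j)) i) := by
  simp only [diracCo, Pi.add_apply, Pi.smul_apply, smul_eq_mul, ← Matrix.mulVec_mulVec,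
    gamma0_mulVec_inr, Finset.sum_apply, gammaS_mulVec_inr, pauliDot_eq, phaseMat_mulVec_inl,
    phaseMat_mulVec_inr, pauli_mulVec_const_mul, ← Finset.mul_sum, Finset.sum_neg_distrib]
  ring

/-! ### Derivatives of spinor fields -/

theorem dT_apply {Ψ : E3 → ℝ → Spinor} {x : E3} {t : ℝ}
    (h : ∀ c, DifferentiableAt ℝ (fun p : E3 × ℝ => Ψ p.1 p.2 c) (x, t)) (c : Fin 2 ⊕ Fin 2) :
    dT Ψ x t c = fderiv ℝ (fun p : E3 × ℝ => Ψ p.1 p.2 c) (x, t) (0, 1) := by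
  have h1 : ∀ c, HasDerivAt (fun s => Ψ x s c)
      (fderiv ℝ (fun p : E3 × ℝ => Ψ p.1 p.2 c) (x, t) (0, 1)) t := fun c =>
    HasFDerivAt.comp_hasDerivAt (f := fun s => (x, s)) t (h c).hasFDerivAt
      ((hasDerivAt_const t x).prodMk (hasDerivAt_id t))
  exact congrFun (hasDerivAt_pi.2 h1).deriv c

theorem dX_apply {Ψ : E3 → ℝ → Spinor} {x : E3} {t : ℝ}
    (h : ∀ c, DifferentiableAt ℝ (fun p : E3 × ℝ => Ψ p.1 p.2 c) (x, t)) (k : Fin 3)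
    (c : Fin 2 ⊕ Fin 2) :
    dX k Ψ x t c = fderiv ℝ (fun p : E3 × ℝ => Ψ p.1 p.2 c) (x, t) (basisVec k, 0) := by
  have h1 : HasFDerivAt (fun y => Ψ y t) (ContinuousLinearMap.pi fun c =>
      (fderiv ℝ (fun p : E3 × ℝ => Ψ p.1 p.2 c) (x, t)).comp
        (ContinuousLinearMap.inl ℝ E3 ℝ)) x :=
    hasFDerivAt_pi.2 fun c => HasFDerivAt.comp (f := fun y => (y, t)) x (h c).hasFDerivAt
      (hasFDerivAt_prodMk_left x t)
  have h2 := (h1.hasLineDerivAt (basisVec k)).lineDeriv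
  rw [dX, h2]
  simp

theorem fderiv_time_mul {c : ℝ → ℂ} {c' : ℂ} {G : E3 × ℝ → ℂ} {p : E3 × ℝ}
    (hc : HasDerivAt c c' p.2) (hG : DifferentiableAt ℝ G p) (v : E3 × ℝ) :
    fderiv ℝ (fun q : E3 × ℝ => c q.2 * G q) p v = v.2 * c' * G p + c p.2 * fderiv ℝ G p v := by
  have h1 : HasFDerivAt (fun q : E3 × ℝ => c q.2) _ p := hc.hasFDerivAt.comp p hasFDerivAt_snd
  rw [(h1.fun_mul hG.hasFDerivAt).fderiv]
  simp
  ring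

theorem differentiableAt_time_mul {c : ℝ → ℂ} {c' : ℂ} {G : E3 × ℝ → ℂ} {p : E3 × ℝ}
    (hc : HasDerivAt c c' p.2) (hG : DifferentiableAt ℝ G p) :
    DifferentiableAt ℝ (fun q : E3 × ℝ => c q.2 * G q) p := by
  have h1 : HasFDerivAt (fun q : E3 × ℝ => c q.2) _ p := hc.hasFDerivAt.comp p hasFDerivAt_snd
  exact h1.differentiableAt.mul hG

theorem fderiv_pauliDot {G : Fin 3 → Fin 2 → E3 × ℝ → ℂ} {p : E3 × ℝ}
    (hG : ∀ k j, DifferentiableAt ℝ (G k j) p) (v : E3 × ℝ) (i : Fin 2) :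
    fderiv ℝ (fun q => pauliDot (fun k j => G k j q) i) p v =
      pauliDot (fun k j => fderiv ℝ (G k j) p v) i := by
  have h : HasFDerivAt (fun q => ∑ k, ∑ j, pauli k i j * G k j q)
      (∑ k, ∑ j, pauli k i j • fderiv ℝ (G k j) p) p :=
    HasFDerivAt.fun_sum fun k _ => HasFDerivAt.fun_sum fun j _ =>
      (hG k j).hasFDerivAt.const_mul (pauli k i j)
  simp only [pauliDot]
  rw [h.fderiv]
  simp

theorem differentiableAt_pauliDot {G : Fin 3 → Fin 2 → E3 × ℝ → ℂ} {p : E3 × ℝ}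
    (hG : ∀ k j, DifferentiableAt ℝ (G k j) p) (i : Fin 2) :
    DifferentiableAt ℝ (fun q => pauliDot (fun k j => G k j q) i) p := by
  unfold pauliDot
  exact DifferentiableAt.fun_sum fun k _ => DifferentiableAt.fun_sum fun j _ =>
      (hG k j).const_mul (pauli k i j)

theorem fderiv_fderiv_comm {G : E3 × ℝ → ℂ} (hG : ContDiffOn ℝ ∞ G posTime) {p : E3 × ℝ}
    (hp : p ∈ posTime) (v w : E3 × ℝ) :
    fderiv ℝ (fun q => fderiv ℝ G q v) p w = fderiv ℝ (fun q => fderiv ℝ G q w) p v := by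
  have hD : DifferentiableAt ℝ (fderiv ℝ G) p :=
    (hG.fderiv_of_isOpen isOpen_posTime (m := ∞) (by simp)).differentiableAt_of_isOpen (by simp)
      isOpen_posTime hp
  have h : ∀ v w, fderiv ℝ (fun q => fderiv ℝ G q v) p w = fderiv ℝ (fderiv ℝ G) p w v := by
    intro v w
    have := hD.hasFDerivAt.clm_apply (hasFDerivAt_const v p)
    rw [this.fderiv]
    simp
  have hs : IsSymmSndFDerivAt ℝ G p :=
    ((hG.contDiffAt (isOpen_posTime.mem_nhds hp)).of_le
      (WithTop.coe_le_coe.2 (le_top : (2 : ℕ∞) ≤ ⊤))).isSymmSndFDerivAt (by simp)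
  rw [h, h, hs.eq]

end DiracAlgebra

/-! ### The composition of the Dirac operator with its right co-factor -/

section CoFactor

variable {ℓ ε : ℝ}

/-- The coefficient of `∂_t` in the upper block of the co-factor. -/
def coTime (ℓ : ℝ) (m : ℂ) (t : ℝ) : ℂ := I * ((t ^ (-ℓ / 2) : ℝ) : ℂ) * (t : ℂ) ^ (I * m)

/-- The coefficient of `σ · ∂` in the upper block of the co-factor. -/
def coSpace (ℓ : ℝ) (m : ℂ) (t : ℝ) : ℂ :=
  I * ((t ^ (-3 * ℓ / 2) : ℝ) : ℂ) * (t : ℂ) ^ (-(I * m))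

theorem hasDerivAt_rpow_mul_cpow (a : ℝ) (c : ℂ) {t : ℝ} (ht : 0 < t) :
    HasDerivAt (fun s : ℝ => I * ((s ^ a : ℝ) : ℂ) * (s : ℂ) ^ c)
      ((a + c) / t * (I * ((t ^ a : ℝ) : ℂ) * (t : ℂ) ^ c)) t := by
  have h1 := (Real.hasDerivAt_rpow_const (p := a) (Or.inl ht.ne')).ofReal_comp
  have h2 := hasDerivAt_ofReal_cpow (hasDerivAt_id t) ht c
  refine ((h1.const_mul I).mul h2).congr_deriv ?_
  have h0 : (t : ℂ) ≠ 0 := by exact_mod_cast ht.ne'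
  rw [Real.rpow_sub_one ht.ne']
  push_cast
  simp only [id]
  field_simp

theorem hasDerivAt_coTime (ℓ : ℝ) (m : ℂ) {t : ℝ} (ht : 0 < t) :
    HasDerivAt (coTime ℓ m) ((-ℓ / 2 + I * m) / t * coTime ℓ m t) t :=
  (hasDerivAt_rpow_mul_cpow (-ℓ / 2) (I * m) ht).congr_deriv (by push_cast; rfl)

theorem hasDerivAt_coSpace (ℓ : ℝ) (m : ℂ) {t : ℝ} (ht : 0 < t) :
    HasDerivAt (coSpace ℓ m) ((-3 * ℓ / 2 - I * m) / t * coSpace ℓ m t) t :=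
  (hasDerivAt_rpow_mul_cpow (-3 * ℓ / 2) (-(I * m)) ht).congr_deriv (by
    push_cast
    rw [← sub_eq_add_neg]
    rfl)

theorem contDiffOn_rpow_mul_cpow (a : ℝ) (c : ℂ) :
    ContDiffOn ℝ ∞ (fun p : E3 × ℝ => I * ((p.2 ^ a : ℝ) : ℂ) * (p.2 : ℂ) ^ c) posTime := by
  have h1 : ContDiffOn ℝ ∞ (fun p : E3 × ℝ => p.2 ^ a) posTime :=
    contDiff_snd.contDiffOn.rpow_const_of_ne fun p hp => ne_of_gt hp
  have h2 : ContDiffOn ℝ ∞ (fun p : E3 × ℝ => (p.2 : ℂ) ^ c) posTime :=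
    contDiffOn_ofReal_cpow contDiff_snd.contDiffOn (fun p hp => hp) c
  exact (contDiffOn_const.mul (ofRealCLM.contDiff.comp_contDiffOn h1)).mul h2

/-- This relation makes the mixed derivatives `∂_t (σ·∂)` cancel in the product of the two
operators. -/
theorem coSpace_eq (ℓ : ℝ) (m : ℂ) {t : ℝ} (ht : 0 < t) :
    coSpace ℓ m t = ((t ^ (-ℓ) : ℝ) : ℂ) * coTime ℓ (-m) t := by
  have h : t ^ (-3 * ℓ / 2) = t ^ (-ℓ) * t ^ (-ℓ / 2) := by
    rw [← Real.rpow_add ht]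
    ring_nf
  rw [coSpace, coTime, h, mul_neg]
  push_cast
  ring

/-- The weight `b^{ℓ/2 - im}` in both operators is, up to `i`, the reciprocal of the time
coefficient of the co-factor; it restores `F` and the initial spinor exactly. -/
theorem coTime_mul_sourceFactor (ℓ : ℝ) (m : ℂ) {t : ℝ} (ht : 0 < t) :
    coTime ℓ m t * sourceFactor ℓ m t = I := by
  have h0 : (t : ℂ) ≠ 0 := by exact_mod_cast ht.ne'
  have h : ((t ^ (-ℓ / 2) : ℝ) : ℂ) * (t : ℂ) ^ (I * m) * sourceFactor ℓ m t = 1 := by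
    rw [sourceFactor, ofReal_cpow ht.le, ← cpow_add _ _ h0, ← cpow_add _ _ h0]
    rw [show ((-ℓ / 2 : ℝ) : ℂ) + I * m + ((ℓ : ℂ) / 2 - I * m) = 0 by push_cast; ring, cpow_zero]
  rw [coTime]
  linear_combination I * h

/-- The upper block of the co-factor, applied to the pair `(u, w)` of two-component spinors. -/
def coUpper (ℓ : ℝ) (m : ℂ) (u w : Fin 2 → E3 × ℝ → ℂ) (i : Fin 2) (q : E3 × ℝ) : ℂ :=
  coTime ℓ m q.2 * fderiv ℝ (u i) q (0, 1) +
    coSpace ℓ m q.2 * pauliDot (fun k j => fderiv ℝ (w j) q (basisVec k, 0)) i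

variable {u w : Fin 2 → E3 × ℝ → ℂ}

theorem contDiffOn_fderiv_apply {G : E3 × ℝ → ℂ} (hG : ContDiffOn ℝ ∞ G posTime) (v : E3 × ℝ) :
    ContDiffOn ℝ ∞ (fun q => fderiv ℝ G q v) posTime :=
  (hG.fderiv_of_isOpen isOpen_posTime (m := ∞) (by simp)).clm_apply contDiffOn_const

theorem differentiableAt_fderiv_apply {G : E3 × ℝ → ℂ} (hG : ContDiffOn ℝ ∞ G posTime)
    {p : E3 × ℝ} (hp : p ∈ posTime) (v : E3 × ℝ) :
    DifferentiableAt ℝ (fun q => fderiv ℝ G q v) p :=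
  (contDiffOn_fderiv_apply hG v).differentiableAt_of_isOpen (by simp) isOpen_posTime hp

theorem contDiffOn_coUpper (ℓ : ℝ) (m : ℂ) (hu : ∀ i, ContDiffOn ℝ ∞ (u i) posTime)
    (hw : ∀ i, ContDiffOn ℝ ∞ (w i) posTime) (i : Fin 2) :
    ContDiffOn ℝ ∞ (coUpper ℓ m u w i) posTime := by
  refine ((contDiffOn_rpow_mul_cpow _ _).mul (contDiffOn_fderiv_apply (hu i) _)).add
    ((contDiffOn_rpow_mul_cpow _ _).mul ?_)
  unfold pauliDot
  exact ContDiffOn.sum fun k _ => ContDiffOn.sum fun j _ =>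
    contDiffOn_const.mul (contDiffOn_fderiv_apply (hw j) _)

theorem fderiv_coUpper (ℓ : ℝ) (m : ℂ) (hu : ∀ i, ContDiffOn ℝ ∞ (u i) posTime)
    (hw : ∀ i, ContDiffOn ℝ ∞ (w i) posTime) (i : Fin 2) {p : E3 × ℝ} (hp : p ∈ posTime)
    (v : E3 × ℝ) :
    fderiv ℝ (coUpper ℓ m u w i) p v =
      v.2 * ((-ℓ / 2 + I * m) / p.2 * coTime ℓ m p.2) * fderiv ℝ (u i) p (0, 1) +
      coTime ℓ m p.2 * fderiv ℝ (fun q => fderiv ℝ (u i) q (0, 1)) p v +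
      (v.2 * ((-3 * ℓ / 2 - I * m) / p.2 * coSpace ℓ m p.2) *
        pauliDot (fun k j => fderiv ℝ (w j) p (basisVec k, 0)) i +
      coSpace ℓ m p.2 *
        pauliDot (fun k j => fderiv ℝ (fun q => fderiv ℝ (w j) q (basisVec k, 0)) p v) i) := by
  have hdu := differentiableAt_fderiv_apply (hu i) hp (0, 1)
  have hdw : ∀ (k : Fin 3) (j : Fin 2),
      DifferentiableAt ℝ (fun q => fderiv ℝ (w j) q (basisVec k, 0)) p := fun k j =>
    differentiableAt_fderiv_apply (hw j) hp _
  have h1 := differentiableAt_time_mul (hasDerivAt_coTime ℓ m hp) hdu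
  have h2 := differentiableAt_time_mul (hasDerivAt_coSpace ℓ m hp) (differentiableAt_pauliDot hdw i)
  have h3 : fderiv ℝ (coUpper ℓ m u w i) p = _ := (h1.hasFDerivAt.add h2.hasFDerivAt).fderiv
  rw [h3, _root_.add_apply, fderiv_time_mul (hasDerivAt_coTime ℓ m hp) hdu,
    fderiv_time_mul (hasDerivAt_coSpace ℓ m hp) (differentiableAt_pauliDot hdw i),
    fderiv_pauliDot hdw]

/-- The spatial term carries a minus sign because the lower components of `𝒟^{co} Φ` are `-coUpper ℓ
(-m) w u`. The multiples of `σ·∂ w` cancel: `-3ℓ/2 - im`, from differentiating `coSpace`, meets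
`3ℓ/2` from the expansion term and `im` from the mass term. What remains is `i coTime` times the
scalar wave operator on `u i`. -/
theorem diracUpper_coUpper (m : ℂ) (hu : ∀ i, ContDiffOn ℝ ∞ (u i) posTime)
    (hw : ∀ i, ContDiffOn ℝ ∞ (w i) posTime) {i : Fin 2} {p : E3 × ℝ} (hp : p ∈ posTime) {f : ℂ}
    (h : fderiv ℝ (fun q => fderiv ℝ (u i) q (0, 1)) p (0, 1) =
      ((p.2 ^ (-ℓ) : ℝ) : ℂ) ^ 2 * (∑ k, fderiv ℝ (fun q => fderiv ℝ (u i) q (basisVec k, 0)) p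
        (basisVec k, 0)) - (ℓ + 2 * I * m) / p.2 * fderiv ℝ (u i) p (0, 1) -
        sourceFactor ℓ m p.2 * f) :
    I * fderiv ℝ (coUpper ℓ m u w i) p (0, 1) - I * ((p.2 ^ (-ℓ) : ℝ) : ℂ) *
      pauliDot (fun k j => fderiv ℝ (coUpper ℓ (-m) w u j) p (basisVec k, 0)) i +
      I * (3 * ℓ / (2 * p.2)) * coUpper ℓ m u w i p - m * (p.2 : ℂ)⁻¹ * coUpper ℓ m u w i p =
      f := by
  have h0 : (p.2 : ℂ) ≠ 0 := by exact_mod_cast (show p.2 ≠ 0 from ne_of_gt hp)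
  have hB : pauliDot (fun k j => fderiv ℝ (coUpper ℓ (-m) w u j) p (basisVec k, 0)) i =
      coTime ℓ (-m) p.2 * pauliDot (fun k j =>
        fderiv ℝ (fun q => fderiv ℝ (w j) q (basisVec k, 0)) p (0, 1)) i +
      coSpace ℓ (-m) p.2 * ∑ k, fderiv ℝ (fun q => fderiv ℝ (u i) q (basisVec k, 0)) p
        (basisVec k, 0) := by
    rw [← pauliDot_pauliDot (v := fun l k i => fderiv ℝ (fun q => fderiv ℝ (u i) q (basisVec k, 0)) p
        (basisVec l, 0)) (fun l k => by
          funext i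
          exact fderiv_fderiv_comm (hu i) hp _ _), ← pauliDot_add_mul]
    congr 1
    funext k j
    rw [fderiv_coUpper ℓ (-m) hw hu j hp, fderiv_fderiv_comm (hw j) hp (0, 1)]
    simp
  rw [hB, fderiv_coUpper ℓ m hu hw i hp, h, coSpace_eq ℓ m hp, coSpace_eq ℓ (-m) hp, neg_neg,
    coUpper, coSpace_eq ℓ m hp]
  have hs := coTime_mul_sourceFactor ℓ m hp
  -- From here the derivatives are independent symbols, and of the coefficients only `c` and `s` are
  -- related, by `hs`.
  generalize coTime ℓ m p.2 = c at *
  generalize coTime ℓ (-m) p.2 = d at *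
  generalize sourceFactor ℓ m p.2 = s at *
  generalize ((p.2 ^ (-ℓ) : ℝ) : ℂ) = a at *
  generalize (∑ k, fderiv ℝ (fun q => fderiv ℝ (u i) q (basisVec k, 0)) p (basisVec k, 0)) = L at *
  generalize fderiv ℝ (u i) p (0, 1) = ut at *
  generalize pauliDot (fun k j => fderiv ℝ (w j) p (basisVec k, 0)) i = P at *
  generalize pauliDot (fun k j =>
        fderiv ℝ (fun q => fderiv ℝ (w j) q (basisVec k, 0)) p (0, 1)) i = Q at *
  simp only [ofReal_one, one_mul]
  have hI := I_sq
  field_simp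
  linear_combination (-(2 * p.2 * I * f)) * hs +
    (-2 * p.2 * f - 2 * m * c * ut - 2 * a * m * d * P) * hI

end CoFactor

/-! ### The solution given by the integral transform -/

section Existence

variable {ℓ ε : ℝ} {F : E3 → ℝ → Spinor} {Ψε : E3 → Spinor}

/-- The upper components of the potential. -/
def potentialU (ℓ ε : ℝ) (m : ℂ) (F : E3 → ℝ → Spinor) (Ψε : E3 → Spinor) (i : Fin 2)
    (p : E3 × ℝ) : ℂ :=
  scalarPotential ℓ ε m 1 (fun y b => F y b (Sum.inl i)) (fun y => Ψε y (Sum.inl i)) p.1 p.2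

/-- The lower components of the potential. -/
def potentialL (ℓ ε : ℝ) (m : ℂ) (F : E3 → ℝ → Spinor) (Ψε : E3 → Spinor) (i : Fin 2)
    (p : E3 × ℝ) : ℂ :=
  scalarPotential ℓ ε (-m) (-1) (fun y b => F y b (Sum.inr i)) (fun y => Ψε y (Sum.inr i)) p.1 p.2

theorem potential_inl (hℓ : ℓ ≠ 1) (hε : 0 < ε) (m : ℂ) {p : E3 × ℝ} (hp : p ∈ posTime)
    (i : Fin 2) : potential ℓ ε m F Ψε p.1 p.2 (Sum.inl i) = potentialU ℓ ε m F Ψε i p := by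
  rw [potential, Pi.add_apply, gamma0_mulVec_inl, diagG, diagK1, Sum.elim_inl, Sum.elim_inl,
    opG_eq_duhamel hℓ hε _ _ _ hp, opK1_eq_evol hℓ hε, potentialU, scalarPotential, one_mul]

theorem potential_inr (hℓ : ℓ ≠ 1) (hε : 0 < ε) (m : ℂ) {p : E3 × ℝ} (hp : p ∈ posTime)
    (i : Fin 2) : potential ℓ ε m F Ψε p.1 p.2 (Sum.inr i) = potentialL ℓ ε m F Ψε i p := by
  rw [potential, Pi.add_apply, gamma0_mulVec_inr, diagG, diagK1, Sum.elim_inr, Sum.elim_inr,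
    opG_eq_duhamel hℓ hε _ _ _ hp, opK1_eq_evol hℓ hε, potentialL, scalarPotential, neg_one_mul]

theorem contDiff_component₂ (hF : ContDiff ℝ ∞ fun p : E3 × ℝ => F p.1 p.2) (c : Fin 2 ⊕ Fin 2) :
    ContDiff ℝ ∞ fun p : E3 × ℝ => F p.1 p.2 c :=
  contDiff_pi.1 hF c

theorem contDiffOn_potentialU (hℓ : ℓ ≠ 1) (hε : 0 < ε) (m : ℂ)
    (hF : ContDiff ℝ ∞ fun p : E3 × ℝ => F p.1 p.2) (hΨ : ContDiff ℝ ∞ Ψε) (i : Fin 2) :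
    ContDiffOn ℝ ∞ (potentialU ℓ ε m F Ψε i) posTime :=
  contDiffOn_scalarPotential hℓ hε m 1 (contDiff_component₂ hF _) (contDiff_pi.1 hΨ _)

theorem contDiffOn_potentialL (hℓ : ℓ ≠ 1) (hε : 0 < ε) (m : ℂ)
    (hF : ContDiff ℝ ∞ fun p : E3 × ℝ => F p.1 p.2) (hΨ : ContDiff ℝ ∞ Ψε) (i : Fin 2) :
    ContDiffOn ℝ ∞ (potentialL ℓ ε m F Ψε i) posTime :=
  contDiffOn_scalarPotential hℓ hε (-m) (-1) (contDiff_component₂ hF _) (contDiff_pi.1 hΨ _)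

theorem contDiffOn_potential (hℓ : ℓ ≠ 1) (hε : 0 < ε) (m : ℂ)
    (hF : ContDiff ℝ ∞ fun p : E3 × ℝ => F p.1 p.2) (hΨ : ContDiff ℝ ∞ Ψε) :
    ContDiffOn ℝ ∞ (fun p : E3 × ℝ => potential ℓ ε m F Ψε p.1 p.2) posTime := by
  refine contDiffOn_pi.2 fun c => ?_
  rcases c with i | i
  · exact (contDiffOn_potentialU hℓ hε m hF hΨ i).congr fun p hp => potential_inl hℓ hε m hp i
  · exact (contDiffOn_potentialL hℓ hε m hF hΨ i).congr fun p hp => potential_inr hℓ hε m hp i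

/-- The wave equation with time dependent coefficients for a component of the potential. -/
theorem scalarPotential_wave (hℓ : ℓ ≠ 1) (hε : 0 < ε) (m s : ℂ) {f : E3 → ℝ → ℂ} {φ : E3 → ℂ}
    (hf : ContDiff ℝ ∞ fun p : E3 × ℝ => f p.1 p.2) (hφ : ContDiff ℝ ∞ φ) {p : E3 × ℝ}
    (hp : p ∈ posTime) {G : E3 × ℝ → ℂ}
    (hG : G = fun p => scalarPotential ℓ ε m s f φ p.1 p.2) :
    fderiv ℝ (fun q => fderiv ℝ G q (0, 1)) p (0, 1) =
      ((p.2 ^ (-ℓ) : ℝ) : ℂ) ^ 2 * (∑ k, fderiv ℝ (fun q => fderiv ℝ G q (basisVec k, 0)) p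
        (basisVec k, 0)) - (ℓ + 2 * I * m) / p.2 * fderiv ℝ G p (0, 1) -
        sourceFactor ℓ m p.2 * f p.1 p.2 := by
  have hGs : ContDiffOn ℝ ∞ G posTime := hG ▸ contDiffOn_scalarPotential hℓ hε m s hf hφ
  have htime : ∀ {H : E3 × ℝ → ℂ} {q : E3 × ℝ}, DifferentiableAt ℝ H q →
      HasDerivAt (fun t => H (q.1, t)) (fderiv ℝ H q (0, 1)) q.2 := fun {H q} hH =>
    HasFDerivAt.comp_hasDerivAt (f := fun s => (q.1, s)) q.2 hH.hasFDerivAt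
      ((hasDerivAt_const q.2 q.1).prodMk (hasDerivAt_id q.2))
  have hspace : ∀ {H : E3 × ℝ → ℂ} {q : E3 × ℝ} (k : Fin 3), DifferentiableAt ℝ H q →
      partialX k (fun y => H (y, q.2)) q.1 = fderiv ℝ H q (basisVec k, 0) := fun {H q} k hH => by
    have := HasFDerivAt.comp (f := fun y => (y, q.2)) q.1 (g := H) hH.hasFDerivAt
      (hasFDerivAt_prodMk_left q.1 q.2)
    refine (congrArg (fun L => L (basisVec k)) this.fderiv).trans ?_
    simp
  have hd : ∀ q ∈ posTime, DifferentiableAt ℝ G q := fun q hq =>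
    hGs.differentiableAt_of_isOpen (by simp) isOpen_posTime hq
  have hT : ∀ q ∈ posTime, fderiv ℝ G q (0, 1) = scalarPotentialT ℓ ε m s f φ q.1 q.2 :=
    fun q hq => (htime (hd q hq)).unique (by
      rw [hG]
      exact hasDerivAt_scalarPotential hℓ hε m s hf hφ q.1 hq)
  have h2 := htime (differentiableAt_fderiv_apply hGs hp (0, 1))
  -- The first time derivative is identified on a neighbourhood of `p.2`, so that it can be
  -- differentiated once more.
  have hev : (fun t => fderiv ℝ G (p.1, t) (0, 1)) =ᶠ[nhds p.2]
      scalarPotentialT ℓ ε m s f φ p.1 := by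
    filter_upwards [lt_mem_nhds (show 0 < p.2 from hp)] with t ht
    exact hT (p.1, t) ht
  rw [h2.unique ((hasDerivAt_scalarPotentialT hℓ hε m s hf hφ p.1 hp).congr_of_eventuallyEq hev),
    hT p hp]
  congr 3
  have hslice : (fun y => scalarPotential ℓ ε m s f φ y p.2) = fun y => G (y, p.2) := by rw [hG]
  rw [hslice, laplace3]
  congr 1
  funext k
  have : partialX k (fun y => G (y, p.2)) = fun y => fderiv ℝ G (y, p.2) (basisVec k, 0) := by
    funext y
    exact hspace (q := (y, p.2)) k (hd (y, p.2) hp)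
  rw [this]
  exact hspace k (differentiableAt_fderiv_apply hGs hp _)

theorem fderiv_eq_of_eqOn {G H : E3 × ℝ → ℂ} (h : Set.EqOn H G posTime) {p : E3 × ℝ}
    (hp : p ∈ posTime) : fderiv ℝ H p = fderiv ℝ G p :=
  (h.eventuallyEq_of_mem (isOpen_posTime.mem_nhds hp)).fderiv_eq

/-- The upper components of `𝒟^{co} Φ`. -/
def solU (ℓ ε : ℝ) (m : ℂ) (F : E3 → ℝ → Spinor) (Ψε : E3 → Spinor) : Fin 2 → E3 × ℝ → ℂ :=
  coUpper ℓ m (potentialU ℓ ε m F Ψε) (potentialL ℓ ε m F Ψε)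

/-- The lower components of `𝒟^{co} Φ`, up to sign. -/
def solL (ℓ ε : ℝ) (m : ℂ) (F : E3 → ℝ → Spinor) (Ψε : E3 → Spinor) : Fin 2 → E3 × ℝ → ℂ :=
  coUpper ℓ (-m) (potentialL ℓ ε m F Ψε) (potentialU ℓ ε m F Ψε)

theorem diracCo_potential (hℓ : ℓ ≠ 1) (hε : 0 < ε) (m : ℂ)
    (hF : ContDiff ℝ ∞ fun p : E3 × ℝ => F p.1 p.2) (hΨ : ContDiff ℝ ∞ Ψε) {p : E3 × ℝ}
    (hp : p ∈ posTime) :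
    diracCo ℓ m (potential ℓ ε m F Ψε) p.1 p.2 =
      Sum.elim (fun i => solU ℓ ε m F Ψε i p) (fun i => -solL ℓ ε m F Ψε i p) := by
  have hU : ∀ i, Set.EqOn (fun q : E3 × ℝ => potential ℓ ε m F Ψε q.1 q.2 (Sum.inl i))
    (potentialU ℓ ε m F Ψε i) posTime := fun i q hq => potential_inl hℓ hε m hq i
  have hL : ∀ i, Set.EqOn (fun q : E3 × ℝ => potential ℓ ε m F Ψε q.1 q.2 (Sum.inr i))
    (potentialL ℓ ε m F Ψε i) posTime := fun i q hq => potential_inr hℓ hε m hq i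
  have hd : ∀ c, DifferentiableAt ℝ (fun q : E3 × ℝ => potential ℓ ε m F Ψε q.1 q.2 c) (p.1, p.2) :=
    fun c => (contDiffOn_pi.1 (contDiffOn_potential hℓ hε m hF hΨ) c).differentiableAt_of_isOpen
      (by simp) isOpen_posTime hp
  funext c
  rcases c with i | i
  · simp only [diracCo_inl, dT_apply hd, dX_apply hd, Sum.elim_inl, solU, coUpper, Prod.mk.eta,
      fderiv_eq_of_eqOn (hU _) hp, fderiv_eq_of_eqOn (hL _) hp]
    rfl
  · simp only [diracCo_inr, dT_apply hd, dX_apply hd, Sum.elim_inr, solL, coUpper, Prod.mk.eta,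
      fderiv_eq_of_eqOn (hU _) hp, fderiv_eq_of_eqOn (hL _) hp, coTime, coSpace, mul_neg, neg_neg]

theorem contDiffOn_diracCo_potential (hℓ : ℓ ≠ 1) (hε : 0 < ε) (m : ℂ)
    (hF : ContDiff ℝ ∞ fun p : E3 × ℝ => F p.1 p.2) (hΨ : ContDiff ℝ ∞ Ψε) :
    ContDiffOn ℝ ∞ (fun p : E3 × ℝ => diracCo ℓ m (potential ℓ ε m F Ψε) p.1 p.2) posTime := by
  have hu := contDiffOn_potentialU hℓ hε m hF hΨ
  have hl := contDiffOn_potentialL hℓ hε m hF hΨ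
  refine contDiffOn_pi.2 fun c => ?_
  rcases c with i | i
  · exact (contDiffOn_coUpper ℓ m hu hl i).congr fun p hp => by
      rw [diracCo_potential hℓ hε m hF hΨ hp]
      rfl
  · exact (contDiffOn_coUpper ℓ (-m) hl hu i).neg.congr fun p hp => by
      rw [diracCo_potential hℓ hε m hF hΨ hp]
      rfl

theorem deriv_scaleFactor_div {t : ℝ} (ht : 0 < t) :
    3 * deriv (scaleFactor ℓ) t / (2 * scaleFactor ℓ t) = 3 * ℓ / (2 * t) := by
  have h : deriv (scaleFactor ℓ) t = ℓ * t ^ (ℓ - 1) :=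
    (Real.hasDerivAt_rpow_const (p := ℓ) (Or.inl ht.ne')).deriv
  have h0 := (Real.rpow_pos_of_pos ht ℓ).ne'
  rw [h, Real.rpow_sub_one ht.ne', scaleFactor]
  field_simp

theorem one_div_scaleFactor {t : ℝ} (ht : 0 < t) : 1 / scaleFactor ℓ t = t ^ (-ℓ) := by
  rw [scaleFactor, Real.rpow_neg ht.le, one_div]

theorem diracOp_diracCo_potential (hℓ : ℓ ≠ 1) (hε : 0 < ε) (m : ℂ)
    (hF : ContDiff ℝ ∞ fun p : E3 × ℝ => F p.1 p.2) (hΨ : ContDiff ℝ ∞ Ψε) (x : E3) {t : ℝ}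
    (ht : 0 < t) :
    diracOp ℓ m (diracCo ℓ m (potential ℓ ε m F Ψε)) x t = F x t := by
  have hu := contDiffOn_potentialU hℓ hε m hF hΨ
  have hl := contDiffOn_potentialL hℓ hε m hF hΨ
  set Ψ := diracCo ℓ m (potential ℓ ε m F Ψε) with hΨdef
  have hp : (x, t) ∈ posTime := ht
  have hd : ∀ c, DifferentiableAt ℝ (fun q : E3 × ℝ => Ψ q.1 q.2 c) (x, t) :=
    fun c => (contDiffOn_pi.1 (contDiffOn_diracCo_potential hℓ hε m hF hΨ) c
      ).differentiableAt_of_isOpen (by simp) isOpen_posTime hp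
  have hU : ∀ i, Set.EqOn (fun q : E3 × ℝ => Ψ q.1 q.2 (Sum.inl i)) (solU ℓ ε m F Ψε i) posTime :=
    fun i q hq => congrFun (diracCo_potential hℓ hε m hF hΨ hq) (Sum.inl i)
  have hL : ∀ i, Set.EqOn (fun q : E3 × ℝ => Ψ q.1 q.2 (Sum.inr i))
      (fun q => -solL ℓ ε m F Ψε i q) posTime :=
    fun i q hq => congrFun (diracCo_potential hℓ hε m hF hΨ hq) (Sum.inr i)
  have hneg : ∀ (v : Fin 3 → Fin 2 → ℂ) i, pauliDot (fun k j => -v k j) i = -pauliDot v i := by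
    intro v i
    simp only [pauliDot, mul_neg, Finset.sum_neg_distrib]
  funext c
  rcases c with i | i
  · have h := diracUpper_coUpper m hu hl hp
      (scalarPotential_wave hℓ hε m 1 (contDiff_component₂ hF (Sum.inl i))
        (contDiff_pi.1 hΨ (Sum.inl i)) hp rfl)
    have h1 := hU i hp
    simp only at h1
    rw [diracOp_inl, h1, deriv_scaleFactor_div ht, one_div_scaleFactor ht, ← h]
    simp only [dT_apply hd, dX_apply hd, fderiv_eq_of_eqOn (hU _) hp, fderiv_eq_of_eqOn (hL _) hp,
      fderiv_fun_neg, _root_.neg_apply, hneg, solU, solL]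
    push_cast
    ring
  · have h := diracUpper_coUpper (-m) hl hu hp
      (scalarPotential_wave hℓ hε (-m) (-1) (contDiff_component₂ hF (Sum.inr i))
        (contDiff_pi.1 hΨ (Sum.inr i)) hp rfl)
    have h1 := hL i hp
    simp only at h1
    rw [diracOp_inr, h1, deriv_scaleFactor_div ht, one_div_scaleFactor ht, ← h]
    simp only [dT_apply hd, dX_apply hd, fderiv_eq_of_eqOn (hU _) hp, fderiv_eq_of_eqOn (hL _) hp,
      fderiv_fun_neg, _root_.neg_apply, solU, solL, neg_neg]
    push_cast
    ring

/-- At `t = ε` the potential vanishes for every `x`, so the spatial part of the co-factor drops out,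
and `coTime · (-i sourceFactor) = -i² = 1`. The derivatives at `ε` are two-sided, as the potential
is smooth for all positive times. -/
theorem coUpper_initial (hℓ : ℓ ≠ 1) (hε : 0 < ε) (m s s' m' : ℂ) {f : Fin 2 → E3 → ℝ → ℂ}
    {φ : Fin 2 → E3 → ℂ} (hf : ∀ i, ContDiff ℝ ∞ fun p : E3 × ℝ => f i p.1 p.2)
    (hφ : ∀ i, ContDiff ℝ ∞ (φ i)) {f' : Fin 2 → E3 → ℝ → ℂ} {φ' : Fin 2 → E3 → ℂ}
    (hf' : ∀ i, ContDiff ℝ ∞ fun p : E3 × ℝ => f' i p.1 p.2) (hφ' : ∀ i, ContDiff ℝ ∞ (φ' i))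
    (i : Fin 2) (x : E3) :
    coUpper ℓ m (fun i p => scalarPotential ℓ ε m s (f i) (φ i) p.1 p.2)
      (fun i p => scalarPotential ℓ ε m' s' (f' i) (φ' i) p.1 p.2) i (x, ε) = s * φ i x := by
  have hp : (x, ε) ∈ posTime := hε
  have hd := (contDiffOn_scalarPotential hℓ hε m s (hf i) (hφ i)).differentiableAt_of_isOpen
    (by simp) isOpen_posTime hp
  have hd' := fun j => (contDiffOn_scalarPotential hℓ hε m' s' (hf' j) (hφ' j)
    ).differentiableAt_of_isOpen (by simp) isOpen_posTime hp
  have h1 : fderiv ℝ (fun p : E3 × ℝ => scalarPotential ℓ ε m s (f i) (φ i) p.1 p.2) (x, ε) (0, 1)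
      = scalarPotentialT ℓ ε m s (f i) (φ i) x ε :=
    (HasFDerivAt.comp_hasDerivAt (f := fun s => (x, s)) ε hd.hasFDerivAt
      ((hasDerivAt_const ε x).prodMk (hasDerivAt_id ε))).unique
      (hasDerivAt_scalarPotential hℓ hε m s (hf i) (hφ i) x hε)
  have h2 : ∀ k j, fderiv ℝ (fun p : E3 × ℝ => scalarPotential ℓ ε m' s' (f' j) (φ' j) p.1 p.2)
      (x, ε) (basisVec k, 0) = 0 := by
    intro k j
    have h3 := HasFDerivAt.comp (f := fun y => (y, ε)) x (hd' j).hasFDerivAt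
      (hasFDerivAt_prodMk_left x ε)
    have h4 : (fun p : E3 × ℝ => scalarPotential ℓ ε m' s' (f' j) (φ' j) p.1 p.2) ∘
        (fun y => (y, ε)) = fun _ => (0 : ℂ) := by
      funext y
      exact scalarPotential_initial m' s' y
    rw [h4] at h3
    have := congrArg (fun L => L (basisVec k)) (h3.unique (hasFDerivAt_const 0 x))
    simpa using this
  have h5 : pauliDot (fun _ _ => 0) i = 0 := by simp [pauliDot]
  simp only [coUpper, h1, h2, h5, scalarPotentialT_initial hℓ hε]
  linear_combination (-(I * s * φ i x)) * coTime_mul_sourceFactor ℓ m hε - s * φ i x * I_sq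

theorem diracCo_potential_initial (hℓ : ℓ ≠ 1) (hε : 0 < ε) (m : ℂ)
    (hF : ContDiff ℝ ∞ fun p : E3 × ℝ => F p.1 p.2) (hΨ : ContDiff ℝ ∞ Ψε) (x : E3) :
    diracCo ℓ m (potential ℓ ε m F Ψε) x ε = Ψε x := by
  have hp : (x, ε) ∈ posTime := hε
  have h := diracCo_potential hℓ hε m hF hΨ hp
  simp only at h
  rw [h]
  funext c
  have h1 := fun c => contDiff_component₂ hF c
  have h2 := fun c => contDiff_pi.1 hΨ c
  rcases c with i | i
  · have h3 := coUpper_initial (f := fun i y b => F y b (Sum.inl i))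
      (φ := fun i y => Ψε y (Sum.inl i)) (f' := fun i y b => F y b (Sum.inr i))
      (φ' := fun i y => Ψε y (Sum.inr i)) hℓ hε m 1 (-1) (-m) (fun i => h1 (Sum.inl i))
      (fun i => h2 (Sum.inl i)) (fun i => h1 (Sum.inr i)) (fun i => h2 (Sum.inr i)) i x
    rw [one_mul] at h3
    exact h3
  · have h3 := coUpper_initial (f := fun i y b => F y b (Sum.inr i))
      (φ := fun i y => Ψε y (Sum.inr i)) (f' := fun i y b => F y b (Sum.inl i))
      (φ' := fun i y => Ψε y (Sum.inl i)) hℓ hε (-m) (-1) 1 m (fun i => h1 (Sum.inr i))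
      (fun i => h2 (Sum.inr i)) (fun i => h1 (Sum.inl i)) (fun i => h2 (Sum.inl i)) i x
    rw [neg_one_mul] at h3
    exact (congrArg Neg.neg h3).trans (neg_neg _)

theorem isCauchySolution_diracCo_potential (hℓ : ℓ ≠ 1) (hε : 0 < ε) (m : ℂ)
    (hF : ContDiff ℝ ∞ fun p : E3 × ℝ => F p.1 p.2) (hΨ : ContDiff ℝ ∞ Ψε) :
    IsCauchySolution ℓ m ε F Ψε (diracCo ℓ m (potential ℓ ε m F Ψε)) where
  continuousOn := (contDiffOn_diracCo_potential hℓ hε m hF hΨ).continuousOn.mono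
    fun _ hp => hε.trans_le hp
  contDiffOn := ((contDiffOn_diracCo_potential hℓ hε m hF hΨ).mono
    fun _ hp => hε.trans hp).of_le (by simp)
  equation x t ht := diracOp_diracCo_potential hℓ hε m hF hΨ x (hε.trans ht)
  initial x := diracCo_potential_initial hℓ hε m hF hΨ x

end Existence

/-! ### Energy estimates for conservation laws -/

section Energy

variable {ε : ℝ}

/-- The set of times after `ε`. -/
def afterTime (ε : ℝ) : Set (E3 × ℝ) := {p | ε < p.2}

theorem isOpen_afterTime (ε : ℝ) : IsOpen (afterTime ε) :=
  isOpen_lt continuous_const continuous_snd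

/-! ### Time slices of functions with bounded spatial support. -/

section SpatialSupport

variable {g : E3 × ℝ → ℝ} {R : ℝ}

theorem fderiv_eq_zero_of_norm_gt (hR : ∀ p ∈ afterTime ε, R ≤ ‖p.1‖ → g p = 0) {p : E3 × ℝ}
    (hp : p ∈ afterTime ε) (h : R < ‖p.1‖) : fderiv ℝ g p = 0 := by
  have hev : g =ᶠ[nhds p] fun _ => 0 := by
    filter_upwards [(isOpen_afterTime ε).mem_nhds hp,
      (isOpen_lt continuous_const continuous_fst.norm).mem_nhds h] with q hq hq'
    exact hR q hq (le_of_lt hq')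
  rw [hev.fderiv_eq]
  simp

theorem continuous_slice_afterTime {G : Type*} [TopologicalSpace G] {g : E3 × ℝ → G}
    (hg : ContinuousOn g (afterTime ε)) {t : ℝ} (ht : ε < t) : Continuous fun x : E3 => g (x, t) :=
  hg.comp_continuous (by fun_prop) fun _ => ht

theorem continuous_fderiv_slice (hg : ContDiffOn ℝ 1 g (afterTime ε)) {t : ℝ} (ht : ε < t)
    (v : E3 × ℝ) : Continuous fun x : E3 => fderiv ℝ g (x, t) v :=
  (continuous_slice_afterTime (hg.continuousOn_fderiv_of_isOpen (isOpen_afterTime ε) le_rfl)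
    ht).clm_apply continuous_const

theorem hasCompactSupport_slice (hR : ∀ p ∈ afterTime ε, R ≤ ‖p.1‖ → g p = 0) {t : ℝ}
    (ht : ε < t) : HasCompactSupport fun x : E3 => g (x, t) :=
  HasCompactSupport.intro (isCompact_closedBall (0 : E3) R) fun x hx => hR (x, t) ht (by
    simpa using (le_of_not_ge (by simpa using hx)))

theorem hasCompactSupport_fderiv_slice (hR : ∀ p ∈ afterTime ε, R ≤ ‖p.1‖ → g p = 0) {t : ℝ}
    (ht : ε < t) (v : E3 × ℝ) : HasCompactSupport fun x : E3 => fderiv ℝ g (x, t) v :=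
  HasCompactSupport.intro (isCompact_closedBall (0 : E3) R) fun x hx => by
    rw [fderiv_eq_zero_of_norm_gt hR (p := (x, t)) ht (by simpa using hx), _root_.zero_apply]

theorem integrable_fderiv_slice (hg : ContDiffOn ℝ 1 g (afterTime ε))
    (hR : ∀ p ∈ afterTime ε, R ≤ ‖p.1‖ → g p = 0) {t : ℝ} (ht : ε < t) (v : E3 × ℝ) :
    Integrable fun x : E3 => fderiv ℝ g (x, t) v :=
  (continuous_fderiv_slice hg ht v).integrable_of_hasCompactSupport
    (hasCompactSupport_fderiv_slice hR ht v)

theorem integrable_slice (hg : ContDiffOn ℝ 1 g (afterTime ε))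
    (hR : ∀ p ∈ afterTime ε, R ≤ ‖p.1‖ → g p = 0) {t : ℝ} (ht : ε < t) :
    Integrable fun x : E3 => g (x, t) :=
  (continuous_slice_afterTime hg.continuousOn ht).integrable_of_hasCompactSupport
    (hasCompactSupport_slice hR ht)

/-- Integration by parts against the constant function `1`. -/
theorem integral_fderiv_slice_eq_zero (hg : ContDiffOn ℝ 1 g (afterTime ε))
    (hR : ∀ p ∈ afterTime ε, R ≤ ‖p.1‖ → g p = 0) {t : ℝ} (ht : ε < t) (v : E3) :
    ∫ x : E3, fderiv ℝ g (x, t) (v, 0) = 0 := by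
  have hd : ∀ x : E3, HasFDerivAt (fun y => g (y, t))
      ((fderiv ℝ g (x, t)).comp (ContinuousLinearMap.inl ℝ E3 ℝ)) x := fun x =>
    HasFDerivAt.comp (f := fun y => (y, t)) x (g := g) (hg.differentiableAt_of_isOpen one_ne_zero
      (isOpen_afterTime ε) (show (x, t) ∈ afterTime ε from ht)).hasFDerivAt
      (hasFDerivAt_prodMk_left x t)
  have hv : ∀ x : E3, fderiv ℝ (fun y => g (y, t)) x v = fderiv ℝ g (x, t) (v, 0) := fun x => by
    rw [(hd x).fderiv]
    simp
  have h := integral_mul_fderiv_eq_neg_fderiv_mul_of_integrable (μ := (volume : Measure E3))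
    (f := fun _ => (1 : ℝ)) (g := fun y => g (y, t)) (v := v) (by simp)
    (by simpa [hv] using integrable_fderiv_slice hg hR ht (v, 0))
    (by simpa using integrable_slice hg hR ht) (fun x _ => by fun_prop)
    (fun x _ => (hd x).differentiableAt)
  simpa [hv] using h

theorem isFiniteMeasure_comap_closedBall (R : ℝ) : IsFiniteMeasure
    ((volume : Measure E3).comap (Subtype.val : Metric.closedBall (0 : E3) R → E3)) := by
  refine ⟨?_⟩
  rw [(MeasurableEmbedding.subtype_coe Metric.isClosed_closedBall.measurableSet).comap_apply,
    Set.image_univ, Subtype.range_coe]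
  exact (isCompact_closedBall _ _).measure_lt_top

theorem integral_eq_integral_closedBall {h : E3 → ℝ} (hh : ∀ x, R < ‖x‖ → h x = 0) :
    ∫ x, h x = ∫ k : Metric.closedBall (0 : E3) R, h k ∂(volume.comap Subtype.val) := by
  rw [integral_subtype_comap Metric.isClosed_closedBall.measurableSet,
    setIntegral_eq_integral_of_forall_compl_eq_zero]
  intro x hx
  exact hh x (by simpa using hx)

/-- All slices live in one closed ball, so this is a parametric integral over a compact space. -/
theorem hasDerivAt_integral_slice (hg : ContDiffOn ℝ 1 g (afterTime ε))
    (hR : ∀ p ∈ afterTime ε, R ≤ ‖p.1‖ → g p = 0) {t : ℝ} (ht : ε < t) :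
    HasDerivAt (fun s => ∫ x : E3, g (x, s)) (∫ x : E3, fderiv ℝ g (x, t) (0, 1)) t := by
  have := isFiniteMeasure_comap_closedBall R
  have : CompactSpace (Metric.closedBall (0 : E3) R) :=
    isCompact_iff_compactSpace.1 (isCompact_closedBall _ _)
  set Ω : Set (ℝ × E3) := {q | ε < q.1}
  have hΩ : IsOpen Ω := isOpen_lt continuous_const continuous_fst
  have hsw : ContDiffOn ℝ 1 (fun q : ℝ × E3 => g (q.2, q.1)) Ω :=
    hg.comp (f := fun q : ℝ × E3 => (q.2, q.1)) (by fun_prop) fun q hq => hq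
  have hκ : Continuous (Subtype.val : Metric.closedBall (0 : E3) R → E3) := continuous_subtype_val
  have h1 := hasFDerivAt_integral_of_compact
    (μ := (volume : Measure E3).comap (Subtype.val : Metric.closedBall (0 : E3) R → E3))
    hκ hΩ hsw (p := t) fun k => ht
  have h2 := fderiv_integral_of_compact_apply
    (μ := (volume : Measure E3).comap (Subtype.val : Metric.closedBall (0 : E3) R → E3))
    hκ hΩ hsw (p := t) (fun k => ht) 1
  have h3 : ∀ x : E3, fderiv ℝ (fun q : ℝ × E3 => g (q.2, q.1)) (t, x) (1, 0) =
      fderiv ℝ g (x, t) (0, 1) := fun x => by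
    have hd : DifferentiableAt ℝ g (x, t) := hg.differentiableAt_of_isOpen one_ne_zero
      (isOpen_afterTime ε) ht
    have := HasFDerivAt.comp (f := fun q : ℝ × E3 => (q.2, q.1)) (t, x) (g := g) hd.hasFDerivAt
      (hasFDerivAt_snd.prodMk hasFDerivAt_fst)
    refine (congrArg (fun L => L (1, 0)) this.fderiv).trans ?_
    simp
  have h4 := h1.differentiableAt.hasDerivAt
  rw [← fderiv_apply_one_eq_deriv, h2] at h4
  simp only [h3] at h4
  rw [integral_eq_integral_closedBall (h := fun x => fderiv ℝ g (x, t) (0, 1)) fun x hx => by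
    rw [fderiv_eq_zero_of_norm_gt hR (p := (x, t)) ht hx, _root_.zero_apply]]
  refine h4.congr_of_eventuallyEq ?_
  filter_upwards [lt_mem_nhds ht] with s hs
  exact integral_eq_integral_closedBall (h := fun x => g (x, s)) fun x hx => hR (x, s) hs hx.le

end SpatialSupport

/-! ### The cut-off function -/

/-- `√(1 + |x|²)`. -/
def japanese (x : E3) : ℝ := √(1 + ‖x‖ ^ 2)

theorem norm_le_japanese (x : E3) : ‖x‖ ≤ japanese x :=
  Real.le_sqrt_of_sq_le (by linarith)

theorem hasFDerivAt_japanese (x : E3) :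
    HasFDerivAt japanese ((1 / japanese x) • (innerSL ℝ x)) x := by
  have h1 := ((hasFDerivAt_id x).norm_sq.const_add 1).sqrt (by positivity)
  refine h1.congr_fderiv ?_
  ext v
  simp [japanese]
  ring

theorem contDiff_japanese : ContDiff ℝ ∞ japanese :=
  (contDiff_const.add (contDiff_norm_sq ℝ)).sqrt fun x => by positivity

/-- A weight supported in a backward cone with a smoothed tip. -/
def coneWeight (ℓ ε R : ℝ) (p : E3 × ℝ) : ℝ :=
  expNegInvGlue (R + 3 * (phi ℓ ε - phi ℓ p.2) - japanese p.1)

theorem contDiffOn_coneWeight (ℓ ε R : ℝ) : ContDiffOn ℝ ∞ (coneWeight ℓ ε R) posTime := by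
  have h1 : ContDiffOn ℝ ∞ (fun p : E3 × ℝ => phi ℓ p.2) posTime :=
    (contDiffOn_phi ℓ).comp contDiff_snd.contDiffOn fun p hp => hp
  exact expNegInvGlue.contDiff.comp_contDiffOn (((contDiffOn_const.add (contDiffOn_const.mul
    (contDiffOn_const.sub h1)))).sub (contDiff_japanese.comp contDiff_fst).contDiffOn)

variable {ℓ : ℝ}

theorem fderiv_coneWeight (hℓ : ℓ ≠ 1) (R : ℝ) {p : E3 × ℝ} (hp : 0 < p.2) (v : E3 × ℝ) :
    fderiv ℝ (coneWeight ℓ ε R) p v =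
      deriv expNegInvGlue (R + 3 * (phi ℓ ε - phi ℓ p.2) - japanese p.1) *
        (-3 * p.2 ^ (-ℓ) * v.2 - inner ℝ p.1 v.1 / japanese p.1) := by
  have h1 : HasFDerivAt (fun p : E3 × ℝ => phi ℓ p.2) _ p :=
    (hasDerivAt_phi hℓ hp).hasFDerivAt.comp p hasFDerivAt_snd
  have h2 : HasFDerivAt (fun p : E3 × ℝ => japanese p.1) _ p :=
    (hasFDerivAt_japanese p.1).comp p hasFDerivAt_fst
  have h3 := (((h1.const_sub (phi ℓ ε)).const_mul 3).const_add R).sub h2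
  have h4 : HasDerivAt expNegInvGlue _ (R + 3 * (phi ℓ ε - phi ℓ p.2) - japanese p.1) :=
    ((expNegInvGlue.contDiff (n := 1)).differentiable (by simp) _).hasDerivAt
  have h5 := h4.hasFDerivAt.comp p h3
  refine (congrArg (fun L => L v) h5.fderiv).trans ?_
  simp
  ring

theorem phi_mono (hℓ : ℓ ≠ 1) (hε : 0 < ε) {t : ℝ} (ht : ε ≤ t) : phi ℓ ε ≤ phi ℓ t := by
  have hm : MonotoneOn (phi ℓ) (Set.Ioi 0) := by
    refine monotoneOn_of_deriv_nonneg (convex_Ioi 0) (contDiffOn_phi ℓ).continuousOn ?_ ?_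
    · rw [interior_Ioi]
      exact (contDiffOn_phi ℓ).differentiableOn (by simp)
    · rw [interior_Ioi]
      intro x hx
      rw [(hasDerivAt_phi hℓ hx).deriv]
      exact Real.rpow_nonneg (le_of_lt hx) _
  exact hm hε (hε.trans_le ht) ht

/-- `φ` is increasing, so the support of the weight shrinks with time and never leaves the initial
ball. -/
theorem coneWeight_eq_zero (hℓ : ℓ ≠ 1) (hε : 0 < ε) {R : ℝ} {p : E3 × ℝ} (hp : ε ≤ p.2)
    (hR : R ≤ ‖p.1‖) : coneWeight ℓ ε R p = 0 := by
  refine expNegInvGlue.zero_of_nonpos ?_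
  have h1 := phi_mono hℓ hε hp
  have h2 := norm_le_japanese p.1
  linarith

/-- A density `ρ` with vanishing initial values vanishes if, with fluxes bounded by `ρ`, its
production is bounded by a multiple of `ρ`. -/
theorem eq_zero_of_local_conservation (hℓ : ℓ ≠ 1) (hε : 0 < ε) {ρ : E3 × ℝ → ℝ}
    {J : Fin 3 → E3 × ℝ → ℝ} {K : ℝ} (hρc : ContinuousOn ρ {p | ε ≤ p.2})
    (hρ : ContDiffOn ℝ 1 ρ (afterTime ε)) (hJ : ∀ k, ContDiffOn ℝ 1 (J k) (afterTime ε))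
    (hρ0 : ∀ p, 0 ≤ ρ p) (hJρ : ∀ k, ∀ p ∈ afterTime ε, |J k p| ≤ ρ p)
    (hinit : ∀ x, ρ (x, ε) = 0)
    (hcons : ∀ p ∈ afterTime ε, fderiv ℝ ρ p (0, 1) +
      p.2 ^ (-ℓ) * ∑ k, fderiv ℝ (J k) p (basisVec k, 0) ≤ K * ρ p)
    (x : E3) {T : ℝ} (hT : ε < T) : ρ (x, T) = 0 := by
  -- With this `R` the argument of the weight at `(x, T)` equals `1`, so the weight is positive
  -- there.
  set R : ℝ := 1 + 3 * (phi ℓ T - phi ℓ ε) + japanese x with hRdef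
  set χ := coneWeight ℓ ε R with hχ
  have hsub : afterTime ε ⊆ posTime := fun p hp => hε.trans hp
  have hχd : ContDiffOn ℝ 1 χ (afterTime ε) :=
    ((contDiffOn_coneWeight ℓ ε R).mono hsub).of_le (by simp)
  have hχ0 : ∀ p, 0 ≤ χ p := fun p => expNegInvGlue.nonneg _
  have hχR : ∀ p ∈ afterTime ε, R ≤ ‖p.1‖ → χ p = 0 := fun p hp h =>
    coneWeight_eq_zero hℓ hε (le_of_lt hp) h
  have hgd : ContDiffOn ℝ 1 (fun p => χ p * ρ p) (afterTime ε) := hχd.mul hρ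
  have hgJ : ∀ k, ContDiffOn ℝ 1 (fun p => χ p * J k p) (afterTime ε) := fun k => hχd.mul (hJ k)
  have hgR : ∀ p ∈ afterTime ε, R ≤ ‖p.1‖ → χ p * ρ p = 0 := fun p hp h => by
    rw [hχR p hp h, zero_mul]
  have hJR : ∀ k, ∀ p ∈ afterTime ε, R ≤ ‖p.1‖ → χ p * J k p = 0 := fun k p hp h => by
    rw [hχR p hp h, zero_mul]
  have hpt : ∀ p ∈ afterTime ε, fderiv ℝ (fun p => χ p * ρ p) p (0, 1) +
      p.2 ^ (-ℓ) * ∑ k, fderiv ℝ (fun p => χ p * J k p) p (basisVec k, 0) ≤ K * (χ p * ρ p) := by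
    intro p hp
    have hp0 : 0 < p.2 := hε.trans hp
    have hd := fun {g : E3 × ℝ → ℝ} (hg : ContDiffOn ℝ 1 g (afterTime ε)) =>
      hg.differentiableAt_of_isOpen one_ne_zero (isOpen_afterTime ε) hp
    have hmul : ∀ {g : E3 × ℝ → ℝ}, ContDiffOn ℝ 1 g (afterTime ε) → ∀ v,
        fderiv ℝ (fun p => χ p * g p) p v = χ p * fderiv ℝ g p v + fderiv ℝ χ p v * g p := by
      intro g hg v
      rw [((hd hχd).hasFDerivAt.fun_mul (hd hg).hasFDerivAt).fderiv]
      simp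
      ring
    have ha : 0 < p.2 ^ (-ℓ) := Real.rpow_pos_of_pos hp0 _
    have hη := expNegInvGlue.monotone.deriv_nonneg
      (x := R + 3 * (phi ℓ ε - phi ℓ p.2) - japanese p.1)
    -- The weight decreases in time at rate `3 t^{-ℓ}` per unit of `d`, against three fluxes of size
    -- at most `t^{-ℓ} ρ`, since the partial derivatives of `√(1 + |x|²)` are at most `1`. The sharp
    -- speed is not needed, because `R` is free.
    have hcone : fderiv ℝ χ p (0, 1) * ρ p +
        p.2 ^ (-ℓ) * ∑ k, fderiv ℝ χ p (basisVec k, 0) * J k p ≤ 0 := by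
      simp only [hχ, fderiv_coneWeight hℓ R hp0]
      set d := deriv expNegInvGlue (R + 3 * (phi ℓ ε - phi ℓ p.2) - japanese p.1)
      have hk : ∀ k, -(inner ℝ p.1 (basisVec k) / japanese p.1) * J k p ≤ ρ p := by
        intro k
        have hj : 0 < japanese p.1 := Real.sqrt_pos.2 (by positivity)
        have h1 : |inner ℝ p.1 (basisVec k) / japanese p.1| ≤ 1 := by
          rw [abs_div, abs_of_pos hj, div_le_one hj]
          refine (abs_real_inner_le_norm _ _).trans ?_
          simpa [basisVec] using norm_le_japanese p.1
        calc _ ≤ |(-(inner ℝ p.1 (basisVec k) / japanese p.1)) * J k p| := le_abs_self _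
          _ = |inner ℝ p.1 (basisVec k) / japanese p.1| * |J k p| := by rw [abs_mul, abs_neg]
          _ ≤ 1 * ρ p := mul_le_mul h1 (hJρ k p hp) (abs_nonneg _) zero_le_one
          _ = ρ p := one_mul _
      have hsum : ∑ k, -(inner ℝ p.1 (basisVec k) / japanese p.1) * J k p ≤ 3 * ρ p := by
        refine (Finset.sum_le_sum fun k _ => hk k).trans ?_
        simp
      calc _ = d * p.2 ^ (-ℓ) * ((∑ k, -(inner ℝ p.1 (basisVec k) / japanese p.1) * J k p)
            - 3 * ρ p) := by
            simp only [Fin.sum_univ_three, inner_zero_right]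
            ring
        _ ≤ 0 := mul_nonpos_of_nonneg_of_nonpos (mul_nonneg hη ha.le) (by linarith)
    rw [hmul hρ]
    simp only [hmul (hJ _), Finset.sum_add_distrib, ← Finset.mul_sum]
    have h := mul_le_mul_of_nonneg_left (hcons p hp) (hχ0 p)
    nlinarith [h, hcone]
  set E : ℝ → ℝ := fun t => ∫ y : E3, χ (y, t) * ρ (y, t) with hE
  have hE' : ∀ t, ε < t → deriv E t ≤ K * E t := by
    intro t ht
    -- The divergence terms integrate to zero, so adding them does not change the derivative of the
    -- energy.
    have h0 : ∫ y : E3, (fderiv ℝ (fun p => χ p * ρ p) (y, t) (0, 1) +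
        t ^ (-ℓ) * ∑ k, fderiv ℝ (fun p => χ p * J k p) (y, t) (basisVec k, 0)) = deriv E t := by
      have hi := fun k => integrable_fderiv_slice (hgJ k) (hJR k) ht (basisVec k, 0)
      rw [integral_add (integrable_fderiv_slice hgd hgR ht _)
        ((integrable_finsetSum _ fun k _ => hi k).const_mul _), integral_const_mul,
        integral_finsetSum _ fun k _ => hi k]
      simp only [integral_fderiv_slice_eq_zero (hgJ _) (hJR _) ht, Finset.sum_const_zero, mul_zero,
        add_zero]
      exact (hasDerivAt_integral_slice hgd hgR ht).deriv.symm
    rw [← h0, hE]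
    simp only
    rw [← integral_const_mul]
    refine integral_mono ?_ ((integrable_slice hgd hgR ht).const_mul K) fun y => hpt (y, t) ht
    exact (integrable_fderiv_slice hgd hgR ht _).add ((integrable_finsetSum _ fun k _ =>
      integrable_fderiv_slice (hgJ k) (hJR k) ht _).const_mul _)
  have hEd : ∀ t, ε < t → DifferentiableAt ℝ E t := fun t ht =>
    (hasDerivAt_integral_slice hgd hgR ht).differentiableAt
  -- At `t = ε` only continuity of `ρ` is available; the common compact support carries it over to
  -- the energy.
  have hEc : ContinuousOn E (Set.Icc ε T) := by
    refine continuousOn_integral_of_compact_support (f := fun t y => χ (y, t) * ρ (y, t))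
      (isCompact_closedBall (0 : E3) R) ?_ fun t y ht hy => ?_
    · have h1 : ContinuousOn (fun p => χ p * ρ p) {p | ε ≤ p.2} :=
        ((contDiffOn_coneWeight ℓ ε R).continuousOn.mono fun p hp => hε.trans_le hp).mul hρc
      exact h1.comp (f := fun q : ℝ × E3 => (q.2, q.1)) (by fun_prop) fun q hq => hq.1.1
    · rw [hχ, coneWeight_eq_zero hℓ hε (p := (y, t)) ht.1 (le_of_lt (by simpa using hy)), zero_mul]
  -- Gronwall's argument with the integrating factor `e^{-Kt}`; the sign of `K` plays no role.
  have hanti : AntitoneOn (fun t => E t * Real.exp (-K * t)) (Set.Icc ε T) := by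
    have hexp : ∀ t, HasDerivAt (fun t => Real.exp (-K * t)) (Real.exp (-K * t) * (-K * 1)) t :=
      fun t => ((hasDerivAt_id t).const_mul (-K)).exp
    refine antitoneOn_of_deriv_nonpos (convex_Icc ε T) (hEc.mul (by fun_prop)) ?_ ?_
    · rw [interior_Icc]
      intro t ht
      exact ((hEd t ht.1).mul (hexp t).differentiableAt).differentiableWithinAt
    · rw [interior_Icc]
      intro t ht
      have h1 := (hEd t ht.1).hasDerivAt.fun_mul (hexp t)
      rw [h1.deriv]
      have h2 := mul_le_mul_of_nonneg_right (hE' t ht.1) (Real.exp_pos (-K * t)).le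
      linarith
  have hEε : E ε = 0 := by simp [hE, hinit]
  have hET : E T ≤ 0 := by
    have h1 := hanti (Set.left_mem_Icc.2 hT.le) (Set.right_mem_Icc.2 hT.le) hT.le
    simp only [hEε, zero_mul] at h1
    exact nonpos_of_mul_nonpos_left h1 (Real.exp_pos _)
  -- If `ρ (x, T)` were nonzero, the continuous nonnegative integrand would be positive at `x` and
  -- the energy at `T` positive.
  by_contra hne
  refine absurd hET (not_le.2 ?_)
  refine Continuous.integral_pos_of_hasCompactSupport_nonneg_nonzero (x := x)
    (continuous_slice_afterTime hgd.continuousOn hT) (hasCompactSupport_slice hgR hT)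
    (fun y => mul_nonneg (hχ0 _) (hρ0 _)) (mul_ne_zero (ne_of_gt ?_) hne)
  refine expNegInvGlue.pos_of_pos ?_
  simp only [hRdef]
  linarith

end Energy

/-! ### Uniqueness for the Dirac equation -/

section Uniqueness

variable {ℓ ε : ℝ} {m : ℂ}

theorem abs_two_inner_le (a b : ℂ) : |2 * inner ℝ a b| ≤ ‖a‖ ^ 2 + ‖b‖ ^ 2 := by
  have h := abs_real_inner_le_norm a b
  rw [abs_mul, abs_two]
  nlinarith [sq_nonneg (‖a‖ - ‖b‖)]

/-- The current `Re (Ψ† γ⁰ γᵏ Ψ)` of the spinor with upper part `u` and lower part `w`. -/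
def diracCurrent (k : Fin 3) (u w : Fin 2 → ℂ) : ℝ := ∑ i, 2 * inner ℝ (u i) ((pauli k *ᵥ w) i)

/-- The Pauli matrices are unitary, so `2 |⟨u, σᵏ w⟩| ≤ |u|² + |w|²`. -/
theorem abs_diracCurrent_le (k : Fin 3) (u w : Fin 2 → ℂ) :
    |diracCurrent k u w| ≤ ∑ i, ‖u i‖ ^ 2 + ∑ i, ‖w i‖ ^ 2 := by
  have h : ∑ i, ‖(pauli k *ᵥ w) i‖ ^ 2 = ∑ i, ‖w i‖ ^ 2 := by
    fin_cases k <;> simp [pauli, Fin.sum_univ_two, Matrix.vecHead, Matrix.vecTail] <;> ring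
  rw [← h, ← Finset.sum_add_distrib]
  exact (Finset.abs_sum_le_sum_abs _ _).trans (Finset.sum_le_sum fun i _ => abs_two_inner_le _ _)

/-- The algebra behind the conservation law of the current for the Dirac equation. -/
theorem dirac_conservation_algebra {u w ut wt : Fin 2 → ℂ} {du dw : Fin 3 → Fin 2 → ℂ} {a b t : ℝ}
    (hu : ∀ i, I * ut i + I * a * pauliDot dw i + I * b * u i - m * (t : ℂ)⁻¹ * u i = 0)
    (hw : ∀ i, I * wt i + I * a * pauliDot du i + I * b * w i - (-m) * (t : ℂ)⁻¹ * w i = 0) :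
    ∑ i, 2 * inner ℝ (u i) (ut i) + ∑ i, 2 * inner ℝ (w i) (wt i) +
      a * ∑ k, (diracCurrent k (du k) w + diracCurrent k u (dw k)) =
    -2 * b * (∑ i, ‖u i‖ ^ 2 + ∑ i, ‖w i‖ ^ 2) +
      2 * m.im / t * (∑ i, ‖u i‖ ^ 2 - ∑ i, ‖w i‖ ^ 2) := by
  have hu' : ∀ i, ut i = -(a * pauliDot dw i) - b * u i - I * (m * (t : ℂ)⁻¹) * u i := fun i => by
    linear_combination (-I) * hu i + (ut i + a * pauliDot dw i + b * u i) * I_sq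
  have hw' : ∀ i, wt i = -(a * pauliDot du i) - b * w i + I * (m * (t : ℂ)⁻¹) * w i := fun i => by
    linear_combination (-I) * hw i + (wt i + a * pauliDot du i + b * w i) * I_sq
  -- Real multiples of `i z` are orthogonal to `z`, so only the imaginary part of `m` contributes.
  have hμ : ∀ z : ℂ, inner ℝ z (I * (m * (t : ℂ)⁻¹) * z) = -(m.im / t * ‖z‖ ^ 2) := fun z => by
    rw [Complex.inner, ← ofReal_inv, ← normSq_eq_norm_sq, normSq_apply]
    simp
    ring
  simp only [hu', hw', inner_add_right, inner_sub_right, inner_neg_right, hμ]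
  simp only [Fin.sum_univ_two, Fin.sum_univ_three, pauliDot_zero, pauliDot_one, diracCurrent,
    Complex.inner, pauli, ← normSq_eq_norm_sq, normSq_apply]
  simp [Matrix.vecHead, Matrix.vecTail]
  ring

theorem dirac_eq_zero (hℓ : ℓ ≠ 1) (hε : 0 < ε) {Ψ : E3 → ℝ → Spinor}
    (hΨ : IsCauchySolution ℓ m ε (fun _ _ => 0) (fun _ => 0) Ψ) (x : E3) {t : ℝ} (ht : ε < t) :
    Ψ x t = 0 := by
  set u : E3 × ℝ → Fin 2 → ℂ := fun p i => Ψ p.1 p.2 (Sum.inl i) with hu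
  set w : E3 × ℝ → Fin 2 → ℂ := fun p i => Ψ p.1 p.2 (Sum.inr i) with hw
  set ρ : E3 × ℝ → ℝ := fun p => ∑ i, ‖u p i‖ ^ 2 + ∑ i, ‖w p i‖ ^ 2 with hρ
  set J : Fin 3 → E3 × ℝ → ℝ := fun k p => diracCurrent k (u p) (w p) with hJ
  have hc := fun c => contDiffOn_pi.1 hΨ.contDiffOn c
  have hd : ∀ p ∈ afterTime ε, ∀ c, DifferentiableAt ℝ (fun p : E3 × ℝ => Ψ p.1 p.2 c) p :=
    fun p hp c => (hc c).differentiableAt_of_isOpen one_ne_zero (isOpen_afterTime ε) hp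
  have hpauli : ∀ k i, ContDiffOn ℝ 1 (fun p => (pauli k *ᵥ w p) i) (afterTime ε) := fun k i => by
    simp only [Matrix.mulVec, dotProduct]
    exact ContDiffOn.sum fun j _ => contDiffOn_const.mul (hc (Sum.inr j))
  have hpd : ∀ k i, ∀ p ∈ afterTime ε, ∀ v, fderiv ℝ (fun p => (pauli k *ᵥ w p) i) p v =
      (pauli k *ᵥ fun j => fderiv ℝ (fun p => w p j) p v) i := fun k i p hp v => by
    have h : HasFDerivAt (fun p => ∑ j, pauli k i j * w p j)
        (∑ j, pauli k i j • fderiv ℝ (fun p => w p j) p) p :=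
      HasFDerivAt.fun_sum fun j _ => (hd p hp (Sum.inr j)).hasFDerivAt.const_mul _
    refine (congrArg (fun L => L v) h.fderiv).trans ?_
    simp [Matrix.mulVec, dotProduct]
  have hJd : ∀ k, ∀ p ∈ afterTime ε, ∀ v, fderiv ℝ (J k) p v =
      diracCurrent k (fun j => fderiv ℝ (fun p => u p j) p v) (w p) +
      diracCurrent k (u p) (fun j => fderiv ℝ (fun p => w p j) p v) := fun k p hp v => by
    have hpk := fun i => (hpauli k i).differentiableAt_of_isOpen one_ne_zero (isOpen_afterTime ε) hp
    have h : HasFDerivAt (J k) (∑ i, (2 : ℝ) • fderiv ℝ (fun p => inner ℝ (u p i)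
        ((pauli k *ᵥ w p) i)) p) p :=
      HasFDerivAt.fun_sum fun i _ =>
        ((hd p hp (Sum.inl i)).inner ℝ (hpk i)).hasFDerivAt.const_mul 2
    rw [h.fderiv, diracCurrent, diracCurrent, ← Finset.sum_add_distrib,
      _root_.sum_apply]
    refine Finset.sum_congr rfl fun i _ => ?_
    rw [_root_.smul_apply, fderiv_inner_apply ℝ (hd p hp (Sum.inl i)) (hpk i), hpd k i p hp,
      smul_eq_mul]
    ring
  have hρd : ∀ p ∈ afterTime ε, ∀ v, fderiv ℝ ρ p v =
      ∑ i, 2 * inner ℝ (u p i) (fderiv ℝ (fun p => u p i) p v) +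
      ∑ i, 2 * inner ℝ (w p i) (fderiv ℝ (fun p => w p i) p v) := fun p hp v => by
    have h : HasFDerivAt ρ _ p :=
      (HasFDerivAt.fun_sum (u := Finset.univ) fun i _ =>
        (hd p hp (Sum.inl i)).hasFDerivAt.norm_sq).add
      (HasFDerivAt.fun_sum (u := Finset.univ) fun i _ =>
        (hd p hp (Sum.inr i)).hasFDerivAt.norm_sq)
    refine (congrArg (fun L => L v) h.fderiv).trans ?_
    simp [hu, hw]
    ring
  have hz : ρ (x, t) = 0 := by
    -- The production is `-3ℓ t⁻¹ ρ + 2 (Im m) t⁻¹ (|u|² - |w|²)`, and `1/t ≤ 1/ε`; this gives `K`.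
    refine eq_zero_of_local_conservation hℓ hε (J := J) (K := (3 * |ℓ| + 2 * |m.im|) / ε)
      ?_ ?_ ?_ ?_ ?_ ?_ ?_ x ht
    · have hcc := fun c => continuousOn_pi.1 hΨ.continuousOn c
      exact (continuousOn_finsetSum _ fun i _ => (hcc (Sum.inl i)).norm.pow 2).add
        (continuousOn_finsetSum _ fun i _ => (hcc (Sum.inr i)).norm.pow 2)
    · exact (ContDiffOn.sum fun i _ => (hc (Sum.inl i)).norm_sq ℝ).add
        (ContDiffOn.sum fun i _ => (hc (Sum.inr i)).norm_sq ℝ)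
    · exact fun k => ContDiffOn.sum fun i _ =>
        contDiffOn_const.mul ((hc (Sum.inl i)).inner ℝ (hpauli k i))
    · intro p
      positivity
    · exact fun k p _ => abs_diracCurrent_le k (u p) (w p)
    · intro y
      simp [hρ, hu, hw, hΨ.initial y]
    · intro p hp
      have hp0 : 0 < p.2 := hε.trans hp
      have he := hΨ.equation p.1 p.2 hp
      have heU : ∀ i, I * fderiv ℝ (fun p => u p i) p (0, 1) + I * ((p.2 ^ (-ℓ) : ℝ) : ℂ) *
          pauliDot (fun k j => fderiv ℝ (fun p => w p j) p (basisVec k, 0)) i +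
          I * ((3 * ℓ / (2 * p.2) : ℝ) : ℂ) * u p i - m * (p.2 : ℂ)⁻¹ * u p i = 0 := fun i => by
        have := congrFun he (Sum.inl i)
        rw [diracOp_inl, deriv_scaleFactor_div hp0, one_div_scaleFactor hp0, dT_apply (hd p hp)]
          at this
        simp only [dX_apply (hd p hp)] at this
        exact this
      have heL : ∀ i, I * fderiv ℝ (fun p => w p i) p (0, 1) + I * ((p.2 ^ (-ℓ) : ℝ) : ℂ) *
          pauliDot (fun k j => fderiv ℝ (fun p => u p j) p (basisVec k, 0)) i +
          I * ((3 * ℓ / (2 * p.2) : ℝ) : ℂ) * w p i - (-m) * (p.2 : ℂ)⁻¹ * w p i = 0 := fun i => by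
        have := congrFun he (Sum.inr i)
        rw [diracOp_inr, deriv_scaleFactor_div hp0, one_div_scaleFactor hp0, dT_apply (hd p hp)]
          at this
        simp only [dX_apply (hd p hp)] at this
        exact neg_eq_zero.1 this
      have halg := dirac_conservation_algebra heU heL
      simp only [hJd _ p hp]
      rw [hρd p hp, halg]
      have hA : 0 ≤ ∑ i, ‖u p i‖ ^ 2 := by positivity
      have hB : 0 ≤ ∑ i, ‖w p i‖ ^ 2 := by positivity
      have hr : ρ p = ∑ i, ‖u p i‖ ^ 2 + ∑ i, ‖w p i‖ ^ 2 := rfl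
      rw [hr]
      generalize ∑ i, ‖u p i‖ ^ 2 = A at *
      generalize ∑ i, ‖w p i‖ ^ 2 = B at *
      have h1 : -ℓ * (A + B) ≤ |ℓ| * (A + B) :=
        mul_le_mul_of_nonneg_right (neg_le_abs ℓ) (add_nonneg hA hB)
      have h2 : m.im * (A - B) ≤ |m.im| * (A + B) := by
        nlinarith [neg_abs_le m.im, le_abs_self m.im]
      calc _ = (3 * (-ℓ * (A + B)) + 2 * (m.im * (A - B))) / p.2 := by
            field_simp
        _ ≤ (3 * (|ℓ| * (A + B)) + 2 * (|m.im| * (A + B))) / p.2 := by gcongr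
        _ ≤ (3 * (|ℓ| * (A + B)) + 2 * (|m.im| * (A + B))) / ε := by
            have := le_of_lt (show ε < p.2 from hp)
            gcongr
        _ = _ := by ring
  have hz' : (∑ i, ‖u (x, t) i‖ ^ 2) = 0 ∧ (∑ i, ‖w (x, t) i‖ ^ 2) = 0 :=
    (add_eq_zero_iff_of_nonneg (by positivity) (by positivity)).1 hz
  funext c
  rcases c with i | i
  · have := (Finset.sum_eq_zero_iff_of_nonneg fun i _ => by positivity).1 hz'.1 i (Finset.mem_univ i)
    simpa [hu] using this
  · have := (Finset.sum_eq_zero_iff_of_nonneg fun i _ => by positivity).1 hz'.2 i (Finset.mem_univ i)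
    simpa [hw] using this

theorem IsCauchySolution.sub {F : E3 → ℝ → Spinor} {Ψε : E3 → Spinor} {Ψ Ψ' : E3 → ℝ → Spinor}
    (h : IsCauchySolution ℓ m ε F Ψε Ψ) (h' : IsCauchySolution ℓ m ε F Ψε Ψ') :
    IsCauchySolution ℓ m ε (fun _ _ => 0) (fun _ => 0) (fun x t => Ψ x t - Ψ' x t) where
  continuousOn := h.continuousOn.sub h'.continuousOn
  contDiffOn := h.contDiffOn.sub h'.contDiffOn
  equation x t ht := by
    have hd : ∀ {Ψ : E3 → ℝ → Spinor}, IsCauchySolution ℓ m ε F Ψε Ψ →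
        HasFDerivAt (fun p : E3 × ℝ => Ψ p.1 p.2)
          (fderiv ℝ (fun p : E3 × ℝ => Ψ p.1 p.2) (x, t)) (x, t) := fun {Ψ} hΨ =>
      (hΨ.contDiffOn.differentiableAt_of_isOpen one_ne_zero (isOpen_afterTime ε)
        (show (x, t) ∈ afterTime ε from ht)).hasFDerivAt
    have hT : ∀ {Ψ : E3 → ℝ → Spinor}, IsCauchySolution ℓ m ε F Ψε Ψ →
        DifferentiableAt ℝ (fun s => Ψ x s) t := fun {Ψ} hΨ =>
      ((hd hΨ).comp_hasDerivAt (f := fun s => (x, s)) t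
        ((hasDerivAt_const t x).prodMk (hasDerivAt_id t))).differentiableAt
    have hX : ∀ {Ψ : E3 → ℝ → Spinor}, IsCauchySolution ℓ m ε F Ψε Ψ →
        DifferentiableAt ℝ (fun y => Ψ y t) x := fun {Ψ} hΨ =>
      ((hd hΨ).comp (f := fun y => (y, t)) x (hasFDerivAt_prodMk_left x t)).differentiableAt
    have h1 : dT (fun x t => Ψ x t - Ψ' x t) x t = dT Ψ x t - dT Ψ' x t :=
      deriv_fun_sub (hT h) (hT h')
    have h2 : ∀ k, dX k (fun x t => Ψ x t - Ψ' x t) x t = dX k Ψ x t - dX k Ψ' x t := fun k => by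
      simp only [dX]
      rw [(hX h).lineDeriv_eq_fderiv, (hX h').lineDeriv_eq_fderiv,
        ((hX h).fun_sub (hX h')).lineDeriv_eq_fderiv, fderiv_fun_sub (hX h) (hX h')]
      rfl
    have h3 : diracOp ℓ m (fun x t => Ψ x t - Ψ' x t) x t =
        diracOp ℓ m Ψ x t - diracOp ℓ m Ψ' x t := by
      simp only [diracOp, h1, h2, Matrix.mulVec_sub, smul_sub, Finset.sum_sub_distrib]
      abel
    rw [h3, h.equation x t ht, h'.equation x t ht, sub_self]
  initial x := by rw [h.initial, h'.initial, sub_self]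

theorem IsCauchySolution.eq_of_lt (hℓ : ℓ ≠ 1) (hε : 0 < ε) {F : E3 → ℝ → Spinor}
    {Ψε : E3 → Spinor} {Ψ Ψ' : E3 → ℝ → Spinor} (h : IsCauchySolution ℓ m ε F Ψε Ψ)
    (h' : IsCauchySolution ℓ m ε F Ψε Ψ') (x : E3) {t : ℝ} (ht : ε < t) : Ψ x t = Ψ' x t :=
  sub_eq_zero.1 (dirac_eq_zero hℓ hε (h.sub h') x ht)

/-- The conditions see only times `t ≥ ε`: at `t > ε` the operator uses values at nearby times,
which are again after `ε`. -/
theorem IsCauchySolution.congr {F : E3 → ℝ → Spinor} {Ψε : E3 → Spinor} {Ψ Ψ' : E3 → ℝ → Spinor}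
    (h : IsCauchySolution ℓ m ε F Ψε Ψ) (h0 : ∀ x, Ψ' x ε = Ψε x)
    (he : ∀ x t, ε < t → Ψ' x t = Ψ x t) : IsCauchySolution ℓ m ε F Ψε Ψ' where
  continuousOn := h.continuousOn.congr fun p hp => by
    rcases eq_or_lt_of_le (show ε ≤ p.2 from hp) with h1 | h1
    · simp only [← h1, h0, h.initial]
    · exact he p.1 p.2 h1
  contDiffOn := h.contDiffOn.congr fun p hp => he p.1 p.2 hp
  equation x t ht := by
    have hT : dT Ψ' x t = dT Ψ x t := by
      refine Filter.EventuallyEq.deriv_eq ?_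
      filter_upwards [lt_mem_nhds ht] with s hs
      exact he x s hs
    have hX : ∀ k, dX k Ψ' x t = dX k Ψ x t := fun k => by
      have : (fun y => Ψ' y t) = fun y => Ψ y t := funext fun y => he y t ht
      rw [dX, this, dX]
    rw [← h.equation x t ht]
    simp only [diracOp, hT, hX, he x t ht]
  initial := h0

end Uniqueness

/-- Spinor fields are total functions of `t`, while the Cauchy problem ignores `t < ε`. Existence
and uniqueness are therefore combined in an equivalence that fixes the values for `t ≥ ε` and no
others. -/
theorem theorem3 (ℓ : ℝ) (hℓ : ℓ ≠ 1) (m : ℂ) (ε : ℝ) (hε : 0 < ε)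
    (F : E3 → ℝ → Spinor) (hF : ContDiff ℝ ∞ (fun p : E3 × ℝ => F p.1 p.2))
    (Ψε : E3 → Spinor) (hΨε : ContDiff ℝ ∞ Ψε) :
    IsWaveFundamentalSolution waveFundamental ∧
    ContDiffOn ℝ 2 (fun p : E3 × ℝ => potential ℓ ε m F Ψε p.1 p.2) {p | ε < p.2} ∧
    ∀ Ψ : E3 → ℝ → Spinor,
      IsCauchySolution ℓ m ε F Ψε Ψ ↔
        (∀ x, Ψ x ε = Ψε x) ∧
        ∀ x t, ε < t → Ψ x t = diracCo ℓ m (potential ℓ ε m F Ψε) x t := by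
  have hsol := isCauchySolution_diracCo_potential hℓ hε m hF hΨε
  refine ⟨isWaveFundamentalSolution_waveFundamental, ?_, fun Ψ => ⟨fun h => ⟨h.initial, ?_⟩, ?_⟩⟩
  · exact ((contDiffOn_potential hℓ hε m hF hΨε).mono fun p hp => hε.trans hp).of_le
      (WithTop.coe_le_coe.2 (le_top : (2 : ℕ∞) ≤ ⊤))
  · exact fun x t ht => h.eq_of_lt hℓ hε hsol x ht
  · rintro ⟨h0, he⟩
    exact hsol.congr h0 he

end
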